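/- \textbf{Setting.} Let $Q^+\subset\mathbb R^2$ be the convex hull of the points $P_n=(n,n^2)$, $n\in\mathbb Z$, and let $Q^-=-Q^+$ be its image under the rotation by $\pi$. Let $S_1$ be the translation surface obtained from $Q^+\sqcup Q^-$ by identifying, for each $n\in\mathbb Z$, the edge $\overline{P_nP_{n+1}}$ of $Q^+$ with its image edge $-\overline{P_nP_{n+1}}$ of $Q^-$ by the translation that takes the one to the other. Let $\Sigma$ be the set of cone singularities of $S_1$, i.e. the points represented by the vertices. The surface carries the path metric and the area measure induced from the plane. A direction of slope $m\in\mathbb R\cup\{\infty\}$ is given by a unit vector $u$ of slope $m$ (either of the two). A trajectory in direction $u$ is a unit speed straight curve in $S_1\smallsetminus\Sigma$ with velocity $u$, defined on a maximal open interval of times. It is singular in forward (resp. backward) time if it runs into a point of $\Sigma$ in finite forward (resp. backward) time; it is a saddle connection if both happen; it is closed if it is defined for all times and periodic. A decomposition of $S_1$ in direction $u$ is a family of pairwise disjoint open subsets whose closures cover $S_1$, such that every point of $S_1\smallsetminus\Sigma$ in none of them lies on a trajectory in direction $u$ that is singular in forward or backward time. The geodesic flow in direction $u$ is recurrent if for every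 measurable $A\subset S_1$ the trajectory in direction $u$ of almost every point of $A$ returns to $A$ at arbitrarily large times. For fractions, $\frac pq\equiv\frac{p'}{q'}\pmod 2$ means that, when both are reduced, $p\equiv p'$ and $q\equiv q'\pmod 2$; the slope $\infty=\frac10$ counts as rational. \textbf{Corollary (A trichotomy).} Let $m\in\mathbb R\cup\{\infty\}$ be a slope. Then the geodesic flow in direction $m$ on $S_1$ satisfies the following. \begin{itemize} \item If $m=\frac pq$ is rational and $\frac pq\equiv\frac01$ or $\frac pq\equiv\frac11\pmod 2$, then $m$ is a completely periodic direction. That is, there is a decomposition of $S_1$ into open Euclidean cylinders in this direction, and every trajectory in this direction is closed or a saddle connection. \item If $m=\frac pq$ is rational and $\frac pq\equiv\frac10\pmod 2$, then there is a decomposition of $S_1$ into infinite strips in this direction, each isometric (in its intrinsic metric) to $I\times\mathbb R$ with $I\subset\mathbb R$ a nonempty bounded open interval. Every trajectory in this direction is singular in at most one of forward and backward time. Any trajectory that is not singular in forward (resp. backward) time eventually leaves every compact subset of $S_1$ and never returns, in forward (resp. backward) time. \item If $m$ is irrational, then the geodesic flow in this direction is recurrent. However, there are no closed trajectories and no saddle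 connections in this direction. \end{itemize} -/

import Mathlib

noncomputable section

namespace ParabolaSurface

open Set Filter Topology MeasureTheory
open scoped ENNReal

/-! The Euclidean plane is modelled by `ℂ`, the point `(x, y)` being `x + i y`. -/

/-- The integer point `(n, n²)` of the parabola `y = x²`. -/
def vertex (n : ℤ) : ℂ := ⟨(n : ℝ), (n : ℝ) ^ 2⟩

/-- The two polygons: `poly true` is `Q⁺`, the convex hull of the points `(n, n²)`, `n ∈ ℤ`, and
`poly false` is `Q⁻`, the image of `Q⁺` under the rotation by `π`. -/
def poly : Bool → Set ℂ
  | true => convexHull ℝ (range vertex)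
  | false => {z | -z ∈ convexHull ℝ (range vertex)}

/-- The disjoint union of the two polygons. -/
abbrev Piece : Type := (s : Bool) × poly s

/-- The edge of `Q⁺` from `(n, n²)` to `(n + 1, (n + 1)²)`. -/
def edge (n : ℤ) : Set ℂ := segment ℝ (vertex n) (vertex (n + 1))

/-- The edge `edge n` of `Q⁺` differs from its image `-edge n` in `Q⁻` by this translation:
`-edge n = edge n - offset n`. -/
def offset (n : ℤ) : ℂ := vertex n + vertex (n + 1)

/-- The edge identifications: a point of `edge n` in `Q⁺` is identified with its image under
the translation taking `edge n` to the edge `-edge n` of `Q⁻`. -/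
def Glue (x y : Piece) : Prop :=
  x.1 = true ∧ y.1 = false ∧ ∃ n : ℤ, (x.2 : ℂ) ∈ edge n ∧ (y.2 : ℂ) = (x.2 : ℂ) - offset n

/-- The translation surface `S₁`: the quotient of `Q⁺ ⊔ Q⁻` by the equivalence relation generated
by the edge identifications. -/
def S1 : Type := Quot Glue

/-- The point of `S₁` represented by the point `z` of the polygon `poly s`. -/
def point (s : Bool) (z : poly s) : S1 := Quot.mk Glue ⟨s, z⟩

/-- The set `Σ` of cone singularities: the points of `S₁` represented by vertices. -/
def singularities : Set S1 :=
  {x | ∃ (s : Bool) (z : poly s), x = point s z ∧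
    ((z : ℂ) ∈ range vertex ∨ -(z : ℂ) ∈ range vertex)}

/-! ### The metric: infimum of the lengths of broken paths, each leg a segment in one polygon -/

/-- The least Euclidean distance between representatives of `x` and `y` in a common polygon
(`∞` if there are none). -/
def legDist (x y : S1) : ℝ≥0∞ :=
  ⨅ (s : Bool) (z : poly s) (w : poly s) (_ : point s z = x) (_ : point s w = y),
    edist (z : ℂ) (w : ℂ)

/-- The metric of `S₁`. Since the two polygons are convex this is the path metric induced by the
Euclidean metrics of the polygons. -/
def pathDist (x y : S1) : ℝ≥0∞ :=
  ⨅ (n : ℕ) (c : ℕ → S1) (_ : c 0 = x) (_ : c n = y), ∑ i ∈ Finset.range n, legDist (c i) (c (i + 1))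

theorem legDist_comm (x y : S1) : legDist x y = legDist y x := by
  have h : ∀ x y : S1, legDist x y ≤ legDist y x := by
    intro x y
    refine le_iInf fun s => le_iInf fun z => le_iInf fun w => le_iInf fun hz => le_iInf fun hw => ?_
    rw [edist_comm]
    exact iInf_le_of_le s (iInf_le_of_le w (iInf_le_of_le z (iInf_le_of_le hw
      (iInf_le_of_le hz le_rfl))))
  exact le_antisymm (h x y) (h y x)

theorem pathDist_self (x : S1) : pathDist x x = 0 := by
  refine le_antisymm ?_ bot_le
  exact iInf_le_of_le 0 (iInf_le_of_le (fun _ => x) (iInf_le_of_le rfl (iInf_le_of_le rfl (by simp))))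

theorem pathDist_comm (x y : S1) : pathDist x y = pathDist y x := by
  have h : ∀ x y : S1, pathDist x y ≤ pathDist y x := by
    intro x y
    refine le_iInf fun n => le_iInf fun c => le_iInf fun h0 => le_iInf fun hn => ?_
    refine iInf_le_of_le n (iInf_le_of_le (fun i => c (n - i)) (iInf_le_of_le (by simpa using hn)
      (iInf_le_of_le (by simpa using h0) ?_)))
    rw [← Finset.sum_range_reflect]
    refine Finset.sum_le_sum fun i hi => ?_
    have hi' : i < n := Finset.mem_range.1 hi
    have e1 : n - (n - 1 - i) = i + 1 := by omega
    have e2 : n - (n - 1 - i + 1) = i := by omega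
    simp only [e1, e2]
    exact (legDist_comm _ _).le
  exact le_antisymm (h x y) (h y x)

theorem pathDist_triangle (x y z : S1) : pathDist x z ≤ pathDist x y + pathDist y z := by
  have key : ∀ (n : ℕ) (c : ℕ → S1) (_ : c 0 = x) (_ : c n = y) (m : ℕ) (d : ℕ → S1)
      (_ : d 0 = y) (_ : d m = z), pathDist x z ≤
        (∑ i ∈ Finset.range n, legDist (c i) (c (i + 1)))
          + ∑ i ∈ Finset.range m, legDist (d i) (d (i + 1)) := by
    intro n c hc0 hcn m d hd0 hdm
    let e : ℕ → S1 := fun i => if i ≤ n then c i else d (i - n)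
    have he : ∀ j, e (n + j) = d j := by
      intro j
      rcases Nat.eq_zero_or_pos j with rfl | hj
      · simp [e, hcn, hd0]
      · have : ¬ n + j ≤ n := by omega
        simp [e, this]
    refine iInf_le_of_le (n + m) (iInf_le_of_le e (iInf_le_of_le (by simp [e, hc0])
      (iInf_le_of_le (by rw [he, hdm]) ?_)))
    rw [Finset.sum_range_add]
    refine add_le_add (Finset.sum_le_sum fun i hi => ?_) (Finset.sum_le_sum fun i _ => ?_)
    · have hi' : i < n := Finset.mem_range.1 hi
      have h1 : i ≤ n := by omega
      have h2 : i + 1 ≤ n := by omega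
      simp [e, h1, h2]
    · rw [add_assoc, he, he]
  rw [pathDist.eq_def x y, pathDist.eq_def y z]
  simp only [ENNReal.iInf_add, ENNReal.add_iInf]
  exact le_iInf fun m => le_iInf fun d => le_iInf fun g0 => le_iInf fun gm =>
    le_iInf fun n => le_iInf fun c => le_iInf fun h0 => le_iInf fun hn => key n c h0 hn m d g0 gm

instance : PseudoEMetricSpace S1 where
  edist := pathDist
  edist_self := pathDist_self
  edist_comm := pathDist_comm
  edist_triangle := pathDist_triangle

/-! ### The area measure -/

/-- A subset of `S₁` is measurable when its traces on the two polygons are Borel. -/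
instance : MeasurableSpace S1 := inferInstanceAs (MeasurableSpace (Quot Glue))

theorem measurable_point (s : Bool) : Measurable (point s) := by
  have h1 : Measurable (fun z : poly s => (⟨s, z⟩ : Piece)) := by
    intro t ht
    exact MeasurableSpace.measurableSet_iInf.1 ht s
  exact fun t ht => h1 ht

/-- The area on `S₁`: the sum of the Lebesgue measures of the two polygons. -/
def area : Measure S1 :=
  Measure.sum fun s : Bool => Measure.map (point s) (Measure.comap ((↑) : poly s → ℂ) volume)

/-! ### The translation structure of `S₁ ∖ Σ` -/

/-- `Q⁺` and the translate of `Q⁻` adjacent to it along `edge n` are two convex sets that lie on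
different sides of that edge. The interior of their union consists of the two open polygons
and the open edge between them. It is the domain of the `n`-th translation chart. -/
def chartDomain (n : ℤ) : Set ℂ := interior (poly true ∪ {z | z - offset n ∈ poly false})

/-- `x` is the point of `S₁` that the `n`-th chart assigns to the point `z` of the plane. (On the
common edge the two alternatives give the same point of `S₁`.) -/
def ChartEq (n : ℤ) (z : ℂ) (x : S1) : Prop :=
  (∃ h : z ∈ poly true, x = point true ⟨z, h⟩) ∨
    (∃ h : z - offset n ∈ poly false, x = point false ⟨z - offset n, h⟩)

/-- `f` restricted to the open set `U` of the plane is a local isometry to `S₁ ∖ Σ` that preserves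
directions: near every point it is a translation followed by one of the charts. -/
def IsTranslationMap (f : ℂ → S1) (U : Set ℂ) : Prop :=
  ∀ z ∈ U, ∃ (n : ℤ) (a : ℂ), a ∈ chartDomain n ∧ ∀ᶠ w in 𝓝 z, ChartEq n (a + (w - z)) (f w)

/-- On the open set `J` of times, the curve `γ` stays in `S₁ ∖ Σ` and is locally a straight line
traversed with the velocity vector `u`. -/
def IsStraight (u : ℂ) (J : Set ℝ) (γ : ℝ → S1) : Prop :=
  ∀ t ∈ J, ∃ (n : ℤ) (a : ℂ), a ∈ chartDomain n ∧
    ∀ᶠ t' in 𝓝 t, ChartEq n (a + ((t' - t : ℝ) : ℂ) * u) (γ t')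

/-- A trajectory of the geodesic flow in the direction `u`: a curve in `S₁ ∖ Σ`, straight with
velocity `u`, on a maximal open interval `J` of times. (The values of `γ` outside `J` are
irrelevant.) -/
structure IsTrajectory (u : ℂ) (J : Set ℝ) (γ : ℝ → S1) : Prop where
  nonempty : J.Nonempty
  isOpen : IsOpen J
  ordConnected : J.OrdConnected
  straight : IsStraight u J γ
  maximal : ∀ (J' : Set ℝ) (γ' : ℝ → S1), IsOpen J' → J'.OrdConnected → J ⊆ J' →
    EqOn γ γ' J → IsStraight u J' γ' → J' ⊆ J

/-- The trajectory runs into a cone singularity in finite forward time. -/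
def SingularForward (J : Set ℝ) (γ : ℝ → S1) : Prop :=
  ∃ b : ℝ, IsLUB J b ∧ ∃ p ∈ singularities, Tendsto γ (𝓝[<] b) (𝓝 p)

/-- The trajectory runs into a cone singularity in finite backward time. -/
def SingularBackward (J : Set ℝ) (γ : ℝ → S1) : Prop :=
  ∃ a : ℝ, IsGLB J a ∧ ∃ p ∈ singularities, Tendsto γ (𝓝[>] a) (𝓝 p)

/-- The trajectory is a saddle connection: it joins singularities, at both of its ends. -/
def IsSaddleConnection (J : Set ℝ) (γ : ℝ → S1) : Prop :=
  SingularForward J γ ∧ SingularBackward J γ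

/-- The trajectory is closed: it is defined for all times and periodic. -/
def IsClosedTrajectory (J : Set ℝ) (γ : ℝ → S1) : Prop :=
  J = univ ∧ ∃ T : ℝ, 0 < T ∧ Function.Periodic γ T

/-! ### Cylinders, strips and decompositions -/

/-- The open strip of width `w` in the direction `u` in the plane, that is the set of points
`u * (t + i s)` with `t` real and `0 < s < w`. For a unit vector `u` it is isometric to
`(0, w) × ℝ`. -/
def planeStrip (u : ℂ) (w : ℝ) : Set ℂ := {z | 0 < (z / u).im ∧ (z / u).im < w}

/-- `C` is an open Euclidean cylinder in the direction `u` on `S₁`: for some width `w > 0` and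
circumference `c > 0`, it is an isometric image, respecting directions, of the quotient
of a strip of width `w` in the direction `u` by the translation by `c * u`. -/
def IsCylinder (u : ℂ) (C : Set S1) : Prop :=
  ∃ (w c : ℝ) (f : ℂ → S1), 0 < w ∧ 0 < c ∧ IsTranslationMap f (planeStrip u w) ∧
    (∀ z ∈ planeStrip u w, ∀ z' ∈ planeStrip u w,
      f z = f z' ↔ ∃ k : ℤ, z' - z = (k : ℂ) * (c : ℂ) * u) ∧
    C = f '' planeStrip u w

/-- `C` is an open infinite strip in the direction `u` on `S₁`: for some `w > 0`, it is an isometric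
image (for the intrinsic metric), respecting directions, of a strip `(0, w) × ℝ`. -/
def IsInfiniteStrip (u : ℂ) (C : Set S1) : Prop :=
  ∃ (w : ℝ) (f : ℂ → S1), 0 < w ∧ IsTranslationMap f (planeStrip u w) ∧
    InjOn f (planeStrip u w) ∧ C = f '' planeStrip u w

/-- The sets in `𝒞` decompose `S₁` in the direction `u`: they are pairwise disjoint, their
closures cover `S₁`, and every nonsingular point that is in none of them is on a trajectory in
the direction `u` that is singular. -/
def IsDecomposition (u : ℂ) (𝒞 : Set (Set S1)) : Prop :=
  𝒞.PairwiseDisjoint id ∧ (⋃ C ∈ 𝒞, closure C) = univ ∧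
    ∀ x : S1, x ∉ singularities → x ∉ ⋃₀ 𝒞 →
      ∃ (J : Set ℝ) (γ : ℝ → S1), IsTrajectory u J γ ∧ (∃ t ∈ J, γ t = x) ∧
        (SingularForward J γ ∨ SingularBackward J γ)

/-- The direction `u` is completely periodic: `S₁` decomposes into cylinders in this direction and
every trajectory is closed or a saddle connection. -/
def IsCompletelyPeriodic (u : ℂ) : Prop :=
  (∃ 𝒞 : Set (Set S1), (∀ C ∈ 𝒞, IsCylinder u C) ∧ IsDecomposition u 𝒞) ∧
    ∀ (J : Set ℝ) (γ : ℝ → S1), IsTrajectory u J γ → IsClosedTrajectory J γ ∨ IsSaddleConnection J γ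

/-- In forward time the trajectory eventually leaves every compact set and never returns. -/
def EscapesForward (J : Set ℝ) (γ : ℝ → S1) : Prop :=
  ∀ K : Set S1, IsCompact K → ∃ T ∈ J, ∀ t ∈ J, T ≤ t → γ t ∉ K

/-- In backward time the trajectory eventually leaves every compact set and never returns. -/
def EscapesBackward (J : Set ℝ) (γ : ℝ → S1) : Prop :=
  ∀ K : Set S1, IsCompact K → ∃ T ∈ J, ∀ t ∈ J, t ≤ T → γ t ∉ K

/-- The geodesic flow in the direction `u` is recurrent: for every measurable set `A`, the trajectory
of almost every point of `A` returns to `A` at arbitrarily large times. -/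
def IsRecurrent (u : ℂ) : Prop :=
  ∀ A : Set S1, MeasurableSet A → ∀ᵐ x ∂area, x ∈ A →
    ∃ (J : Set ℝ) (γ : ℝ → S1), IsTrajectory u J γ ∧ 0 ∈ J ∧ γ 0 = x ∧
      ∀ T : ℝ, ∃ t ∈ J, T < t ∧ γ t ∈ A

/-! ### Slopes -/

open Classical in
/-- The fraction `y / x` as an element of `ℝ ∪ {∞}`, with the convention `y / 0 = ∞`. It is used for
`(x, y) ≠ (0, 0)` only. -/
def frac (y x : ℝ) : OnePoint ℝ := if x = 0 then OnePoint.infty else ((y / x : ℝ) : OnePoint ℝ)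

/-- The slope of a nonzero vector of the plane. -/
def slope (u : ℂ) : OnePoint ℝ := frac u.im u.re

/-- `m` is the rational slope `p / q` (in lowest terms) with `p ≡ p'` and `q ≡ q'` modulo `2`.
The slope `∞ = 1 / 0` is rational. -/
def IsRationalCongr (m : OnePoint ℝ) (p' q' : ℤ) : Prop :=
  ∃ p q : ℤ, IsCoprime p q ∧ m = frac p q ∧ p ≡ p' [ZMOD 2] ∧ q ≡ q' [ZMOD 2]

end ParabolaSurface

end

noncomputable section

namespace ParabolaSurface

open Set Filter Topology MeasureTheory
open scoped ENNReal


/-! ### The polygon as an epigraph, and the chart domains in coordinates -/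

section

/-! The proof rests on three kinds of affine automorphisms of `S1`. The symmetry `P_n ↦ P_{n+k}` of
the parabola gives the linear part `(x, y) ↦ (x, y + 2kx)` (`affineAut_slide`). The horizontal
cylinders all have circumference equal to twice their height, so one can twist in all of them at
once with the linear part `(x, y) ↦ (x + 2ey, y)` (`affineAut_twist`). The rotation that exchanges
the polygons has linear part `-1` (`affineAut_swap`). All notions in the theorem are transported by
affine automorphisms.

Rational slopes: the Euclidean algorithm with even quotients takes a primitive integer vector to its
reduction modulo `2` (`liftable_of_isCoprime`), which leaves the slopes `0`, `1` and `∞`. In slopes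
`0` and `1` the lines through the vertices cut the surface into explicit cylinders
(`isCompletelyPeriodic_dir`). In the vertical direction they cut it into the strips over the edges,
and heights tend to infinity along the strips (`isStripDirection_I`).

Irrational slopes: the gluing translations and the vertices are integral, so a point of `S1` has a
class in `ℂ ⧸ lat`, which moves linearly along a straight curve and is `0` at singularities. A
closed trajectory or a saddle connection would give a nonzero lattice vector parallel to `u`. A line
that misses the lattice is a trajectory defined for all times, so the flow exists almost everywhere
and preserves area.

Recurrence does not follow from Poincaré's theorem, as the area is infinite. The criterion
`conservative_of_small_exit` asks for sets `F` of finite area, containing a prescribed low part of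
the surface, out of which little area flows in unit time. Such an `F` is the image of a low part
under an affine automorphism that takes a nearly horizontal vector `v` to `u`. Leaving the part at
level `N` in direction `v` requires starting in a collar of area `O(N |v.im|)`
(`mem_collar_of_exit`, `area_collar_le`). A continued fraction algorithm with even quotients
(`State.exists_small`) makes `|v.im|` small faster than the level `N` grows. -/

@[simp] theorem vertex_re (n : ℤ) : (vertex n).re = n := rfl
@[simp] theorem vertex_im (n : ℤ) : (vertex n).im = (n : ℝ) ^ 2 := rfl

/-- The line through `(k, k²)` and `(k + 1, (k + 1)²)`. -/
def chord (k : ℤ) (x : ℝ) : ℝ := (2 * k + 1) * x - k * (k + 1)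

/-- The piecewise linear function whose epigraph is `Q⁺`. -/
def profile (x : ℝ) : ℝ := x ^ 2 + Int.fract x * (1 - Int.fract x)

theorem profile_eq_floor (x : ℝ) : profile x = chord ⌊x⌋ x := by
  have := Int.self_sub_floor x
  rw [profile, chord, ← this]; ring

/-- Since `chord k x = x² - (x - k)(x - k - 1)`, the largest chord at `x` is the one whose edge lies
over `x`. -/
theorem chord_le_profile (k : ℤ) (x : ℝ) : chord k x ≤ profile x := by
  rw [profile_eq_floor]
  have h0 := Int.floor_le x
  have h1 := Int.lt_floor_add_one x
  set j := ⌊x⌋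
  unfold chord
  rcases lt_trichotomy k j with h | h | h
  · have : (k : ℝ) + 1 ≤ j := by exact_mod_cast h
    nlinarith
  · rw [h]
  · have : (j : ℝ) + 1 ≤ k := by exact_mod_cast h
    nlinarith

theorem profile_eq {k : ℤ} {x : ℝ} (h0 : (k : ℝ) ≤ x) (h1 : x ≤ k + 1) :
    profile x = chord k x := by
  refine le_antisymm ?_ (chord_le_profile k x)
  rw [profile_eq_floor]
  rcases h1.lt_or_eq with h | h
  · rw [Int.floor_eq_iff.2 ⟨h0, h⟩]
  · have : ⌊x⌋ = k + 1 := by rw [h]; simp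
    rw [this, h]; unfold chord; push_cast; apply le_of_eq; ring

theorem profile_int (k : ℤ) : profile k = (k : ℝ) ^ 2 := by
  rw [profile_eq (k := k) le_rfl (by linarith)]; unfold chord; ring

theorem continuous_profile : Continuous profile := by
  have : Continuous fun x : ℝ => (fun t : ℝ => t * (1 - t)) (Int.fract x) :=
    ContinuousOn.comp_fract'' (f := fun t : ℝ => t * (1 - t)) (by fun_prop) (by norm_num)
  unfold profile
  exact (continuous_pow 2).add this

theorem profile_neg (x : ℝ) : profile (-x) = profile x := by
  have h := Int.floor_le x
  have h' := Int.lt_floor_add_one x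
  rw [profile_eq_floor x, profile_eq (k := -⌊x⌋ - 1) (by push_cast; linarith)
    (by push_cast; linarith)]
  unfold chord; push_cast; ring

theorem sq_le_profile (x : ℝ) : x ^ 2 ≤ profile x := by
  have := Int.fract_nonneg x
  have := Int.fract_lt_one x
  unfold profile; nlinarith

/-- The epigraph is an intersection of half planes that contain the vertices. Conversely, each
vertical line is filled by segments from the lower boundary to chords arbitrarily high up. -/
theorem mem_poly_true {z : ℂ} : z ∈ poly true ↔ profile z.re ≤ z.im := by
  constructor
  · intro h
    have hc : Convex ℝ {z : ℂ | ∀ k : ℤ, chord k z.re ≤ z.im} := by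
      intro x hx y hy a b ha hb hab k
      have h1 := hx k
      have h2 := hy k
      simp only [Complex.add_re, Complex.add_im, Complex.smul_re, Complex.smul_im, smul_eq_mul]
      have e : chord k (a * x.re + b * y.re) = a * chord k x.re + b * chord k y.re := by
        unfold chord
        linear_combination ((k : ℝ) * (k + 1)) * hab
      rw [e]; gcongr
    have hv : range vertex ⊆ {z : ℂ | ∀ k : ℤ, chord k z.re ≤ z.im} := by
      rintro _ ⟨n, rfl⟩ k
      exact (chord_le_profile k n).trans (profile_int n).le
    have := convexHull_min hv hc h ⌊z.re⌋
    rwa [profile_eq_floor]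
  · intro h
    -- `K` is so large that the horizontal segment from `(-K, K²)` to `(K, K²)` passes above `z`.
    obtain ⟨K, hK⟩ := exists_nat_ge (|z.re| + |z.im| + 1)
    have hcv : Convex ℝ (poly true) := convex_convexHull ℝ _
    have hmem : ∀ n, vertex n ∈ poly true := fun n => subset_convexHull ℝ _ ⟨n, rfl⟩
    have a1 := abs_nonneg z.re
    have a2 := abs_nonneg z.im
    have hlow : (⟨z.re, profile z.re⟩ : ℂ) ∈ poly true := by
      have h0 := Int.floor_le z.re
      have h1 := Int.lt_floor_add_one z.re
      have := hcv (hmem ⌊z.re⌋) (hmem (⌊z.re⌋ + 1)) (a := 1 - (z.re - ⌊z.re⌋))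
        (b := z.re - ⌊z.re⌋) (by linarith) (by linarith) (by ring)
      convert this using 1
      rw [profile_eq_floor]
      apply Complex.ext <;> simp only [Complex.add_re, Complex.add_im, Complex.smul_re,
        Complex.smul_im, smul_eq_mul, vertex_re, vertex_im, chord] <;> push_cast <;> ring
    have hhigh : (⟨z.re, (K : ℝ) ^ 2⟩ : ℂ) ∈ poly true := by
      have b1 := neg_abs_le z.re
      have b2 := le_abs_self z.re
      have hK0 : (0 : ℝ) < K := by linarith
      have := hcv (hmem (-K)) (hmem K) (a := (K - z.re) / (2 * K))
        (b := (K + z.re) / (2 * K)) (div_nonneg (by linarith) (by linarith))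
        (div_nonneg (by linarith) (by linarith)) (by field_simp; ring)
      convert this using 1
      apply Complex.ext <;> simp only [Complex.add_re, Complex.add_im, Complex.smul_re,
        Complex.smul_im, smul_eq_mul, vertex_re, vertex_im] <;> push_cast <;> field_simp <;> ring
    have hle : z.im ≤ (K : ℝ) ^ 2 := by
      have := le_abs_self z.im
      nlinarith
    have hseg := hcv.segment_subset hlow hhigh
    apply hseg
    rcases h.eq_or_lt with h | h
    · have : z = ⟨z.re, profile z.re⟩ := Complex.ext rfl h.symm
      rw [this]; exact left_mem_segment ℝ _ _
    · have hp : 0 < (K : ℝ) ^ 2 - profile z.re := by linarith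
      refine ⟨((K : ℝ) ^ 2 - z.im) / (K ^ 2 - profile z.re),
        (z.im - profile z.re) / (K ^ 2 - profile z.re), div_nonneg (by linarith) hp.le,
        div_nonneg (by linarith) hp.le, by field_simp; ring, ?_⟩
      apply Complex.ext <;> simp only [Complex.add_re, Complex.add_im, Complex.smul_re,
        Complex.smul_im, smul_eq_mul] <;> field_simp <;> ring

theorem mem_poly_false {z : ℂ} : z ∈ poly false ↔ -z ∈ poly true := Iff.rfl

theorem mem_poly_false' {z : ℂ} : z ∈ poly false ↔ z.im ≤ -profile z.re := by
  rw [mem_poly_false, mem_poly_true, Complex.neg_re, Complex.neg_im, profile_neg]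
  constructor <;> intro h <;> linarith

theorem neg_mem_poly {s : Bool} {z : ℂ} : -z ∈ poly s ↔ z ∈ poly !s := by
  cases s
  · simp [mem_poly_false]
  · simp [mem_poly_false]

theorem isClosed_poly (s : Bool) : IsClosed (poly s) := by
  have h : IsClosed (poly true) := by
    have : poly true = {z | profile z.re ≤ z.im} := by ext z; exact mem_poly_true
    rw [this]
    exact isClosed_le (continuous_profile.comp Complex.continuous_re) Complex.continuous_im
  cases s
  · exact h.preimage continuous_neg
  · exact h

theorem convex_poly (s : Bool) : Convex ℝ (poly s) := by
  cases s
  · have : poly false = -poly true := rfl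
    rw [this]; exact (convex_convexHull ℝ _).neg
  · exact convex_convexHull ℝ _

theorem zero_mem_poly (s : Bool) : (0 : ℂ) ∈ poly s := by
  have h : (0 : ℂ) ∈ poly true := by
    rw [mem_poly_true]; simpa using (profile_int 0).le
  cases s
  · rw [mem_poly_false]; simpa using h
  · exact h

theorem vertex_mem_poly (n : ℤ) : vertex n ∈ poly true := subset_convexHull ℝ _ ⟨n, rfl⟩

@[simp] theorem offset_re (n : ℤ) : (offset n).re = 2 * n + 1 := by simp [offset]; ring
@[simp] theorem offset_im (n : ℤ) : (offset n).im = (n : ℝ) ^ 2 + (n + 1) ^ 2 := by simp [offset]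

theorem mem_edge {n : ℤ} {z : ℂ} :
    z ∈ edge n ↔ (n : ℝ) ≤ z.re ∧ z.re ≤ n + 1 ∧ z.im = chord n z.re := by
  constructor
  · rintro ⟨a, b, ha, hb, hab, rfl⟩
    have : a = 1 - b := by linarith
    subst this
    simp only [Complex.add_re, Complex.add_im, Complex.real_smul, Complex.mul_re, Complex.mul_im,
      Complex.ofReal_re, Complex.ofReal_im, zero_mul, sub_zero, add_zero, vertex_re, vertex_im, chord]
    push_cast
    refine ⟨by nlinarith, by nlinarith, by ring⟩
  · rintro ⟨h0, h1, h2⟩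
    refine ⟨1 - (z.re - n), z.re - n, by linarith, by linarith, by ring, ?_⟩
    apply Complex.ext
    · simp; ring
    · simp [h2, chord]; ring

theorem mem_edge' {n : ℤ} {z : ℂ} :
    z ∈ edge n ↔ (n : ℝ) ≤ z.re ∧ z.re ≤ n + 1 ∧ z.im = profile z.re := by
  rw [mem_edge]
  constructor <;> rintro ⟨h0, h1, h2⟩
  · exact ⟨h0, h1, h2.trans (profile_eq h0 h1).symm⟩
  · exact ⟨h0, h1, h2.trans (profile_eq h0 h1)⟩

theorem edge_subset_poly (n : ℤ) : edge n ⊆ poly true := fun z hz => by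
  rw [mem_edge'] at hz; rw [mem_poly_true]; exact hz.2.2.ge

theorem offset_sub_mem_edge {n : ℤ} {z : ℂ} (hz : z ∈ edge n) : offset n - z ∈ edge n := by
  rw [mem_edge] at *
  obtain ⟨h0, h1, h2⟩ := hz
  simp only [Complex.sub_re, Complex.sub_im, offset_re, offset_im, h2, chord]
  exact ⟨by linarith, by linarith, by ring⟩

theorem sub_offset_mem_poly {n : ℤ} {z : ℂ} (hz : z ∈ edge n) : z - offset n ∈ poly false := by
  rw [mem_poly_false, neg_sub]
  exact edge_subset_poly n (offset_sub_mem_edge hz)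

/-- The point reflection of the profile in the midpoint of an edge lies below the chord. -/
theorem reflected_profile_le (n : ℤ) (x : ℝ) :
    (n : ℝ) ^ 2 + (n + 1) ^ 2 - profile (2 * n + 1 - x) ≤ chord n x := by
  have := chord_le_profile n (2 * n + 1 - x)
  unfold chord at *
  nlinarith

theorem sub_offset_mem_poly_false {n : ℤ} {z : ℂ} : z - offset n ∈ poly false ↔
    z.im ≤ (n : ℝ) ^ 2 + (n + 1) ^ 2 - profile (2 * n + 1 - z.re) := by
  rw [mem_poly_false, mem_poly_true]
  simp only [Complex.sub_re, Complex.sub_im, offset_re, offset_im, neg_sub]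
  constructor <;> intro h <;> linarith

/-- To the right of the `n`-th edge all slopes of the profile are at least `2n + 3`, hence exceed
the slope of that edge. -/
theorem profile_sub_lt {n : ℤ} {x y : ℝ} (hx : (n : ℝ) + 1 ≤ x) (hxy : x < y) :
    profile x + (2 * n + 1) * (y - x) < profile y := by
  have h1 := chord_le_profile ⌊x⌋ y
  rw [profile_eq_floor x]
  have h2 : (n : ℝ) + 1 ≤ ⌊x⌋ := by
    have : n + 1 ≤ ⌊x⌋ := Int.le_floor.2 (by push_cast; exact hx)
    exact_mod_cast this
  unfold chord at *
  nlinarith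

theorem profile_sub_lt' {n : ℤ} {x y : ℝ} (hx : x ≤ n) (hxy : y < x) :
    profile x + (2 * n + 1) * (y - x) < profile y := by
  have := profile_sub_lt (n := -n - 1) (x := -x) (y := -y) (by push_cast; linarith) (by linarith)
  rw [profile_neg, profile_neg] at this
  push_cast at this
  nlinarith

theorem mem_chartDomain {n : ℤ} {z : ℂ} : z ∈ chartDomain n ↔
    profile z.re < z.im ∨ z.im < (n : ℝ) ^ 2 + (n + 1) ^ 2 - profile (2 * n + 1 - z.re) ∨
      ((n : ℝ) < z.re ∧ z.re < n + 1) := by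
  have hU : (poly true ∪ {z | z - offset n ∈ poly false}) = {z | profile z.re ≤ z.im ∨
      z.im ≤ (n : ℝ) ^ 2 + (n + 1) ^ 2 - profile (2 * n + 1 - z.re)} := by
    ext w
    simp only [mem_union, mem_poly_true, mem_ofPred_eq, sub_offset_mem_poly_false]
  rw [chartDomain, hU]
  constructor
  · intro h
    by_contra! hc
    obtain ⟨h1, h2, h3⟩ := hc
    -- The point is pushed parallel to the `n`-th edge, away from it. Both polygons recede strictly
    -- from such a line, so points arbitrarily close to `z` lie outside the union.
    have key : ∀ d : ℝ, (∀ ε > 0, z.im + ε * d * (2 * n + 1) < profile (z.re + ε * d) ∧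
        (n : ℝ) ^ 2 + (n + 1) ^ 2 - profile (2 * n + 1 - (z.re + ε * d))
          < z.im + ε * d * (2 * n + 1)) → False := by
      intro d hd
      have hcont : Tendsto (fun ε : ℝ => (⟨z.re + ε * d, z.im + ε * d * (2 * n + 1)⟩ : ℂ))
          (𝓝[>] 0) (𝓝 z) := by
        have hc : Continuous (fun ε : ℝ => (⟨z.re + ε * d, z.im + ε * d * (2 * n + 1)⟩ : ℂ)) := by
          have : (fun ε : ℝ => (⟨z.re + ε * d, z.im + ε * d * (2 * n + 1)⟩ : ℂ)) =
            fun ε : ℝ => ((z.re + ε * d : ℝ) : ℂ) + ((z.im + ε * d * (2 * n + 1) : ℝ) : ℂ) * Complex.I := by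
            ext ε; apply Complex.ext <;> simp
          rw [this]; fun_prop
        have := hc.tendsto 0
        simp only [zero_mul, add_zero] at this
        exact this.mono_left nhdsWithin_le_nhds
      have hev := hcont.eventually (mem_interior_iff_mem_nhds.1 h)
      obtain ⟨ε, hε, hε0⟩ := (hev.and self_mem_nhdsWithin).exists
      obtain ⟨k1, k2⟩ := hd ε hε0
      rcases hε with hε | hε <;> simp at hε <;> linarith
    rcases lt_or_ge (n : ℝ) z.re with hn | hn
    · have h3 := h3 hn
      refine key 1 fun ε hε => ?_
      have a1 := profile_sub_lt (n := n) (x := z.re) (y := z.re + ε * 1) h3 (by linarith)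
      have a2 := profile_sub_lt' (n := n) (x := 2 * n + 1 - z.re) (y := 2 * n + 1 - (z.re + ε * 1))
        (by linarith) (by linarith)
      constructor <;> linarith
    · refine key (-1) fun ε hε => ?_
      have a1 := profile_sub_lt' (n := n) (x := z.re) (y := z.re + ε * -1) hn (by linarith)
      have a2 := profile_sub_lt (n := n) (x := 2 * n + 1 - z.re) (y := 2 * n + 1 - (z.re + ε * -1))
        (by linarith) (by linarith)
      constructor <;> linarith
  · intro h
    have hp : Continuous fun z : ℂ => profile z.re := continuous_profile.comp Complex.continuous_re
    have hp' : Continuous fun z : ℂ => profile (2 * n + 1 - z.re) :=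
      continuous_profile.comp (by fun_prop)
    rw [mem_interior_iff_mem_nhds]
    rcases h with h | h | h
    · filter_upwards [(isOpen_lt hp Complex.continuous_im).mem_nhds h] with w hw
      exact Or.inl (le_of_lt hw)
    · filter_upwards [(isOpen_lt Complex.continuous_im (continuous_const.sub hp')).mem_nhds h] with w hw
      exact Or.inr (le_of_lt hw)
    · filter_upwards [(isOpen_lt continuous_const Complex.continuous_re).mem_nhds h.1,
        (isOpen_lt Complex.continuous_re continuous_const).mem_nhds h.2] with w hw1 hw2
      have e1 := profile_eq (k := n) (le_of_lt hw1) (le_of_lt hw2)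
      have e2 := profile_eq (k := n) (x := 2 * n + 1 - w.re) (by linarith) (by linarith)
      rw [e1, e2]
      -- Over the open edge both boundaries are the chord, so the two polygons leave no gap.
      rcases le_total (chord n w.re) w.im with h | h
      · exact Or.inl h
      · right; unfold chord at *; linarith

theorem isOpen_chartDomain (n : ℤ) : IsOpen (chartDomain n) := isOpen_interior

end

/-! ### Points of the surface in polygon and chart coordinates -/

section

open Classical in
/-- The point of `S₁` represented by `z` in `poly s` (with a junk value outside the polygon). -/
def pt (s : Bool) (z : ℂ) : S1 :=
  if h : z ∈ poly s then point s ⟨z, h⟩ else point s ⟨0, zero_mem_poly s⟩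

/-- The translation by which the polygon `poly s` is placed in the `n`-th chart. -/
def shift (n : ℤ) (s : Bool) : ℂ := bif s then 0 else offset n

@[simp] theorem shift_true (n : ℤ) : shift n true = 0 := rfl
@[simp] theorem shift_false (n : ℤ) : shift n false = offset n := rfl

theorem pt_of_mem {s : Bool} {z : ℂ} (h : z ∈ poly s) : pt s z = point s ⟨z, h⟩ := dif_pos h

theorem exists_pt (x : S1) : ∃ s, ∃ z ∈ poly s, x = pt s z := by
  induction x using Quot.ind with
  | mk p => exact ⟨p.1, p.2, p.2.2, (pt_of_mem p.2.2).symm⟩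

theorem pt_edge {n : ℤ} {z : ℂ} (h : z ∈ edge n) : pt true z = pt false (z - offset n) := by
  rw [pt_of_mem (edge_subset_poly n h), pt_of_mem (sub_offset_mem_poly h)]
  exact Quot.sound ⟨rfl, rfl, n, h, rfl⟩

/-- A property of representatives that is compatible with the edge identifications depends on the
represented point only. -/
theorem pt_invariant (P : Bool → ℂ → Prop)
    (hP : ∀ n, ∀ z ∈ edge n, P true z ↔ P false (z - offset n)) {s s' : Bool} {z z' : ℂ}
    (hz : z ∈ poly s) (hz' : z' ∈ poly s') (h : pt s z = pt s' z') : P s z ↔ P s' z' := by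
  have hG : ∀ x y : Piece, Glue x y → P x.1 x.2 = P y.1 y.2 := by
    rintro ⟨s, x, hx⟩ ⟨s', y, hy⟩ ⟨h1, h2, n, h3, h4⟩
    dsimp only at h1 h2 h3 h4 ⊢
    subst h1 h2 h4
    exact propext (hP n x h3)
  rw [pt_of_mem hz, pt_of_mem hz'] at h
  have := congrArg (Quot.lift (fun p : Piece => P p.1 p.2) hG) h
  exact iff_of_eq this

open Classical in
/-- The `n`-th translation chart. -/
def chart (n : ℤ) (z : ℂ) : S1 := if z ∈ poly true then pt true z else pt false (z - offset n)

/-- The line of the edge separates the two polygons, so a common point lies on it. Beyond the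
endpoints the profile rises strictly above this line. -/
theorem mem_edge_of_mem_of_mem {n : ℤ} {z : ℂ} (h : z ∈ poly true) (h' : z - offset n ∈ poly false) :
    z ∈ edge n := by
  rw [mem_poly_true] at h
  rw [sub_offset_mem_poly_false] at h'
  have h1 := reflected_profile_le n z.re
  have h2 := chord_le_profile n z.re
  rw [mem_edge]
  refine ⟨?_, ?_, by linarith⟩
  · by_contra! hc
    have := profile_sub_lt' (n := n) (x := n) (y := z.re) le_rfl hc
    rw [profile_int] at this
    unfold chord at *; linarith
  · by_contra! hc
    have := profile_sub_lt (n := n) (x := n + 1) (y := z.re) le_rfl hc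
    have e := profile_int (n + 1)
    push_cast at e
    rw [e] at this
    unfold chord at *; linarith

theorem chart_of_mem {n : ℤ} {s : Bool} {z : ℂ} (h : z - shift n s ∈ poly s) :
    chart n z = pt s (z - shift n s) := by
  cases s
  · unfold chart
    split_ifs with h1
    · exact pt_edge (mem_edge_of_mem_of_mem h1 h)
    · rfl
  · simp at h
    simp [chart, h]

theorem chart_add_shift {n : ℤ} {s : Bool} {z : ℂ} (h : z ∈ poly s) :
    chart n (z + shift n s) = pt s z := by
  rw [chart_of_mem (s := s)] <;> simp [h]

theorem exists_shift {n : ℤ} {z : ℂ} (h : z ∈ chartDomain n) : ∃ s, z - shift n s ∈ poly s := by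
  rcases interior_subset h with h | h
  · exact ⟨true, by simpa using h⟩
  · exact ⟨false, h⟩

/-- This replaces the relation `ChartEq` by the function `chart n`; the alternatives agree on the
common edge by the gluing. -/
theorem chartEq_iff {n : ℤ} {z : ℂ} {x : S1} (h : z ∈ chartDomain n) :
    ChartEq n z x ↔ x = chart n z := by
  constructor
  · rintro (⟨h, rfl⟩ | ⟨h, rfl⟩)
    · rw [chart_of_mem (s := true) (by simpa using h)]; simp [pt_of_mem h]
    · rw [chart_of_mem (s := false) h]; simp [pt_of_mem h]
  · rintro rfl
    obtain ⟨s, hs⟩ := exists_shift h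
    rw [chart_of_mem hs, pt_of_mem hs]
    cases s
    · exact Or.inr ⟨hs, rfl⟩
    · rw [shift_true, sub_zero] at hs
      exact Or.inl ⟨hs, by congr 2; simp⟩

theorem disjoint_edge_chartDomain {n k : ℤ} (h : k ≠ n) {z : ℂ} (hz : z ∈ edge k) :
    z ∉ chartDomain n := by
  rw [mem_edge'] at hz
  rw [mem_chartDomain]
  have h1 := reflected_profile_le n z.re
  have h2 := chord_le_profile n z.re
  obtain ⟨a, b, c⟩ := hz
  rintro (h3 | h3 | ⟨h3, h4⟩)
  · linarith
  · linarith
  · have h5 : (n : ℝ) < k + 1 := by linarith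
    have h6 : (k : ℝ) < n + 1 := by linarith
    norm_cast at h5 h6
    omega

/-- The point reflection in the midpoint of the edge exchanges the two polygons of the chart. It
carries statements about `Q⁺` over to `Q⁻`. -/
theorem offset_sub_mem_chartDomain {n : ℤ} {z : ℂ} :
    offset n - z ∈ chartDomain n ↔ z ∈ chartDomain n := by
  rw [mem_chartDomain, mem_chartDomain]
  simp only [Complex.sub_re, Complex.sub_im, offset_re, offset_im, sub_sub_cancel]
  constructor
  · rintro (h | h | h)
    · right; left; linarith
    · left; linarith
    · right; right; constructor <;> linarith
  · rintro (h | h | h)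
    · right; left; linarith
    · left; linarith
    · right; right; constructor <;> linarith

/-- A chart is injective, and its coordinates are those of the polygons. -/
theorem eq_of_chart_eq_pt {n : ℤ} {b z : ℂ} {s : Bool} (hb : b ∈ chartDomain n) (hz : z ∈ poly s)
    (h : chart n b = pt s z) : b = z + shift n s := by
  obtain ⟨s', hs'⟩ := exists_shift hb
  rw [chart_of_mem hs'] at h
  -- This equation is preserved by the gluing along the edge `n`. At any other edge it fails on both
  -- sides, since a chart domain meets no edge but its own.
  refine (pt_invariant (fun s z => b = z + shift n s) (fun k w hw => ?_) hs' hz h).1 (by simp)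
  rcases eq_or_ne k n with rfl | hk
  · simp
  · constructor
    · rintro rfl
      exact absurd hb (by simpa using disjoint_edge_chartDomain hk hw)
    · rintro rfl
      refine absurd hb ?_
      rw [← offset_sub_mem_chartDomain]
      convert disjoint_edge_chartDomain hk (offset_sub_mem_edge hw) using 2
      simp

theorem chart_injOn (n : ℤ) : InjOn (chart n) (chartDomain n) := by
  intro a ha b hb h
  obtain ⟨s, hs⟩ := exists_shift hb
  rw [chart_of_mem hs] at h
  simpa using eq_of_chart_eq_pt ha hs h

/-- `z` is a vertex of one of the polygons. -/
def IsVertex (z : ℂ) : Prop := z ∈ range vertex ∨ -z ∈ range vertex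

theorem isVertex_neg {z : ℂ} : IsVertex (-z) ↔ IsVertex z := by
  unfold IsVertex; rw [neg_neg, or_comm]

/-- A vertex of `Q⁻` that lies in `Q⁺` has height at most and at least `0`, so it is the origin, a
vertex of both polygons. -/
theorem isVertex_of_mem_true {z : ℂ} (hz : z ∈ poly true) : IsVertex z ↔ z ∈ range vertex := by
  refine ⟨?_, Or.inl⟩
  rintro (h | ⟨n, hn⟩)
  · exact h
  · rw [mem_poly_true] at hz
    have h1 := sq_le_profile z.re
    have h2 := congrArg Complex.im hn
    have h3 := congrArg Complex.re hn
    simp at h2 h3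
    refine ⟨0, ?_⟩
    have h4 : z.re ^ 2 = n ^ 2 := by rw [h3]; ring
    have h5 : z.re = 0 := by nlinarith
    apply Complex.ext <;> simp
    · exact h5.symm
    · nlinarith

theorem isVertex_of_mem_edge {n : ℤ} {z : ℂ} (hz : z ∈ edge n) :
    IsVertex z ↔ z = vertex n ∨ z = vertex (n + 1) := by
  rw [isVertex_of_mem_true (edge_subset_poly n hz)]
  constructor
  · rintro ⟨k, rfl⟩
    rw [mem_edge] at hz
    simp only [vertex_re] at hz
    have h1 : n ≤ k := by exact_mod_cast hz.1
    have h2 : k ≤ n + 1 := by exact_mod_cast hz.2.1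
    have : k = n ∨ k = n + 1 := by omega
    rcases this with rfl | rfl <;> simp
  · rintro (rfl | rfl) <;> exact ⟨_, rfl⟩

theorem pt_mem_singularities {s : Bool} {z : ℂ} (hz : z ∈ poly s) :
    pt s z ∈ singularities ↔ IsVertex z := by
  constructor
  · rintro ⟨s', z', h1, h2⟩
    rw [← pt_of_mem z'.2] at h1
    -- The gluing along the edge `n` takes `vertex n` to `-vertex (n + 1)` and `vertex (n + 1)` to
    -- `-vertex n`.
    refine (pt_invariant (fun _ z => IsVertex z) (fun n w hw => ?_) hz z'.2 h1).2 h2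
    rw [isVertex_of_mem_edge hw, ← isVertex_neg, neg_sub, isVertex_of_mem_edge (offset_sub_mem_edge hw)]
    simp only [offset]
    constructor
    · rintro (rfl | rfl)
      · right; ring
      · left; ring
    · rintro (h | h)
      · right; linear_combination -h
      · left; linear_combination -h
  · intro h
    exact ⟨s, ⟨z, hz⟩, pt_of_mem hz, h⟩

theorem not_isVertex_of_chartDomain {n : ℤ} {s : Bool} {z : ℂ} (hz : z ∈ poly s)
    (h : z + shift n s ∈ chartDomain n) : ¬ IsVertex z := by
  have key : ∀ z ∈ poly true, z ∈ chartDomain n → ¬ IsVertex z := by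
    intro z hz h
    rw [isVertex_of_mem_true hz]
    rintro ⟨k, rfl⟩
    have h1 : vertex k ∈ edge k := left_mem_segment ℝ _ _
    have h2 : vertex k ∈ edge (k - 1) := by
      rw [edge, sub_add_cancel]; exact right_mem_segment ℝ _ _
    rcases eq_or_ne k n with rfl | hk
    · exact disjoint_edge_chartDomain (by omega) h2 h
    · exact disjoint_edge_chartDomain hk h1 h
  cases s
  · rw [← isVertex_neg]
    refine key _ hz ?_
    rw [← offset_sub_mem_chartDomain]
    convert h using 1
    simp; ring
  · exact key z hz (by simpa using h)

theorem chart_not_mem_singularities {n : ℤ} {z : ℂ} (h : z ∈ chartDomain n) :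
    chart n z ∉ singularities := by
  obtain ⟨s, hs⟩ := exists_shift h
  rw [chart_of_mem hs, pt_mem_singularities hs]
  exact not_isVertex_of_chartDomain (n := n) hs (by simpa using h)

theorem exists_chartDomain {s : Bool} {z : ℂ} (hz : z ∈ poly s) (h : ¬ IsVertex z) :
    ∃ n, z + shift n s ∈ chartDomain n := by
  have key : ∀ z ∈ poly true, ¬ IsVertex z → z ∈ chartDomain ⌊z.re⌋ := by
    intro z hz h
    rw [mem_poly_true] at hz
    rw [mem_chartDomain]
    rcases hz.lt_or_eq with h1 | h1
    · exact Or.inl h1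
    · right; right
      refine ⟨lt_of_le_of_ne (Int.floor_le _) fun e => h (Or.inl ⟨⌊z.re⌋, ?_⟩), Int.lt_floor_add_one _⟩
      apply Complex.ext
      · exact e
      · rw [← h1, ← e, profile_int]; simp
  cases s
  · refine ⟨⌊(-z).re⌋, ?_⟩
    rw [← offset_sub_mem_chartDomain]
    convert key (-z) hz (by rwa [isVertex_neg]) using 1
    simp
  · exact ⟨_, by simpa using key z hz h⟩

theorem exists_chart {x : S1} (hx : x ∉ singularities) : ∃ n, ∃ a ∈ chartDomain n, x = chart n a := by
  obtain ⟨s, z, hz, rfl⟩ := exists_pt x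
  rw [pt_mem_singularities hz] at hx
  obtain ⟨n, hn⟩ := exists_chartDomain hz hx
  exact ⟨n, _, hn, (chart_add_shift hz).symm⟩

/-! ### Germs of translation maps -/

/-- Near `z`, the map `f` is a translation followed by a chart. -/
def Germ (f : ℂ → S1) (z : ℂ) : Prop :=
  ∃ n, ∃ a ∈ chartDomain n, ∀ᶠ w in 𝓝 z, f w = chart n (a + (w - z))

theorem eventually_mem_chartDomain {n : ℤ} {a : ℂ} (ha : a ∈ chartDomain n) (z : ℂ) :
    ∀ᶠ w in 𝓝 z, a + (w - z) ∈ chartDomain n := by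
  have : Tendsto (fun w : ℂ => a + (w - z)) (𝓝 z) (𝓝 a) := by
    have h : Continuous fun w : ℂ => a + (w - z) := by fun_prop
    simpa using h.tendsto z
  exact this.eventually ((isOpen_chartDomain n).mem_nhds ha)

theorem isTranslationMap_iff {f : ℂ → S1} {U : Set ℂ} : IsTranslationMap f U ↔ ∀ z ∈ U, Germ f z := by
  refine forall₂_congr fun z _ => exists_congr fun n => exists_congr fun a => and_congr_right fun ha => ?_
  exact eventually_congr ((eventually_mem_chartDomain ha z).mono fun w hw => chartEq_iff hw)

theorem Germ.congr {f g : ℂ → S1} {z : ℂ} (hf : Germ f z) (h : ∀ᶠ w in 𝓝 z, g w = f w) : Germ g z := by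
  obtain ⟨n, a, ha, hw⟩ := hf
  refine ⟨n, a, ha, ?_⟩
  filter_upwards [hw, h] with w h1 h2
  rw [h2, h1]

theorem germ_chart {n : ℤ} {a : ℂ} (ha : a ∈ chartDomain n) : Germ (chart n) a :=
  ⟨n, a, ha, Eventually.of_forall fun w => by ring_nf⟩

theorem tendsto_add_sub (z z' : ℂ) : Tendsto (fun w : ℂ => z + (w - z')) (𝓝 z') (𝓝 z) := by
  have h : Continuous fun w : ℂ => z + (w - z') := by fun_prop
  simpa using h.tendsto z'

theorem Germ.translate {f : ℂ → S1} {z : ℂ} (hf : Germ f z) (z' : ℂ) :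
    Germ (fun w => f (z + (w - z'))) z' := by
  obtain ⟨n, a, ha, hw⟩ := hf
  exact ⟨n, a, ha, ((tendsto_add_sub z z').eventually hw).mono fun w h => h.trans (by ring_nf)⟩

theorem Germ.not_mem_singularities {f : ℂ → S1} {z : ℂ} (hf : Germ f z) : f z ∉ singularities := by
  obtain ⟨n, a, ha, hw⟩ := hf
  rw [hw.self_of_nhds]; simpa using chart_not_mem_singularities ha

theorem exists_germ {x : S1} (hx : x ∉ singularities) (z : ℂ) : ∃ f, Germ f z ∧ f z = x := by
  obtain ⟨n, a, ha, rfl⟩ := exists_chart hx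
  exact ⟨_, (germ_chart ha).translate z, by simp⟩

/-- An interior point of a polygon looks alike in every chart, whereas a point of an open edge is
seen by the chart of that edge only. This is what makes germs unique. -/
theorem mem_nhds_poly_or {n : ℤ} {s : Bool} {z : ℂ} (hz : z ∈ poly s)
    (h : z + shift n s ∈ chartDomain n) :
    poly s ∈ 𝓝 z ∨ ∀ m, z + shift m s ∈ chartDomain m → m = n := by
  have key : ∀ z ∈ poly true, z ∈ chartDomain n →
      poly true ∈ 𝓝 z ∨ ∀ m, z ∈ chartDomain m → m = n := by
    intro z hz h
    rw [mem_poly_true] at hz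
    rcases hz.lt_or_eq with h1 | h1
    · left
      filter_upwards [(isOpen_lt (continuous_profile.comp Complex.continuous_re)
        Complex.continuous_im).mem_nhds h1] with w hw
      rw [mem_poly_true]; exact le_of_lt hw
    · right
      have h2 : ∀ m, z ∈ chartDomain m → (m : ℝ) < z.re ∧ z.re < m + 1 := by
        intro m hm
        rcases mem_chartDomain.1 hm with h3 | h3 | h3
        · linarith
        · have := reflected_profile_le m z.re
          have := chord_le_profile m z.re
          linarith
        · exact h3
      intro m hm
      have h3 := h2 n h
      have h4 := h2 m hm
      have h5 : (m : ℝ) < n + 1 := by linarith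
      have h6 : (n : ℝ) < m + 1 := by linarith
      norm_cast at h5 h6
      omega
  cases s
  · have e : ∀ m, z + shift m false ∈ chartDomain m ↔ -z ∈ chartDomain m := by
      intro m
      rw [← offset_sub_mem_chartDomain]; simp
    simp only [e] at h ⊢
    rcases key _ hz h with h | h
    · left
      exact continuous_neg.continuousAt.preimage_mem_nhds h
    · exact Or.inr h
  · simpa using key z hz (by simpa using h)

/-- Two germs of translation maps that agree at one point agree near that point. -/
theorem Germ.eventuallyEq {f g : ℂ → S1} {z z' : ℂ} (hf : Germ f z) (hg : Germ g z')
    (h : f z = g z') : ∀ᶠ w in 𝓝 z, f w = g (z' + (w - z)) := by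
  obtain ⟨n, a, ha, hfw⟩ := hf
  obtain ⟨m, b, hb, hgw⟩ := hg
  have e1 := hfw.self_of_nhds
  have e2 := hgw.self_of_nhds
  simp only [sub_self, add_zero] at e1 e2
  obtain ⟨s, hs⟩ := exists_shift ha
  rw [chart_of_mem hs] at e1
  have hb' := eq_of_chart_eq_pt hb hs (by rw [← e2, ← h, e1])
  set c := a - shift n s
  have ha' : a = c + shift n s := by simp [c]
  have hp : ∀ᶠ w in 𝓝 z, poly s ∈ 𝓝 c → c + (w - z) ∈ poly s := by
    by_cases hc : poly s ∈ 𝓝 c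
    · exact ((tendsto_add_sub c z).eventually (p := fun w => w ∈ poly s) hc).mono fun w hw _ => hw
    · exact Eventually.of_forall fun w h => absurd h hc
  filter_upwards [hfw, (tendsto_add_sub z' z).eventually hgw, hp] with w h1 h2 h3
  rw [h1, h2]
  -- Inside a polygon both charts are translates of `pt s`; on an edge the two charts are the same.
  rcases mem_nhds_poly_or hs (ha' ▸ ha) with h4 | h4
  · have h5 := h3 h4
    rw [ha', hb']
    have e3 : c + shift n s + (w - z) = (c + (w - z)) + shift n s := by ring
    have e4 : c + shift m s + (z' + (w - z) - z') = (c + (w - z)) + shift m s := by ring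
    rw [e3, e4, chart_add_shift h5, chart_add_shift h5]
  · have := h4 m (hb' ▸ hb)
    subst this
    rw [hb', ← ha']; ring_nf

/-- Every chart domain contains the interiors of both of its polygons, so the index `0` is an
arbitrary choice. -/
theorem germ_pt {s : Bool} {z : ℂ} (h : poly s ∈ 𝓝 z) : Germ (pt s) z := by
  have hz := mem_of_mem_nhds h
  have hd : z + shift 0 s ∈ chartDomain 0 := by
    rw [chartDomain, mem_interior_iff_mem_nhds]
    cases s
    · have : Tendsto (fun w => w - offset 0) (𝓝 (z + shift 0 false)) (𝓝 z) := by
        have h : Continuous fun w : ℂ => w - offset 0 := by fun_prop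
        simpa using h.tendsto (z + shift 0 false)
      filter_upwards [this h] with w hw
      exact Or.inr hw
    · simp only [shift_true, add_zero]
      filter_upwards [h] with w hw
      exact Or.inl hw
  refine ⟨0, _, hd, ?_⟩
  filter_upwards [h] with w hw
  rw [← chart_add_shift (n := 0) hw]; ring_nf

end

section

/-! ### Straight curves -/

/-- Near the time `t`, the curve `γ` is straight with velocity `u`. -/
def StraightAt (u : ℂ) (γ : ℝ → S1) (t : ℝ) : Prop :=
  ∃ f, Germ f 0 ∧ ∀ᶠ t' in 𝓝 t, γ t' = f (((t' - t : ℝ) : ℂ) * u)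

theorem tendsto_line (u z : ℂ) (t : ℝ) :
    Tendsto (fun t' : ℝ => z + ((t' - t : ℝ) : ℂ) * u) (𝓝 t) (𝓝 z) := by
  have h : Continuous fun t' : ℝ => z + ((t' - t : ℝ) : ℂ) * u := by fun_prop
  simpa using h.tendsto t

theorem straightAt_of_germ {u z : ℂ} {γ : ℝ → S1} {t : ℝ} {f : ℂ → S1} (hf : Germ f z)
    (h : ∀ᶠ t' in 𝓝 t, γ t' = f (z + ((t' - t : ℝ) : ℂ) * u)) : StraightAt u γ t :=
  ⟨_, hf.translate 0, h.mono fun t' ht' => by rw [ht', sub_zero]⟩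

theorem straightAt_iff {u : ℂ} {γ : ℝ → S1} {t : ℝ} : StraightAt u γ t ↔
    ∃ n, ∃ a ∈ chartDomain n, ∀ᶠ t' in 𝓝 t, γ t' = chart n (a + ((t' - t : ℝ) : ℂ) * u) := by
  constructor
  · rintro ⟨f, ⟨n, a, ha, hf⟩, h⟩
    refine ⟨n, a, ha, ?_⟩
    have := (tendsto_line u 0 t).eventually hf
    filter_upwards [h, this] with t' h1 h2
    rw [zero_add] at h2
    rw [h1, h2, sub_zero]
  · rintro ⟨n, a, ha, h⟩
    exact straightAt_of_germ (germ_chart ha) h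

theorem eventually_line_mem_chartDomain {n : ℤ} {a : ℂ} (ha : a ∈ chartDomain n) (u : ℂ) (t : ℝ) :
    ∀ᶠ t' : ℝ in 𝓝 t, a + ((t' - t : ℝ) : ℂ) * u ∈ chartDomain n :=
  (tendsto_line u a t).eventually ((isOpen_chartDomain n).mem_nhds ha)

theorem isStraight_iff {u : ℂ} {J : Set ℝ} {γ : ℝ → S1} :
    IsStraight u J γ ↔ ∀ t ∈ J, StraightAt u γ t := by
  refine forall₂_congr fun t _ => ?_
  rw [straightAt_iff]
  refine exists_congr fun n => ?_
  constructor
  · rintro ⟨a, ha, h⟩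
    exact ⟨a, ha, (h.and (eventually_line_mem_chartDomain ha u t)).mono fun t' h => (chartEq_iff h.2).1 h.1⟩
  · rintro ⟨a, ha, h⟩
    exact ⟨a, ha, (h.and (eventually_line_mem_chartDomain ha u t)).mono fun t' h => (chartEq_iff h.2).2 h.1⟩

theorem StraightAt.congr {u : ℂ} {γ γ' : ℝ → S1} {t : ℝ} (h : StraightAt u γ t)
    (e : ∀ᶠ t' in 𝓝 t, γ' t' = γ t') : StraightAt u γ' t := by
  obtain ⟨f, hf, h⟩ := h
  exact ⟨f, hf, (h.and e).mono fun t' h => h.2.trans h.1⟩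

theorem StraightAt.not_mem_singularities {u : ℂ} {γ : ℝ → S1} {t : ℝ} (h : StraightAt u γ t) :
    γ t ∉ singularities := by
  obtain ⟨f, hf, h⟩ := h
  rw [h.self_of_nhds]
  simpa using hf.not_mem_singularities

theorem StraightAt.eventuallyEq {u : ℂ} {γ γ' : ℝ → S1} {t : ℝ} (h : StraightAt u γ t)
    (h' : StraightAt u γ' t) (e : γ t = γ' t) : ∀ᶠ t' in 𝓝 t, γ t' = γ' t' := by
  obtain ⟨f, hf, h⟩ := h
  obtain ⟨g, hg, h'⟩ := h'
  have e1 := h.self_of_nhds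
  have e2 := h'.self_of_nhds
  simp only [sub_self, Complex.ofReal_zero, zero_mul] at e1 e2
  have := hf.eventuallyEq hg (by rw [← e1, ← e2, e])
  have := (tendsto_line u 0 t).eventually this
  filter_upwards [h, h', this] with t' h1 h2 h3
  simp only [zero_add, sub_zero] at h3
  rw [h1, h2, h3]

/-- This plays the role of the Hausdorff property. A coincidence near `t` means that the chart
coordinates correspond inside one of two closed polygons; one of the two occurs frequently, and
closedness carries the coincidence to the time `t`. -/
theorem StraightAt.eq_of_frequently {u : ℂ} {γ γ' : ℝ → S1} {t : ℝ} (h : StraightAt u γ t)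
    (h' : StraightAt u γ' t) (e : ∃ᶠ t' in 𝓝 t, γ t' = γ' t') : γ t = γ' t := by
  rw [straightAt_iff] at h h'
  obtain ⟨n, a, ha, h⟩ := h
  obtain ⟨m, b, hb, h'⟩ := h'
  have key : ∃ᶠ t' : ℝ in 𝓝 t, ∃ s, (a - shift n s) + ((t' - t : ℝ) : ℂ) * u ∈ poly s ∧
      b = (a - shift n s) + shift m s := by
    refine (e.and_eventually (h.and (h'.and ((eventually_line_mem_chartDomain ha u t).and
      (eventually_line_mem_chartDomain hb u t))))).mono ?_
    rintro t' ⟨h1, h2, h3, h4, h5⟩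
    obtain ⟨s, hs⟩ := exists_shift h4
    have h6 := eq_of_chart_eq_pt h5 hs (by rw [← h3, ← h1, h2, chart_of_mem hs])
    exact ⟨s, by convert hs using 1; ring, by linear_combination h6⟩
  have : ∃ s, ∃ᶠ t' : ℝ in 𝓝 t, (a - shift n s) + ((t' - t : ℝ) : ℂ) * u ∈ poly s ∧
      b = (a - shift n s) + shift m s := by
    simpa only [Bool.exists_bool, frequently_or_distrib] using key
  obtain ⟨s, hs⟩ := this
  have hb' := hs.exists.choose_spec.2
  have hc := (isClosed_poly s).mem_of_frequently_of_tendsto (hs.mono fun _ h => h.1) (tendsto_line u _ t)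
  have e1 := h.self_of_nhds
  have e2 := h'.self_of_nhds
  simp only [sub_self, Complex.ofReal_zero, zero_mul, add_zero] at e1 e2
  rw [e1, e2, hb', chart_add_shift hc, chart_of_mem hc]

/-- Two straight curves with the same velocity that meet at some time coincide. -/
theorem IsStraight.eqOn {u : ℂ} {J : Set ℝ} {γ γ' : ℝ → S1} (hJ : J.OrdConnected)
    (h : IsStraight u J γ) (h' : IsStraight u J γ') {t : ℝ} (ht : t ∈ J) (e : γ t = γ' t) :
    EqOn γ γ' J := by
  rw [isStraight_iff] at h h'
  -- The set of times near which the curves agree is open, and relatively closed by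
  -- `StraightAt.eq_of_frequently`.
  have := hJ.isPreconnected.subset_of_closure_inter_subset (u := {t | ∀ᶠ t' in 𝓝 t, γ t' = γ' t'})
    isOpen_setOfPred_eventually_nhds ⟨t, ht, (h t ht).eventuallyEq (h' t ht) e⟩ (by
      rintro r ⟨hr, hrJ⟩
      refine (h r hrJ).eventuallyEq (h' r hrJ) ((h r hrJ).eq_of_frequently (h' r hrJ) ?_)
      rw [mem_closure_iff_frequently] at hr
      exact hr.mono fun r h => Eventually.self_of_nhds (p := fun t' => γ t' = γ' t') h)
  exact fun r hr => (this hr).self_of_nhds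

theorem IsStraight.mono {u : ℂ} {J J' : Set ℝ} {γ : ℝ → S1} (h : IsStraight u J γ) (hJ : J' ⊆ J) :
    IsStraight u J' γ := fun t ht => h t (hJ ht)

theorem IsStraight.congr {u : ℂ} {J : Set ℝ} {γ γ' : ℝ → S1} (hJ : IsOpen J) (h : IsStraight u J γ)
    (e : EqOn γ' γ J) : IsStraight u J γ' := by
  rw [isStraight_iff] at *
  exact fun t ht => (h t ht).congr (mem_of_superset (hJ.mem_nhds ht) e)

theorem StraightAt.comp_add {u : ℂ} {γ : ℝ → S1} {t c : ℝ} (h : StraightAt u γ (t + c)) :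
    StraightAt u (fun t => γ (t + c)) t := by
  obtain ⟨f, hf, h⟩ := h
  refine ⟨f, hf, ?_⟩
  have : Tendsto (fun t' => t' + c) (𝓝 t) (𝓝 (t + c)) := (continuous_add_const c).tendsto t
  exact (this.eventually h).mono fun t' h' => h'.trans (by ring_nf)

theorem IsStraight.comp_add {u : ℂ} {J : Set ℝ} {γ : ℝ → S1} (h : IsStraight u J γ) (c : ℝ) :
    IsStraight u {t | t + c ∈ J} (fun t => γ (t + c)) := by
  rw [isStraight_iff] at *
  exact fun t ht => (h _ ht).comp_add

theorem ordConnected_preimage_add {J : Set ℝ} (h : J.OrdConnected) (c : ℝ) :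
    {t | t + c ∈ J}.OrdConnected :=
  ⟨fun x hx y hy z hz => h.out hx hy ⟨by linarith [hz.1], by linarith [hz.2]⟩⟩

theorem isOpen_preimage_add {J : Set ℝ} (h : IsOpen J) (c : ℝ) : IsOpen {t | t + c ∈ J} :=
  h.preimage (continuous_add_const c)

/-- A trajectory contains every straight curve with the same velocity that it meets. -/
theorem IsTrajectory.extends {u : ℂ} {J J₀ : Set ℝ} {γ γ₀ : ℝ → S1} (h : IsTrajectory u J γ)
    (ho : IsOpen J₀) (hc : J₀.OrdConnected) (hs : IsStraight u J₀ γ₀) {t : ℝ} (ht : t ∈ J)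
    (ht₀ : t ∈ J₀) (e : γ t = γ₀ t) : J₀ ⊆ J ∧ EqOn γ γ₀ J₀ := by
  have e1 : EqOn γ γ₀ (J ∩ J₀) :=
    IsStraight.eqOn (h.ordConnected.inter hc) (h.straight.mono inter_subset_left)
      (hs.mono inter_subset_right) ⟨ht, ht₀⟩ e
  classical
  let γ' : ℝ → S1 := fun t => if t ∈ J then γ t else γ₀ t
  have g1 : EqOn γ' γ J := fun r hr => if_pos hr
  have g2 : EqOn γ' γ₀ J₀ := by
    intro r hr
    by_cases hrJ : r ∈ J
    · rw [g1 hrJ, e1 ⟨hrJ, hr⟩]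
    · exact if_neg hrJ
  have hsub : J ∪ J₀ ⊆ J := by
    refine h.maximal _ γ' (h.isOpen.union ho) ?_ subset_union_left g1.symm ?_
    · exact (IsPreconnected.union t ht ht₀ h.ordConnected.isPreconnected hc.isPreconnected).ordConnected
    · rintro r (hr | hr)
      · exact (h.straight.congr h.isOpen g1) r hr
      · exact (hs.congr ho g2) r hr
  have hJ₀ : J₀ ⊆ J := subset_union_right.trans hsub
  exact ⟨hJ₀, fun r hr => e1 ⟨hJ₀ hr, hr⟩⟩

theorem IsTrajectory.extends_of_zero {u : ℂ} {J J₀ : Set ℝ} {γ γ₀ : ℝ → S1} (h : IsTrajectory u J γ)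
    (ho : IsOpen J₀) (hc : J₀.OrdConnected) (hs : IsStraight u J₀ γ₀) {t : ℝ} (ht : t ∈ J)
    (h0 : 0 ∈ J₀) (e : γ t = γ₀ 0) : ∀ r ∈ J₀, r + t ∈ J ∧ γ (r + t) = γ₀ r := by
  have := h.extends (isOpen_preimage_add ho (-t)) (ordConnected_preimage_add hc (-t))
    (hs.comp_add (-t)) ht (by simpa using h0) (by simpa using e)
  intro r hr
  have hr' : r + t ∈ {t' | t' + -t ∈ J₀} := by simpa using hr
  exact ⟨this.1 hr', by simpa using this.2 hr'⟩

theorem exists_straight (u : ℂ) {x : S1} (hx : x ∉ singularities) :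
    ∃ r > 0, ∃ γ, IsStraight u (Metric.ball 0 r) γ ∧ γ 0 = x := by
  obtain ⟨n, a, ha, rfl⟩ := exists_chart hx
  have := eventually_line_mem_chartDomain ha u 0
  simp only [sub_zero] at this
  obtain ⟨r, hr, h⟩ := Metric.eventually_nhds_iff_ball.1 this
  refine ⟨r, hr, fun t => chart n (a + t * u), ?_, by simp⟩
  rw [isStraight_iff]
  intro t ht
  exact straightAt_of_germ (germ_chart (h t ht)) (Eventually.of_forall fun t' => by push_cast; ring_nf)

/-- All straight curves that are at `x` at time `0` agree where they are jointly defined, so their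
union is the maximal one. -/
theorem exists_trajectory (u : ℂ) {x : S1} (hx : x ∉ singularities) :
    ∃ J γ, IsTrajectory u J γ ∧ 0 ∈ J ∧ γ 0 = x := by
  let P : Set ℝ → (ℝ → S1) → Prop := fun J γ =>
    IsOpen J ∧ J.OrdConnected ∧ 0 ∈ J ∧ IsStraight u J γ ∧ γ 0 = x
  let J : Set ℝ := ⋃₀ {J | ∃ γ, P J γ}
  have hex : ∀ t ∈ J, ∃ γ, ∃ J', P J' γ ∧ t ∈ J' := by
    rintro t ⟨J', ⟨γ, h⟩, ht⟩
    exact ⟨γ, J', h, ht⟩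
  classical
  let γ : ℝ → S1 := fun t => if h : t ∈ J then (hex t h).choose t else x
  have hγ : ∀ J' γ', P J' γ' → EqOn γ γ' J' := by
    intro J' γ' h t ht
    have htJ : t ∈ J := ⟨J', ⟨γ', h⟩, ht⟩
    obtain ⟨J'', h2, ht2⟩ := (hex t htJ).choose_spec
    have : γ t = (hex t htJ).choose t := dif_pos htJ
    rw [this]
    exact IsStraight.eqOn (h2.2.1.inter h.2.1) (h2.2.2.2.1.mono inter_subset_left)
      (h.2.2.2.1.mono inter_subset_right) ⟨h2.2.2.1, h.2.2.1⟩ (h2.2.2.2.2.trans h.2.2.2.2.symm) ⟨ht2, ht⟩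
  obtain ⟨r, hr, γ₁, h1, h2⟩ := exists_straight u hx
  have hP1 : P (Metric.ball 0 r) γ₁ :=
    ⟨Metric.isOpen_ball, (convex_ball 0 r).ordConnected, Metric.mem_ball_self hr, h1, h2⟩
  have h0 : (0 : ℝ) ∈ J := ⟨_, ⟨_, hP1⟩, Metric.mem_ball_self hr⟩
  have hJo : IsOpen J := isOpen_sUnion fun J' ⟨γ', h⟩ => h.1
  have hJc : J.OrdConnected := by
    refine (isPreconnected_sUnion 0 _ ?_ ?_).ordConnected
    · rintro J' ⟨γ', h⟩; exact h.2.2.1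
    · rintro J' ⟨γ', h⟩; exact h.2.1.isPreconnected
  have hγ0 : γ 0 = x := (hγ _ _ hP1 (Metric.mem_ball_self hr)).trans h2
  have hst : IsStraight u J γ := by
    rintro t ⟨J', ⟨γ', h⟩, ht⟩
    exact (h.2.2.2.1.congr h.1 (hγ _ _ h)) t ht
  refine ⟨J, γ, ⟨⟨0, h0⟩, hJo, hJc, hst, fun J' γ' ho hc hsub he hs => ?_⟩, h0, hγ0⟩
  -- A straight extension is itself one of the curves in the union.
  exact fun t ht => ⟨J', ⟨γ', ho, hc, hsub h0, hs, by rw [← he h0, hγ0]⟩, ht⟩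

/-- A straight curve inside one polygon, avoiding the vertices. -/
theorem isStraight_pt {s : Bool} {z u : ℂ} {J : Set ℝ} (hJ : IsOpen J)
    (h : ∀ t ∈ J, z + t * u ∈ poly s) (hv : ∀ t ∈ J, ¬ IsVertex (z + t * u)) :
    IsStraight u J (fun t => pt s (z + t * u)) := by
  rw [isStraight_iff]
  intro t ht
  obtain ⟨n, hn⟩ := exists_chartDomain (h t ht) (hv t ht)
  refine straightAt_of_germ (germ_chart hn) ?_
  filter_upwards [hJ.mem_nhds ht] with t' ht'
  rw [← chart_add_shift (n := n) (h t' ht')]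
  push_cast; ring_nf

/-- A straight curve inside one polygon does not extend beyond a vertex. -/
theorem not_straightAt_of_vertex {s : Bool} {z u : ℂ} {γ : ℝ → S1} {t : ℝ} (hz : z ∈ poly s)
    (hv : IsVertex z) (h : ∃ᶠ t' in 𝓝 t, z + ((t' - t : ℝ) : ℂ) * u ∈ poly s ∧
      γ t' = pt s (z + ((t' - t : ℝ) : ℂ) * u)) : ¬ StraightAt u γ t := by
  rw [straightAt_iff]
  rintro ⟨n, a, ha, h'⟩
  obtain ⟨t', ⟨h1, h2⟩, h3, h4⟩ :=
    (h.and_eventually (h'.and (eventually_line_mem_chartDomain ha u t))).exists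
  -- A single common time fixes the chart coordinate of the curve at `t`: it is the vertex, which no
  -- chart domain contains.
  have := eq_of_chart_eq_pt h4 h1 (by rw [← h3, h2])
  have e : a = z + shift n s := by linear_combination this
  exact not_isVertex_of_chartDomain hz (e ▸ ha) hv

end

section

/-! ### The metric -/

theorem edist_pt_le {s : Bool} {z w : ℂ} (hz : z ∈ poly s) (hw : w ∈ poly s) :
    edist (pt s z) (pt s w) ≤ edist z w := by
  have h1 : legDist (pt s z) (pt s w) ≤ edist z w := by
    refine iInf_le_of_le s (iInf_le_of_le ⟨z, hz⟩ (iInf_le_of_le ⟨w, hw⟩ (iInf_le_of_le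
      (pt_of_mem hz).symm (iInf_le_of_le (pt_of_mem hw).symm le_rfl))))
  refine le_trans ?_ h1
  exact iInf_le_of_le 1 (iInf_le_of_le (fun i => if i = 0 then pt s z else pt s w)
    (iInf_le_of_le (by simp) (iInf_le_of_le (by simp) (by simp))))

theorem continuousOn_pt (s : Bool) : ContinuousOn (pt s) (poly s) := by
  have : LipschitzOnWith 1 (pt s) (poly s) := fun z hz w hw => by
    simpa using edist_pt_le hz hw
  exact this.continuousOn

/-- A map on `S₁` is Lipschitz if it is Lipschitz on both polygons. -/
theorem lipschitzWith_of_poly {E : Type*} [PseudoEMetricSpace E] {φ : S1 → E} {C : NNReal}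
    (hC : C ≠ 0)
    (h : ∀ s, ∀ z ∈ poly s, ∀ w ∈ poly s, edist (φ (pt s z)) (φ (pt s w)) ≤ C * edist z w) :
    LipschitzWith C φ := by
  intro x y
  have hC' : (C : ℝ≥0∞) ≠ 0 := by simpa using hC
  have hleg : ∀ x y, edist (φ x) (φ y) ≤ C * legDist x y := by
    intro x y
    -- The constant is divided away so that the bound can be checked on each member of the infimum;
    -- this needs `C ≠ 0`.
    rw [mul_comm, ← ENNReal.div_le_iff_le_mul (Or.inl hC') (Or.inl ENNReal.coe_ne_top)]
    refine le_iInf fun s => le_iInf fun z => le_iInf fun w => le_iInf fun hz => le_iInf fun hw => ?_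
    rw [ENNReal.div_le_iff_le_mul (Or.inl hC') (Or.inl ENNReal.coe_ne_top), mul_comm]
    rw [← hz, ← hw, ← pt_of_mem, ← pt_of_mem]
    exact h s z z.2 w w.2
  change _ ≤ C * pathDist x y
  rw [mul_comm, ← ENNReal.div_le_iff_le_mul (Or.inl hC') (Or.inl ENNReal.coe_ne_top)]
  refine le_iInf fun n => le_iInf fun c => le_iInf fun h0 => le_iInf fun hn => ?_
  rw [ENNReal.div_le_iff_le_mul (Or.inl hC') (Or.inl ENNReal.coe_ne_top), mul_comm, ← h0, ← hn,
    Finset.mul_sum]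
  exact (edist_le_range_sum_edist (fun i => φ (c i)) n).trans (Finset.sum_le_sum fun i _ => hleg _ _)

/-- A map that is pointwise locally Lipschitz along a segment is Lipschitz for its endpoints. -/
theorem edist_le_of_locally {E : Type*} [PseudoEMetricSpace E] {g : ℝ → E} {C : NNReal}
    (h : ∀ t ∈ Icc (0 : ℝ) 1, ∀ᶠ t' in 𝓝[Icc 0 1] t, edist (g t) (g t') ≤ C * edist t t') :
    edist (g 0) (g 1) ≤ C := by
  have hcont : ContinuousOn g (Icc 0 1) := by
    intro t ht
    rw [ContinuousWithinAt, tendsto_iff_edist_tendsto_0]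
    have hC : Tendsto (fun t' => (C : ℝ≥0∞) * edist t t') (𝓝[Icc 0 1] t) (𝓝 0) := by
      have h1 : Tendsto (fun t' => edist t t') (𝓝[Icc 0 1] t) (𝓝 0) := by
        have : Continuous fun t' : ℝ => edist t t' := by fun_prop
        simpa using (this.tendsto t).mono_left nhdsWithin_le_nhds
      simpa using ENNReal.Tendsto.const_mul h1 (Or.inr ENNReal.coe_ne_top)
    refine tendsto_of_tendsto_of_tendsto_of_le_of_le' tendsto_const_nhds hC
      (Eventually.of_forall fun _ => zero_le) ?_
    filter_upwards [h t ht] with t' ht'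
    rwa [edist_comm]
  have hcl : IsClosed ({t | edist (g 0) (g t) ≤ C * edist 0 t} ∩ Icc 0 1) := by
    rw [inter_comm]
    refine isClosed_Icc.isClosed_le (f := fun t => edist (g 0) (g t)) ?_ ?_
    · exact (continuous_const.edist continuous_id).comp_continuousOn hcont
    · have h1 : Continuous fun t : ℝ => edist 0 t := by fun_prop
      exact (ENNReal.continuous_const_mul ENNReal.coe_ne_top).comp_continuousOn h1.continuousOn
  -- Continuous induction: the set of good times is closed, and the local bound at a good time
  -- extends it to the right because distances on the line add up.
  have := hcl.Icc_subset_of_forall_exists_gt (by simp) (by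
    rintro t ⟨ht, ht0, ht1⟩ y hy
    have h1 : ∀ᶠ t' in 𝓝[>] t, edist (g t) (g t') ≤ C * edist t t' := by
      have hle : 𝓝[>] t ≤ 𝓝[Icc 0 1] t := by
        rw [← nhdsWithin_Ioc_eq_nhdsGT ht1]
        exact nhdsWithin_mono _ fun r hr => ⟨ht0.trans hr.1.le, hr.2⟩
      exact hle (h t ⟨ht0, ht1.le⟩)
    obtain ⟨t', h2, h3⟩ := (h1.and (Ioc_mem_nhdsGT hy)).exists
    refine ⟨t', ?_, h3⟩
    have e : edist (0 : ℝ) t' = edist 0 t + edist t t' := by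
      rw [edist_dist, edist_dist, edist_dist, ← ENNReal.ofReal_add dist_nonneg dist_nonneg]
      congr 1
      simp only [Real.dist_eq]
      rw [abs_of_nonpos (by linarith [h3.1]), abs_of_nonpos (by linarith),
        abs_of_nonpos (by linarith [h3.1])]
      ring
    change edist (g 0) (g t') ≤ C * edist 0 t'
    rw [e, mul_add]
    exact (edist_triangle _ (g t) _).trans (add_le_add ht h2))
  have := this (right_mem_Icc.2 zero_le_one)
  simpa [edist_dist] using this

/-- A map on a convex set that is pointwise locally Lipschitz is Lipschitz. -/
theorem edist_le_of_locally_convex {E : Type*} [PseudoEMetricSpace E] {S : Set ℂ} (hS : Convex ℝ S)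
    {g : ℂ → E} {C : NNReal}
    (h : ∀ z ∈ S, ∀ᶠ w in 𝓝[S] z, edist (g z) (g w) ≤ C * edist z w) {z w : ℂ} (hz : z ∈ S)
    (hw : w ∈ S) : edist (g z) (g w) ≤ C * edist z w := by
  have hmem : ∀ t ∈ Icc (0 : ℝ) 1, z + t * (w - z) ∈ S := by
    intro t ht
    have := hS hz hw (a := 1 - t) (b := t) (by linarith [ht.2]) ht.1 (by ring)
    convert this using 1
    simp only [Complex.real_smul]; push_cast; ring
  have hcont : Continuous fun t : ℝ => z + t * (w - z) := by fun_prop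
  -- The segment is parametrized by `[0, 1]`, so its length enters the constant.
  have := edist_le_of_locally (g := fun t : ℝ => g (z + t * (w - z))) (C := C * nndist z w) ?_
  · simp only [Complex.ofReal_zero, zero_mul, add_zero, Complex.ofReal_one, one_mul,
      add_sub_cancel] at this
    rwa [edist_nndist z w, ← ENNReal.coe_mul]
  · intro t ht
    have h1 : Tendsto (fun t : ℝ => z + t * (w - z)) (𝓝[Icc 0 1] t) (𝓝[S] (z + t * (w - z))) :=
      tendsto_nhdsWithin_of_tendsto_nhds_of_eventually_within _
        ((hcont.tendsto t).mono_left nhdsWithin_le_nhds)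
        (eventually_mem_nhdsWithin.mono hmem)
    filter_upwards [h1.eventually (h _ (hmem t ht))] with t' ht'
    refine ht'.trans (le_of_eq ?_)
    rw [ENNReal.coe_mul, mul_assoc]
    congr 1
    simp only [edist_nndist]
    rw [← ENNReal.coe_mul]
    congr 1
    apply NNReal.eq
    rw [NNReal.coe_mul, coe_nndist, coe_nndist, coe_nndist, dist_eq_norm, dist_eq_norm, dist_eq_norm]
    have : z + t * (w - z) - (z + t' * (w - z)) = ((t - t' : ℝ) : ℂ) * (w - z) := by push_cast; ring
    rw [this, norm_mul, Complex.norm_real, norm_sub_rev w z, mul_comm]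

end

section

/-! ### Affine automorphisms -/

/-- The determinant of two vectors of the plane. -/
def cross (u z : ℂ) : ℝ := u.re * z.im - u.im * z.re

/-- `φ` is an affine automorphism of `S₁` of area one with linear part `L`. -/
structure AffineAut (L : ℂ ≃L[ℝ] ℂ) (φ : S1 ≃ₜ S1) : Prop where
  cross_map : ∀ z w, cross (L z) (L w) = cross z w
  sing : ∀ x, φ x ∈ singularities ↔ x ∈ singularities
  germ : ∀ f z, Germ f z → Germ (fun w => φ (f (L.symm w))) (L z)

theorem tendsto_clm_sub (L : ℂ ≃L[ℝ] ℂ) (z z' : ℂ) :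
    Tendsto (fun w => z + L (w - z')) (𝓝 z') (𝓝 z) := by
  have h : Continuous fun w => z + L (w - z') := by fun_prop
  simpa using h.tendsto z'

/-- One germ at each nonsingular point suffices, because germs with the same value agree up to a
translation of the argument. -/
theorem affineAut_of_exists {L : ℂ ≃L[ℝ] ℂ} {φ : S1 ≃ₜ S1}
    (hc : ∀ z w, cross (L z) (L w) = cross z w)
    (hs : ∀ x, φ x ∈ singularities ↔ x ∈ singularities)
    (h : ∀ x ∉ singularities, ∃ f g z z', Germ f z ∧ f z = x ∧ Germ g z' ∧
      ∀ᶠ w in 𝓝 0, φ (f (z + w)) = g (z' + L w)) : AffineAut L φ := by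
  refine ⟨hc, hs, fun f z hf => ?_⟩
  obtain ⟨f', g, z₁, z', hf', e, hg, h⟩ := h (f z) hf.not_mem_singularities
  have h1 := hf.eventuallyEq hf' e.symm
  refine (hg.translate (L z)).congr ?_
  have t1 : Tendsto L.symm (𝓝 (L z)) (𝓝 z) := by
    simpa using L.symm.continuous.tendsto (L z)
  have t2 : Tendsto (fun w => L.symm w - z) (𝓝 (L z)) (𝓝 0) := by
    have h : Continuous fun w => L.symm w - z := by fun_prop
    simpa using h.tendsto (L z)
  filter_upwards [t1.eventually h1, t2.eventually h] with w h2 h3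
  rw [h2, h3]; simp

namespace AffineAut

variable {L L' : ℂ ≃L[ℝ] ℂ} {φ φ' : S1 ≃ₜ S1}

theorem symm (h : AffineAut L φ) : AffineAut L.symm φ.symm := by
  have hsing : ∀ x, φ.symm x ∈ singularities ↔ x ∈ singularities := fun x => by
    rw [← h.sing, φ.apply_symm_apply]
  refine affineAut_of_exists (fun z w => ?_) hsing fun x hx => ?_
  · rw [← h.cross_map]; simp
  · obtain ⟨g, hg, hgx⟩ := exists_germ (mt (hsing x).1 hx) 0
    refine ⟨_, g, _, 0, h.germ g 0 hg, ?_, hg, ?_⟩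
    · simp [hgx]
    · simp

theorem trans (h : AffineAut L φ) (h' : AffineAut L' φ') : AffineAut (L.trans L') (φ.trans φ') := by
  refine ⟨fun z w => ?_, fun x => ?_, fun f z hf => ?_⟩
  · exact (h'.cross_map _ _).trans (h.cross_map _ _)
  · exact (h'.sing _).trans (h.sing _)
  · exact h'.germ _ _ (h.germ f z hf)

theorem refl : AffineAut (ContinuousLinearEquiv.refl ℝ ℂ) (Homeomorph.refl S1) :=
  ⟨fun _ _ => rfl, fun _ => Iff.rfl, fun _ _ h => h⟩

variable {u u' : ℂ} {c : ℝ}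

/-- The linear part changes the speed; the time scale `c` corrects this, so that directions of unit
vectors can be compared. -/
theorem straight_map (h : AffineAut L φ) (hu : u' = c * L u) {J : Set ℝ} {γ : ℝ → S1}
    (hγ : IsStraight u J γ) : IsStraight u' {t | c * t ∈ J} (fun t => φ (γ (c * t))) := by
  rw [isStraight_iff] at *
  intro t ht
  obtain ⟨f, hf, hw⟩ := hγ _ ht
  have hg := h.germ f 0 hf
  rw [map_zero] at hg
  refine ⟨_, hg, ?_⟩
  have : Tendsto (fun t' => c * t') (𝓝 t) (𝓝 (c * t)) := (continuous_const_mul c).tendsto t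
  filter_upwards [this.eventually hw] with t' h'
  have e : ((t' - t : ℝ) : ℂ) * u' = L (((c * t' - c * t : ℝ) : ℂ) * u) := by
    have h1 : ((c * t' - c * t : ℝ) : ℂ) * u = (c * t' - c * t) • u := by simp
    have h2 : L ((c * t' - c * t) • u) = (c * t' - c * t) • L u := L.map_smul _ _
    rw [h1, h2, hu, Complex.real_smul]; push_cast; ring
  rw [e, L.symm_apply_apply, h']

theorem inv_eq (hc : 0 < c) (hu : u' = c * L u) : u = (c⁻¹ : ℝ) * L.symm u' := by
  have h1 : (c : ℂ) * L u = c • L u := by simp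
  rw [hu, h1, ← L.map_smul, L.symm_apply_apply, ← Complex.real_smul, inv_smul_smul₀ hc.ne']

theorem ordConnected_mul (hc : 0 < c) {J : Set ℝ} (hJ : J.OrdConnected) :
    {t | c * t ∈ J}.OrdConnected :=
  ⟨fun _ hx _ hy _ hz => hJ.out hx hy
    ⟨mul_le_mul_of_nonneg_left hz.1 hc.le, mul_le_mul_of_nonneg_left hz.2 hc.le⟩⟩

theorem isOpen_mul (c : ℝ) {J : Set ℝ} (hJ : IsOpen J) : IsOpen {t | c * t ∈ J} :=
  hJ.preimage (continuous_const_mul c)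

theorem trajectory_map (h : AffineAut L φ) (hc : 0 < c) (hu : u' = c * L u) {J : Set ℝ} {γ : ℝ → S1}
    (hγ : IsTrajectory u J γ) : IsTrajectory u' {t | c * t ∈ J} (fun t => φ (γ (c * t))) := by
  refine ⟨?_, isOpen_mul c hγ.isOpen, ordConnected_mul hc hγ.ordConnected,
    h.straight_map hu hγ.straight, fun J' γ' ho hJ' hsub he hs => ?_⟩
  · obtain ⟨t, ht⟩ := hγ.nonempty
    exact ⟨c⁻¹ * t, by simpa [mul_inv_cancel_left₀ hc.ne'] using ht⟩
  · have hs' := h.symm.straight_map (inv_eq hc hu) hs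
    have := hγ.maximal _ _ (isOpen_mul c⁻¹ ho) (ordConnected_mul (inv_pos.2 hc) hJ') ?_ ?_ hs'
    · intro t ht
      exact this (by simpa [inv_mul_cancel_left₀ hc.ne'] using ht)
    · intro t ht
      exact hsub (by simpa [mul_inv_cancel_left₀ hc.ne'] using ht)
    · intro t ht
      have h1 := he (show c⁻¹ * t ∈ {t | c * t ∈ J} by simpa [mul_inv_cancel_left₀ hc.ne'] using ht)
      simp only [mul_inv_cancel_left₀ hc.ne'] at h1
      change γ t = φ.symm (γ' (c⁻¹ * t))
      rw [← h1, φ.symm_apply_apply]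

theorem singularForward_map (h : AffineAut L φ) (hc : 0 < c) {J : Set ℝ} {γ : ℝ → S1}
    (hγ : SingularForward J γ) : SingularForward {t | c * t ∈ J} (fun t => φ (γ (c * t))) := by
  obtain ⟨b, hb, p, hp, ht⟩ := hγ
  refine ⟨c⁻¹ * b, ⟨fun t ht => ?_, fun r hr => ?_⟩, φ p, (h.sing p).2 hp, ?_⟩
  · have := hb.1 ht
    rw [← div_eq_inv_mul, le_div_iff₀ hc]; linarith
  · have h1 : b ≤ c * r := hb.2 fun t ht => by
      have := hr (show c⁻¹ * t ∈ {t | c * t ∈ J} by simpa [mul_inv_cancel_left₀ hc.ne'] using ht)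
      rwa [← div_eq_inv_mul, div_le_iff₀ hc, mul_comm] at this
    rw [← div_eq_inv_mul, div_le_iff₀ hc]; linarith
  · refine (φ.continuous.tendsto p).comp (ht.comp (tendsto_nhdsWithin_iff.2 ⟨?_, ?_⟩))
    · have := (continuous_const_mul c).tendsto (c⁻¹ * b)
      rw [mul_inv_cancel_left₀ hc.ne'] at this
      exact this.mono_left nhdsWithin_le_nhds
    · filter_upwards [self_mem_nhdsWithin] with t ht
      rw [mem_Iio, ← div_eq_inv_mul, lt_div_iff₀ hc] at ht
      rw [mem_Iio]; linarith

theorem singularBackward_map (h : AffineAut L φ) (hc : 0 < c) {J : Set ℝ} {γ : ℝ → S1}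
    (hγ : SingularBackward J γ) : SingularBackward {t | c * t ∈ J} (fun t => φ (γ (c * t))) := by
  obtain ⟨b, hb, p, hp, ht⟩ := hγ
  refine ⟨c⁻¹ * b, ⟨fun t ht => ?_, fun r hr => ?_⟩, φ p, (h.sing p).2 hp, ?_⟩
  · have := hb.1 ht
    rw [← div_eq_inv_mul, div_le_iff₀ hc]; linarith
  · have h1 : c * r ≤ b := hb.2 fun t ht => by
      have := hr (show c⁻¹ * t ∈ {t | c * t ∈ J} by simpa [mul_inv_cancel_left₀ hc.ne'] using ht)
      rwa [← div_eq_inv_mul, le_div_iff₀ hc, mul_comm] at this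
    rw [← div_eq_inv_mul, le_div_iff₀ hc]; linarith
  · refine (φ.continuous.tendsto p).comp (ht.comp (tendsto_nhdsWithin_iff.2 ⟨?_, ?_⟩))
    · have := (continuous_const_mul c).tendsto (c⁻¹ * b)
      rw [mul_inv_cancel_left₀ hc.ne'] at this
      exact this.mono_left nhdsWithin_le_nhds
    · filter_upwards [self_mem_nhdsWithin] with t ht
      rw [mem_Ioi, ← div_eq_inv_mul, div_lt_iff₀ hc] at ht
      rw [mem_Ioi]; linarith

theorem isClosedTrajectory_map (φ : S1 → S1) (hc : 0 < c) {J : Set ℝ} {γ : ℝ → S1}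
    (hγ : IsClosedTrajectory J γ) : IsClosedTrajectory {t | c * t ∈ J} (fun t => φ (γ (c * t))) := by
  obtain ⟨rfl, T, hT, hp⟩ := hγ
  refine ⟨by simp, c⁻¹ * T, by positivity, fun t => ?_⟩
  dsimp only
  rw [mul_add, mul_inv_cancel_left₀ hc.ne', hp]

theorem escapesForward_map (φ : S1 ≃ₜ S1) (hc : 0 < c) {J : Set ℝ} {γ : ℝ → S1}
    (hγ : EscapesForward J γ) : EscapesForward {t | c * t ∈ J} (fun t => φ (γ (c * t))) := by
  intro K hK
  obtain ⟨T, hT, h⟩ := hγ _ (φ.isCompact_preimage.2 hK)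
  refine ⟨c⁻¹ * T, by simpa [mul_inv_cancel_left₀ hc.ne'] using hT, fun t ht hle => h _ ht ?_⟩
  rwa [← div_eq_inv_mul, div_le_iff₀ hc, mul_comm] at hle

theorem escapesBackward_map (φ : S1 ≃ₜ S1) (hc : 0 < c) {J : Set ℝ} {γ : ℝ → S1}
    (hγ : EscapesBackward J γ) : EscapesBackward {t | c * t ∈ J} (fun t => φ (γ (c * t))) := by
  intro K hK
  obtain ⟨T, hT, h⟩ := hγ _ (φ.isCompact_preimage.2 hK)
  refine ⟨c⁻¹ * T, by simpa [mul_inv_cancel_left₀ hc.ne'] using hT, fun t ht hle => h _ ht ?_⟩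
  rwa [← div_eq_inv_mul, le_div_iff₀ hc, mul_comm] at hle

/-- Every trajectory is the image of a trajectory. -/
theorem exists_trajectory_preimage (h : AffineAut L φ) (hc : 0 < c) (hu : u' = c * L u) {J : Set ℝ}
    {γ : ℝ → S1} (hγ : IsTrajectory u' J γ) : ∃ J₀ γ₀, IsTrajectory u J₀ γ₀ ∧
      J = {t | c * t ∈ J₀} ∧ γ = fun t => φ (γ₀ (c * t)) := by
  refine ⟨_, _, h.symm.trajectory_map (inv_pos.2 hc) (inv_eq hc hu) hγ, ?_, ?_⟩
  · ext t; simp [inv_mul_cancel_left₀ hc.ne']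
  · ext t; simp [inv_mul_cancel_left₀ hc.ne']

end AffineAut

/-! ### Transport of cylinders, strips and decompositions by affine automorphisms -/

theorem mem_planeStrip {u : ℂ} (hu : u ≠ 0) {w : ℝ} {z : ℂ} :
    z ∈ planeStrip u w ↔ 0 < cross u z ∧ cross u z < w * Complex.normSq u := by
  have h : 0 < Complex.normSq u := Complex.normSq_pos.2 hu
  have e : (z / u).im = cross u z / Complex.normSq u := by
    rw [Complex.div_im, cross]; ring
  change 0 < (z / u).im ∧ (z / u).im < w ↔ _
  rw [e, div_lt_iff₀ h, div_pos_iff_of_pos_right h]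

namespace AffineAut

variable {L : ℂ ≃L[ℝ] ℂ} {φ : S1 ≃ₜ S1} {u u' : ℂ} {c : ℝ}

theorem ne_zero (hc : 0 < c) (hu : u' = c * L u) (h0 : u ≠ 0) : u' ≠ 0 := by
  rw [hu]
  exact mul_ne_zero (by exact_mod_cast hc.ne') (by simpa using h0)

/-- The new width is dictated by `cross u' (L z) = c * cross u z`, which holds because `L` preserves
determinants. -/
theorem mem_planeStrip_map (h : AffineAut L φ) (hc : 0 < c) (hu : u' = c * L u) (h0 : u ≠ 0)
    {w : ℝ} {z : ℂ} :
    L z ∈ planeStrip u' (w * c * Complex.normSq u / Complex.normSq u') ↔ z ∈ planeStrip u w := by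
  have hu' := ne_zero hc hu h0
  have hn : Complex.normSq u' ≠ 0 := (Complex.normSq_pos.2 hu').ne'
  rw [mem_planeStrip h0, mem_planeStrip hu', div_mul_cancel₀ _ hn]
  have e : cross u' (L z) = c * cross u z := by
    rw [← h.cross_map u z, hu]; simp [cross]; ring
  rw [e, show w * c * Complex.normSq u = c * (w * Complex.normSq u) by ring,
    mul_lt_mul_iff_right₀ hc, mul_pos_iff_of_pos_left hc]

theorem isTranslationMap_map (h : AffineAut L φ) (hc : 0 < c) (hu : u' = c * L u) (h0 : u ≠ 0)
    {w : ℝ} {f : ℂ → S1} (hf : IsTranslationMap f (planeStrip u w)) :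
    IsTranslationMap (fun z => φ (f (L.symm z)))
      (planeStrip u' (w * c * Complex.normSq u / Complex.normSq u')) := by
  rw [isTranslationMap_iff] at *
  intro z hz
  rw [← L.apply_symm_apply z, h.mem_planeStrip_map hc hu h0] at hz
  simpa using h.germ f _ (hf _ hz)

theorem image_planeStrip_map (h : AffineAut L φ) (hc : 0 < c) (hu : u' = c * L u) (h0 : u ≠ 0)
    (w : ℝ) (f : ℂ → S1) : φ '' (f '' planeStrip u w) = (fun z => φ (f (L.symm z))) ''
      planeStrip u' (w * c * Complex.normSq u / Complex.normSq u') := by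
  ext x
  constructor
  · rintro ⟨_, ⟨z, hz, rfl⟩, rfl⟩
    exact ⟨L z, (h.mem_planeStrip_map hc hu h0).2 hz, by simp⟩
  · rintro ⟨z, hz, rfl⟩
    rw [← L.apply_symm_apply z, h.mem_planeStrip_map hc hu h0] at hz
    exact ⟨_, ⟨_, hz, rfl⟩, rfl⟩

theorem width_pos (hc : 0 < c) (hu : u' = c * L u) (h0 : u ≠ 0) {w : ℝ} (hw : 0 < w) :
    0 < w * c * Complex.normSq u / Complex.normSq u' := by
  have := Complex.normSq_pos.2 h0
  have := Complex.normSq_pos.2 (ne_zero hc hu h0)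
  positivity

theorem isCylinder_map (h : AffineAut L φ) (hc : 0 < c) (hu : u' = c * L u) (h0 : u ≠ 0)
    {C : Set S1} (hC : IsCylinder u C) : IsCylinder u' (φ '' C) := by
  obtain ⟨w, d, f, hw, hd, hf, hp, rfl⟩ := hC
  -- The period vector `d * u` is sent by `L` to `(d / c) * u'`.
  refine ⟨_, d / c, _, width_pos hc hu h0 hw, div_pos hd hc, h.isTranslationMap_map hc hu h0 hf,
    fun z hz z' hz' => ?_, h.image_planeStrip_map hc hu h0 w f⟩
  rw [← L.apply_symm_apply z, h.mem_planeStrip_map hc hu h0] at hz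
  rw [← L.apply_symm_apply z', h.mem_planeStrip_map hc hu h0] at hz'
  rw [φ.injective.eq_iff, hp _ hz _ hz']
  refine exists_congr fun k => ?_
  rw [← map_sub, ← L.injective.eq_iff, L.apply_symm_apply]
  have e1 : (k : ℂ) * d * u = ((k : ℝ) * d) • u := by simp
  have e2 : L (((k : ℝ) * d) • u) = ((k : ℝ) * d) • L u := L.map_smul _ _
  have hc' : (c : ℂ) ≠ 0 := by exact_mod_cast hc.ne'
  rw [e1, e2, hu, Complex.real_smul]
  push_cast
  rw [show (k : ℂ) * (d / c) * (c * L u) = k * d * L u by field_simp]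

theorem isInfiniteStrip_map (h : AffineAut L φ) (hc : 0 < c) (hu : u' = c * L u) (h0 : u ≠ 0)
    {C : Set S1} (hC : IsInfiniteStrip u C) : IsInfiniteStrip u' (φ '' C) := by
  obtain ⟨w, f, hw, hf, hp, rfl⟩ := hC
  refine ⟨_, _, width_pos hc hu h0 hw, h.isTranslationMap_map hc hu h0 hf,
    fun z hz z' hz' e => ?_, h.image_planeStrip_map hc hu h0 w f⟩
  rw [← L.apply_symm_apply z, h.mem_planeStrip_map hc hu h0] at hz
  rw [← L.apply_symm_apply z', h.mem_planeStrip_map hc hu h0] at hz'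
  exact L.symm.injective (hp hz hz' (φ.injective e))

theorem isDecomposition_map (h : AffineAut L φ) (hc : 0 < c) (hu : u' = c * L u)
    {𝒞 : Set (Set S1)} (hC : IsDecomposition u 𝒞) : IsDecomposition u' ((φ '' ·) '' 𝒞) := by
  obtain ⟨h1, h2, h3⟩ := hC
  refine ⟨?_, ?_, fun x hx hx' => ?_⟩
  · rintro _ ⟨C, hC, rfl⟩ _ ⟨C', hC', rfl⟩ hne
    have : C ≠ C' := fun e => hne (by rw [e])
    exact (disjoint_image_iff φ.injective).2 (h1 hC hC' this)
  · rw [biUnion_image]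
    have : ∀ C : Set S1, closure (φ '' C) = φ '' closure C := fun C => (φ.image_closure C).symm
    simp only [this]
    rw [← image_iUnion₂, h2, image_univ, φ.surjective.range_eq]
  · have hx0 : φ.symm x ∉ singularities := by rwa [← h.sing, φ.apply_symm_apply]
    have hx1 : φ.symm x ∉ ⋃₀ 𝒞 := by
      rintro ⟨C, hC, hxC⟩
      exact hx' ⟨_, ⟨C, hC, rfl⟩, ⟨_, hxC, by simp⟩⟩
    obtain ⟨J, γ, hγ, ⟨t, ht, e⟩, hs⟩ := h3 _ hx0 hx1
    refine ⟨_, _, h.trajectory_map hc hu hγ, ⟨c⁻¹ * t, ?_, ?_⟩,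
      hs.imp (h.singularForward_map hc) (h.singularBackward_map hc)⟩
    · simpa [mul_inv_cancel_left₀ hc.ne'] using ht
    · simp [mul_inv_cancel_left₀ hc.ne', e]

theorem isCompletelyPeriodic_map (h : AffineAut L φ) (hc : 0 < c) (hu : u' = c * L u) (h0 : u ≠ 0)
    (hC : IsCompletelyPeriodic u) : IsCompletelyPeriodic u' := by
  obtain ⟨⟨𝒞, h1, h2⟩, h3⟩ := hC
  refine ⟨⟨_, ?_, h.isDecomposition_map hc hu h2⟩, fun J γ hγ => ?_⟩
  · rintro _ ⟨C, hC, rfl⟩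
    exact h.isCylinder_map hc hu h0 (h1 C hC)
  · obtain ⟨J₀, γ₀, h4, rfl, rfl⟩ := h.exists_trajectory_preimage hc hu hγ
    exact (h3 _ _ h4).imp (isClosedTrajectory_map φ hc) fun h5 =>
      ⟨h.singularForward_map hc h5.1, h.singularBackward_map hc h5.2⟩

end AffineAut

/-- `S₁` decomposes into strips in the direction `u`, and every trajectory in this direction is
singular in at most one direction of time and escapes in every nonsingular one. -/
def IsStripDirection (u : ℂ) : Prop :=
  (∃ 𝒞 : Set (Set S1), (∀ C ∈ 𝒞, IsInfiniteStrip u C) ∧ IsDecomposition u 𝒞) ∧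
    ∀ (J : Set ℝ) (γ : ℝ → S1), IsTrajectory u J γ →
      ¬ (SingularForward J γ ∧ SingularBackward J γ) ∧
      (¬ SingularForward J γ → EscapesForward J γ) ∧
      (¬ SingularBackward J γ → EscapesBackward J γ)

theorem AffineAut.isStripDirection_map {L : ℂ ≃L[ℝ] ℂ} {φ : S1 ≃ₜ S1} {u u' : ℂ} {c : ℝ}
    (h : AffineAut L φ) (hc : 0 < c) (hu : u' = c * L u) (h0 : u ≠ 0)
    (hC : IsStripDirection u) : IsStripDirection u' := by
  obtain ⟨⟨𝒞, h1, h2⟩, h3⟩ := hC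
  refine ⟨⟨_, ?_, h.isDecomposition_map hc hu h2⟩, fun J γ hγ => ?_⟩
  · rintro _ ⟨C, hC, rfl⟩
    exact h.isInfiniteStrip_map hc hu h0 (h1 C hC)
  · obtain ⟨J₀, γ₀, h4, rfl, rfl⟩ := h.exists_trajectory_preimage hc hu hγ
    obtain ⟨h5, h6, h7⟩ := h3 _ _ h4
    -- Transport by `φ` followed by transport by its inverse restores the original curve. Hence
    -- singularity of the image implies singularity of the original, which the negated hypotheses
    -- need.
    have back : ∀ (P : Set ℝ → (ℝ → S1) → Prop),
        P {t | c⁻¹ * t ∈ {t | c * t ∈ J₀}} (fun t => φ.symm (φ (γ₀ (c * (c⁻¹ * t))))) → P J₀ γ₀ := by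
      intro P hP
      convert hP using 1
      · ext t; simp [mul_inv_cancel_left₀ hc.ne']
      · ext t; simp [mul_inv_cancel_left₀ hc.ne']
    have b1 : SingularForward {t | c * t ∈ J₀} (fun t => φ (γ₀ (c * t))) → SingularForward J₀ γ₀ :=
      fun h8 => back _ (h.symm.singularForward_map (inv_pos.2 hc) h8)
    have b2 : SingularBackward {t | c * t ∈ J₀} (fun t => φ (γ₀ (c * t))) → SingularBackward J₀ γ₀ :=
      fun h8 => back _ (h.symm.singularBackward_map (inv_pos.2 hc) h8)
    refine ⟨fun h8 => h5 ⟨b1 h8.1, b2 h8.2⟩, fun h8 => ?_, fun h8 => ?_⟩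
    · exact AffineAut.escapesForward_map φ hc (h6 fun h9 => h8 (h.singularForward_map hc h9))
    · exact AffineAut.escapesBackward_map φ hc (h7 fun h9 => h8 (h.singularBackward_map hc h9))

end

section

/-! ### The shears and the rotation by `π` -/

/-- The map on `S₁` defined by a function of representatives. -/
def liftPt {α : Type*} (P : Bool → ℂ → α) (hP : ∀ n, ∀ z ∈ edge n, P true z = P false (z - offset n)) :
    S1 → α :=
  Quot.lift (fun p : Piece => P p.1 p.2) (by
    rintro ⟨s, x, hx⟩ ⟨s', y, hy⟩ ⟨h1, h2, n, h3, h4⟩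
    dsimp only at h1 h2 h3 h4 ⊢
    subst h1 h2 h4
    exact hP n x h3)

theorem liftPt_pt {α : Type*} {P : Bool → ℂ → α}
    (hP : ∀ n, ∀ z ∈ edge n, P true z = P false (z - offset n)) {s : Bool} {z : ℂ} (hz : z ∈ poly s) :
    liftPt P hP (pt s z) = P s z := by
  rw [pt_of_mem hz]; rfl

/-- The shear `(x, y) ↦ (x, y + 2 a x)`. -/
def vshear (a : ℝ) : ℂ ≃L[ℝ] ℂ :=
  LinearEquiv.toContinuousLinearEquiv
    { toFun := fun z => ⟨z.re, z.im + 2 * a * z.re⟩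
      invFun := fun z => ⟨z.re, z.im - 2 * a * z.re⟩
      map_add' := fun z w => by apply Complex.ext <;> simp; ring
      map_smul' := fun r z => by apply Complex.ext <;> simp; ring
      left_inv := fun z => by apply Complex.ext <;> simp
      right_inv := fun z => by apply Complex.ext <;> simp }

/-- The shear `(x, y) ↦ (x + 2 a y, y)`. -/
def hshear (a : ℝ) : ℂ ≃L[ℝ] ℂ :=
  LinearEquiv.toContinuousLinearEquiv
    { toFun := fun z => ⟨z.re + 2 * a * z.im, z.im⟩
      invFun := fun z => ⟨z.re - 2 * a * z.im, z.im⟩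
      map_add' := fun z w => by apply Complex.ext <;> simp; ring
      map_smul' := fun r z => by apply Complex.ext <;> simp; ring
      left_inv := fun z => by apply Complex.ext <;> simp
      right_inv := fun z => by apply Complex.ext <;> simp }

@[simp] theorem vshear_re (a : ℝ) (z : ℂ) : (vshear a z).re = z.re := rfl
@[simp] theorem vshear_im (a : ℝ) (z : ℂ) : (vshear a z).im = z.im + 2 * a * z.re := rfl
@[simp] theorem hshear_re (a : ℝ) (z : ℂ) : (hshear a z).re = z.re + 2 * a * z.im := rfl
@[simp] theorem hshear_im (a : ℝ) (z : ℂ) : (hshear a z).im = z.im := rfl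

theorem cross_vshear (a : ℝ) (z w : ℂ) : cross (vshear a z) (vshear a w) = cross z w := by
  simp [cross]; ring

theorem cross_hshear (a : ℝ) (z w : ℂ) : cross (hshear a z) (hshear a w) = cross z w := by
  simp [cross]; ring

/-- The sign of a polygon. -/
def sgn (s : Bool) : ℝ := bif s then 1 else -1

@[simp] theorem sgn_true : sgn true = 1 := rfl
@[simp] theorem sgn_false : sgn false = -1 := rfl

/-- The affine map between polygons induced by `P_n ↦ P_{n + k}`. -/
def slide (k : ℤ) (s : Bool) (z : ℂ) : ℂ := vshear k z + sgn s * vertex k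

@[simp] theorem slide_re (k : ℤ) (s : Bool) (z : ℂ) : (slide k s z).re = z.re + sgn s * k := by
  simp [slide]
@[simp] theorem slide_im (k : ℤ) (s : Bool) (z : ℂ) :
    (slide k s z).im = z.im + 2 * k * z.re + sgn s * k ^ 2 := by simp [slide]

/-- The profile differs from `x²` by a periodic function, so it has the same integral translation
symmetry. This makes `slide` preserve the polygons. -/
theorem profile_add_int (x : ℝ) (k : ℤ) : profile (x + k) = profile x + 2 * k * x + k ^ 2 := by
  unfold profile; rw [Int.fract_add_intCast]; ring

theorem slide_mem_poly (k : ℤ) {s : Bool} {z : ℂ} (hz : z ∈ poly s) : slide k s z ∈ poly s := by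
  cases s
  · rw [mem_poly_false'] at *
    simp only [slide_re, slide_im, sgn_false, neg_mul, one_mul]
    have := profile_add_int z.re (-k)
    push_cast at this
    rw [this]; linarith
  · rw [mem_poly_true] at *
    simp only [slide_re, slide_im, sgn_true, one_mul, profile_add_int]
    linarith

theorem slide_mem_edge (k : ℤ) {n : ℤ} {z : ℂ} (hz : z ∈ edge n) : slide k true z ∈ edge (n + k) := by
  rw [mem_edge'] at *
  simp only [slide_re, slide_im, sgn_true, one_mul, profile_add_int]
  push_cast
  refine ⟨by linarith, by linarith, by linarith⟩

/-- Sliding commutes with the gluings, the edge `n` going to the edge `n + k`. For this the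
translation parts on the two polygons have opposite signs. -/
theorem slide_offset (k n : ℤ) (z : ℂ) :
    slide k true z - offset (n + k) = slide k false (z - offset n) := by
  apply Complex.ext <;> simp <;> ring

theorem slide_slide (k : ℤ) (s : Bool) (z : ℂ) : slide (-k) s (slide k s z) = z := by
  apply Complex.ext
  · simp
  · cases s <;> simp <;> ring

/-- The affine automorphism induced by `P_n ↦ P_{n + k}`, as a map. -/
def slideMap (k : ℤ) : S1 → S1 :=
  liftPt (fun s z => pt s (slide k s z)) fun n z hz => by
    rw [pt_edge (slide_mem_edge k hz), slide_offset]

theorem slideMap_pt (k : ℤ) {s : Bool} {z : ℂ} (hz : z ∈ poly s) :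
    slideMap k (pt s z) = pt s (slide k s z) := liftPt_pt _ hz

theorem continuous_slideMap (k : ℤ) : Continuous (slideMap k) := by
  -- The summand `1` only makes the constant visibly nonzero, as `lipschitzWith_of_poly` requires.
  have : LipschitzWith (‖(vshear k : ℂ →L[ℝ] ℂ)‖₊ + 1) (slideMap k) := by
    refine lipschitzWith_of_poly (by positivity) fun s z hz w hw => ?_
    rw [slideMap_pt k hz, slideMap_pt k hw]
    refine (edist_pt_le (slide_mem_poly k hz) (slide_mem_poly k hw)).trans ?_
    rw [slide, slide, edist_add_right]
    refine ((vshear k : ℂ →L[ℝ] ℂ).lipschitz z w).trans ?_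
    gcongr
    simp
  exact this.continuous

theorem slideMap_slideMap (k : ℤ) (x : S1) : slideMap (-k) (slideMap k x) = x := by
  obtain ⟨s, z, hz, rfl⟩ := exists_pt x
  rw [slideMap_pt k hz, slideMap_pt _ (slide_mem_poly k hz), slide_slide]

/-- The affine automorphism induced by `P_n ↦ P_{n + k}`. -/
def slideHomeo (k : ℤ) : S1 ≃ₜ S1 where
  toFun := slideMap k
  invFun := slideMap (-k)
  left_inv := slideMap_slideMap k
  right_inv x := by simpa using slideMap_slideMap (-k) x
  continuous_toFun := continuous_slideMap k
  continuous_invFun := continuous_slideMap (-k)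

theorem slide_mem_chartDomain (k : ℤ) {n : ℤ} {z : ℂ} (hz : z ∈ chartDomain n) :
    slide k true z ∈ chartDomain (n + k) := by
  rw [mem_chartDomain] at *
  have e := profile_add_int (2 * n + 1 - z.re) k
  have e1 : 2 * ((n + k : ℤ) : ℝ) + 1 - (z.re + 1 * k) = 2 * n + 1 - z.re + k := by push_cast; ring
  simp only [slide_re, slide_im, sgn_true, e1]
  rw [one_mul, profile_add_int, e]
  push_cast
  rcases hz with h | h | h
  · left; linarith
  · right; left; linarith
  · right; right; constructor <;> linarith

theorem slideMap_chart (k : ℤ) {n : ℤ} {z : ℂ} (hz : z ∈ chartDomain n) :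
    slideMap k (chart n z) = chart (n + k) (slide k true z) := by
  obtain ⟨s, hs⟩ := exists_shift hz
  rw [chart_of_mem hs, slideMap_pt k hs, ← chart_add_shift (n := n + k) (slide_mem_poly k hs)]
  congr 1
  cases s
  · rw [shift_false, shift_false, ← slide_offset]; ring
  · simp

theorem slideMap_not_mem (k : ℤ) {x : S1} (hx : x ∉ singularities) : slideMap k x ∉ singularities := by
  obtain ⟨n, a, ha, rfl⟩ := exists_chart hx
  rw [slideMap_chart k ha]
  exact chart_not_mem_singularities (slide_mem_chartDomain k ha)

theorem affineAut_slide (k : ℤ) : AffineAut (vshear k) (slideHomeo k) := by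
  refine affineAut_of_exists (cross_vshear k) (fun x => ?_) fun x hx => ?_
  · refine ⟨fun h => ?_, fun h => ?_⟩
    · by_contra hx
      exact slideMap_not_mem k hx h
    · by_contra hx
      have := slideMap_not_mem (-k) hx
      exact this (by rwa [← (slideHomeo k).symm_apply_apply x] at h)
  · obtain ⟨n, a, ha, rfl⟩ := exists_chart hx
    refine ⟨chart n, chart (n + k), a, _, germ_chart ha, rfl,
      germ_chart (slide_mem_chartDomain k ha), ?_⟩
    have := eventually_mem_chartDomain ha 0
    filter_upwards [this] with w hw
    rw [sub_zero] at hw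
    refine (slideMap_chart k hw).trans ?_
    congr 1
    simp only [slide, map_add]; ring

/-- The rotation by `π`, which exchanges the two polygons, as a map. -/
def swapMap : S1 → S1 :=
  liftPt (fun s z => pt (!s) (-z)) fun n z hz => by
    have := pt_edge (offset_sub_mem_edge hz)
    simp only [Bool.not_true, Bool.not_false, neg_sub]
    rw [this]; congr 1; ring

theorem swapMap_pt {s : Bool} {z : ℂ} (hz : z ∈ poly s) : swapMap (pt s z) = pt (!s) (-z) :=
  liftPt_pt _ hz

theorem neg_mem_poly_not {s : Bool} {z : ℂ} (hz : z ∈ poly s) : -z ∈ poly !s := by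
  rw [neg_mem_poly, Bool.not_not]; exact hz

theorem swapMap_swapMap (x : S1) : swapMap (swapMap x) = x := by
  obtain ⟨s, z, hz, rfl⟩ := exists_pt x
  rw [swapMap_pt hz, swapMap_pt (neg_mem_poly_not hz)]; simp

theorem continuous_swapMap : Continuous swapMap := by
  have : LipschitzWith 1 swapMap := by
    refine lipschitzWith_of_poly (by positivity) fun s z hz w hw => ?_
    rw [swapMap_pt hz, swapMap_pt hw]
    refine (edist_pt_le (neg_mem_poly_not hz) (neg_mem_poly_not hw)).trans ?_
    simp
  exact this.continuous

/-- The rotation by `π`, which exchanges the two polygons. -/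
def swapHomeo : S1 ≃ₜ S1 where
  toFun := swapMap
  invFun := swapMap
  left_inv := swapMap_swapMap
  right_inv := swapMap_swapMap
  continuous_toFun := continuous_swapMap
  continuous_invFun := continuous_swapMap

theorem swapMap_chart {n : ℤ} {z : ℂ} (hz : z ∈ chartDomain n) :
    swapMap (chart n z) = chart n (offset n - z) := by
  obtain ⟨s, hs⟩ := exists_shift hz
  rw [chart_of_mem hs, swapMap_pt hs, ← chart_add_shift (n := n) (neg_mem_poly_not hs)]
  congr 1
  cases s <;> simp; ring

theorem swapMap_not_mem {x : S1} (hx : x ∉ singularities) : swapMap x ∉ singularities := by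
  obtain ⟨n, a, ha, rfl⟩ := exists_chart hx
  rw [swapMap_chart ha]
  exact chart_not_mem_singularities (offset_sub_mem_chartDomain.2 ha)

theorem affineAut_swap : AffineAut (ContinuousLinearEquiv.neg ℝ) swapHomeo := by
  refine affineAut_of_exists (fun z w => by simp [cross]) (fun x => ?_) fun x hx => ?_
  · refine ⟨fun h => ?_, fun h => ?_⟩
    · by_contra hx
      exact swapMap_not_mem hx h
    · by_contra hx
      have := swapMap_not_mem hx
      exact this (by rwa [← swapHomeo.symm_apply_apply x] at h)
  · obtain ⟨n, a, ha, rfl⟩ := exists_chart hx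
    refine ⟨chart n, chart n, a, _, germ_chart ha, rfl,
      germ_chart (offset_sub_mem_chartDomain.2 ha), ?_⟩
    have := eventually_mem_chartDomain ha 0
    filter_upwards [this] with w hw
    rw [sub_zero] at hw
    refine (swapMap_chart hw).trans ?_
    congr 1
    simp; ring

end

section

/-! ### Trajectories inside one polygon -/

/-- A trajectory that passes through a segment of `poly s` ending at vertices is this segment. -/
theorem IsTrajectory.eq_segment {u z : ℂ} {s : Bool} {J J₀ : Set ℝ} {γ : ℝ → S1} {t₀ : ℝ}
    (h : IsTrajectory u J γ) (ht₀ : t₀ ∈ J) (e : γ t₀ = pt s z) (ho : IsOpen J₀)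
    (hc : J₀.OrdConnected) (h0 : 0 ∈ J₀) (hp : ∀ t ∈ J₀, z + t * u ∈ poly s)
    (hv : ∀ t ∈ J₀, ¬ IsVertex (z + t * u))
    (hend : ∀ r ∉ J₀, ∃ b ∈ uIcc 0 r, z + b * u ∈ poly s ∧ IsVertex (z + b * u) ∧
      ∃ᶠ t in 𝓝 b, t ∈ J₀) :
    (∀ t, t ∈ J ↔ t - t₀ ∈ J₀) ∧ ∀ t ∈ J, γ t = pt s (z + (t - t₀ : ℝ) * u) := by
  have h1 := h.extends_of_zero ho hc (isStraight_pt ho hp hv) ht₀ h0 (by simpa using e)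
  -- A trajectory reaching a time outside the segment would be straight at an intermediate time at
  -- which it is at a vertex.
  have h2 : ∀ t ∈ J, t - t₀ ∈ J₀ := by
    intro t ht
    by_contra hr
    obtain ⟨b, hb, hb1, hb2, hb3⟩ := hend _ hr
    have hbJ : b + t₀ ∈ J := by
      refine h.ordConnected.uIcc_subset ht₀ ht ?_
      rw [mem_uIcc] at *
      rcases hb with hb | hb
      · left; constructor <;> linarith
      · right; constructor <;> linarith
    refine not_straightAt_of_vertex (u := u) hb1 hb2 ?_ (isStraight_iff.1 h.straight _ hbJ)
    have ht : Tendsto (fun t => t + t₀) (𝓝 b) (𝓝 (b + t₀)) := (continuous_add_const t₀).tendsto b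
    refine ht.frequently (hb3.mono fun r hr => ?_)
    have e1 : z + b * u + ((r + t₀ - (b + t₀) : ℝ) : ℂ) * u = z + r * u := by push_cast; ring
    rw [e1]
    exact ⟨hp r hr, (h1 r hr).2⟩
  refine ⟨fun t => ⟨h2 t, fun ht => ?_⟩, fun t ht => ?_⟩
  · simpa using (h1 _ ht).1
  · simpa using (h1 _ (h2 t ht)).2

theorem tendsto_pt_line {u z : ℂ} {s : Bool} {J J₀ : Set ℝ} {γ : ℝ → S1} {t₀ b : ℝ} {l : Filter ℝ}
    (hl : l ≤ 𝓝 (b + t₀)) (hp : ∀ t ∈ J₀, z + t * u ∈ poly s) (hb : z + b * u ∈ poly s)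
    (hJ : ∀ t, t ∈ J ↔ t - t₀ ∈ J₀) (hγ : ∀ t ∈ J, γ t = pt s (z + (t - t₀ : ℝ) * u))
    (hlJ : ∀ᶠ t in l, t ∈ J) : Tendsto γ l (𝓝 (pt s (z + b * u))) := by
  have hc : Continuous fun t : ℝ => z + (t - t₀ : ℝ) * u := by fun_prop
  have h1 : Tendsto (fun t : ℝ => z + (t - t₀ : ℝ) * u) l (𝓝[poly s] (z + b * u)) := by
    refine tendsto_nhdsWithin_iff.2 ⟨?_, hlJ.mono fun t ht => hp _ ((hJ t).1 ht)⟩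
    have := hc.tendsto (b + t₀)
    simp only [add_sub_cancel_right] at this
    exact this.mono_left hl
  exact ((continuousOn_pt s _ hb).tendsto.comp h1).congr' (hlJ.mono fun t ht => (hγ t ht).symm)

theorem singularForward_of_segment {u z : ℂ} {s : Bool} {J J₀ : Set ℝ} {γ : ℝ → S1} {t₀ b : ℝ}
    (hp : ∀ t ∈ J₀, z + t * u ∈ poly s) (hb : z + b * u ∈ poly s) (hv : IsVertex (z + b * u))
    (hJ : ∀ t, t ∈ J ↔ t - t₀ ∈ J₀) (hγ : ∀ t ∈ J, γ t = pt s (z + (t - t₀ : ℝ) * u))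
    (hlub : IsLUB J₀ b) (hn : J₀ ∈ 𝓝[<] b) : SingularForward J γ := by
  refine ⟨b + t₀, ⟨fun t ht => ?_, fun r hr => ?_⟩, _, (pt_mem_singularities hb).2 hv,
    tendsto_pt_line nhdsWithin_le_nhds hp hb hJ hγ ?_⟩
  · linarith [hlub.1 ((hJ t).1 ht)]
  · have : b ≤ r - t₀ := hlub.2 fun t ht => by
      have := hr ((hJ (t + t₀)).2 (by simpa using ht))
      linarith
    linarith
  · have : Tendsto (fun t => t - t₀) (𝓝[<] (b + t₀)) (𝓝[<] b) := by
      refine tendsto_nhdsWithin_iff.2 ⟨?_, ?_⟩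
      · have := (continuous_sub_right t₀).tendsto (b + t₀)
        simp only [add_sub_cancel_right] at this
        exact this.mono_left nhdsWithin_le_nhds
      · filter_upwards [self_mem_nhdsWithin] with t ht
        rw [mem_Iio] at *; linarith
    exact (this.eventually_mem hn).mono fun t ht => (hJ t).2 ht

theorem singularBackward_of_segment {u z : ℂ} {s : Bool} {J J₀ : Set ℝ} {γ : ℝ → S1} {t₀ b : ℝ}
    (hp : ∀ t ∈ J₀, z + t * u ∈ poly s) (hb : z + b * u ∈ poly s) (hv : IsVertex (z + b * u))
    (hJ : ∀ t, t ∈ J ↔ t - t₀ ∈ J₀) (hγ : ∀ t ∈ J, γ t = pt s (z + (t - t₀ : ℝ) * u))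
    (hlub : IsGLB J₀ b) (hn : J₀ ∈ 𝓝[>] b) : SingularBackward J γ := by
  refine ⟨b + t₀, ⟨fun t ht => ?_, fun r hr => ?_⟩, _, (pt_mem_singularities hb).2 hv,
    tendsto_pt_line nhdsWithin_le_nhds hp hb hJ hγ ?_⟩
  · linarith [hlub.1 ((hJ t).1 ht)]
  · have : r - t₀ ≤ b := hlub.2 fun t ht => by
      have := hr ((hJ (t + t₀)).2 (by simpa using ht))
      linarith
    linarith
  · have : Tendsto (fun t => t - t₀) (𝓝[>] (b + t₀)) (𝓝[>] b) := by
      refine tendsto_nhdsWithin_iff.2 ⟨?_, ?_⟩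
      · have := (continuous_sub_right t₀).tendsto (b + t₀)
        simp only [add_sub_cancel_right] at this
        exact this.mono_left nhdsWithin_le_nhds
      · filter_upwards [self_mem_nhdsWithin] with t ht
        rw [mem_Ioi] at *; linarith
    exact (this.eventually_mem hn).mono fun t ht => (hJ t).2 ht

/-! ### Escaping upwards -/

theorem mem_closure_compl_poly {z : ℂ} (h : z.im = profile z.re) : z ∈ closure (poly true)ᶜ := by
  have hc : Continuous fun ε : ℝ => z - ε * Complex.I := by fun_prop
  have h1 : Tendsto (fun ε : ℝ => z - ε * Complex.I) (𝓝[>] 0) (𝓝 z) := by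
    have := hc.tendsto 0
    simp only [Complex.ofReal_zero, zero_mul, sub_zero] at this
    exact this.mono_left nhdsWithin_le_nhds
  refine mem_closure_of_tendsto h1 ?_
  filter_upwards [self_mem_nhdsWithin] with ε hε
  rw [mem_compl_iff, mem_poly_true]
  simp [← h]; simpa using hε

/-- The distance to the boundary of the polygons. -/
def boundaryDist : S1 → ℝ :=
  liftPt (fun s z => Metric.infDist z (poly s)ᶜ) fun n z hz => by
    have h1 := mem_closure_compl_poly (mem_edge'.1 hz).2.2
    have h2 := mem_closure_compl_poly (mem_edge'.1 (offset_sub_mem_edge hz)).2.2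
    rw [Metric.infDist_zero_of_mem_closure h1, eq_comm]
    apply Metric.infDist_zero_of_mem_closure
    have h3 : z - offset n ∈ Homeomorph.neg ℂ ⁻¹' closure (poly true)ᶜ := by simpa using h2
    rw [(Homeomorph.neg ℂ).preimage_closure] at h3
    exact h3

theorem continuous_boundaryDist : Continuous boundaryDist := by
  have : LipschitzWith 1 boundaryDist := by
    refine lipschitzWith_of_poly one_ne_zero fun s z hz w hw => ?_
    rw [boundaryDist, liftPt_pt _ hz, liftPt_pt _ hw]
    exact Metric.lipschitz_infDist_pt _ z w
  exact this.continuous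

theorem profile_le (x : ℝ) : profile x ≤ x ^ 2 + 1 := by
  have := Int.fract_nonneg x
  have := Int.fract_lt_one x
  unfold profile; nlinarith

/-- The continuous function `boundaryDist` is bounded on a compact set, but exceeds any bound far up
on a vertical line. -/
theorem escape_up {K : Set S1} (hK : IsCompact K) (z : ℂ) : ∃ T : ℝ, ∀ t : ℝ, T ≤ t →
    z + t * Complex.I ∈ poly true ∧ pt true (z + t * Complex.I) ∉ K := by
  obtain ⟨M, hM⟩ := hK.bddAbove_image continuous_boundaryDist.continuousOn
  set R := |M| + 1
  have hR : 0 < R := by positivity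
  -- From this height on the ball of radius `R` stays above `x² + 1`, hence above the profile.
  refine ⟨(|z.re| + R) ^ 2 + 1 + R - z.im, fun t ht => ?_⟩
  have hball : ∀ w : ℂ, dist (z + t * Complex.I) w < R → w ∈ poly true := by
    intro w hw
    rw [dist_comm, dist_eq_norm] at hw
    have h1 := (Complex.abs_re_le_norm (w - (z + t * Complex.I))).trans_lt hw
    have h2 := (Complex.abs_im_le_norm (w - (z + t * Complex.I))).trans_lt hw
    simp at h1 h2
    rw [abs_lt] at h1 h2
    rw [mem_poly_true]
    refine (profile_le _).trans ?_
    have : |w.re| ≤ |z.re| + R := by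
      rw [abs_le]; have := neg_abs_le z.re; have := le_abs_self z.re; constructor <;> linarith
    have : w.re ^ 2 ≤ (|z.re| + R) ^ 2 := by
      rw [← sq_abs]; gcongr
    linarith
  have hmem := hball (z + t * Complex.I) (by simpa using hR)
  refine ⟨hmem, fun hk => ?_⟩
  have h1 : boundaryDist (pt true (z + t * Complex.I)) ≤ M := hM ⟨_, hk, rfl⟩
  rw [boundaryDist, liftPt_pt _ hmem] at h1
  have hne : ((poly true)ᶜ).Nonempty := by
    refine ⟨-Complex.I, ?_⟩
    rw [mem_compl_iff, mem_poly_true]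
    have := profile_int 0
    simp only [Int.cast_zero] at this
    simp [this]
  have h2 : R ≤ Metric.infDist (z + t * Complex.I) (poly true)ᶜ := by
    rw [Metric.le_infDist hne]
    intro w hw
    by_contra! hlt
    exact hw (hball w hlt)
  have := le_abs_self M
  simp only [R] at h2
  linarith

theorem escape_down {K : Set S1} (hK : IsCompact K) (z : ℂ) : ∃ T : ℝ, ∀ t : ℝ, t ≤ T →
    z + t * Complex.I ∈ poly false ∧ pt false (z + t * Complex.I) ∉ K := by
  obtain ⟨T, hT⟩ := escape_up (hK.image continuous_swapMap) (-z)
  refine ⟨-T, fun t ht => ?_⟩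
  obtain ⟨h1, h2⟩ := hT (-t) (by linarith)
  have e : -(z + t * Complex.I) = -z + ((-t : ℝ) : ℂ) * Complex.I := by push_cast; ring
  have h3 : z + t * Complex.I ∈ poly false := by rw [mem_poly_false, e]; exact h1
  refine ⟨h3, fun h4 => h2 ⟨_, h4, ?_⟩⟩
  rw [swapMap_pt h3, e]; rfl

/-! ### The vertical direction -/

theorem isStraight_strip {n : ℤ} {b : ℂ} (h0 : (n : ℝ) < b.re) (h1 : b.re < n + 1) :
    IsStraight Complex.I univ (fun t => chart n (b + t * Complex.I)) := by
  rw [isStraight_iff]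
  intro t _
  refine straightAt_of_germ (germ_chart (n := n) (a := b + t * Complex.I) ?_)
    (Eventually.of_forall fun t' => by push_cast; ring_nf)
  rw [mem_chartDomain]; right; right; simpa using ⟨h0, h1⟩

/-- The abscissa decides: nonintegral points lie in the strip over an open edge, integral ones on a
vertical ray that starts at a vertex. -/
theorem vertical_cases {x : S1} (hx : x ∉ singularities) :
    (∃ (n : ℤ) (b : ℂ), (n : ℝ) < b.re ∧ b.re < n + 1 ∧ x = chart n b) ∨
    (∃ (k : ℤ) (z : ℂ), z.re = k ∧ (k : ℝ) ^ 2 < z.im ∧ x = pt true z) ∨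
    (∃ (k : ℤ) (z : ℂ), z.re = k ∧ z.im < -(k : ℝ) ^ 2 ∧ x = pt false z) := by
  have key : ∀ z ∈ poly true, ¬ IsVertex z → (∃ n : ℤ, (n : ℝ) < z.re ∧ z.re < n + 1) ∨
      ∃ k : ℤ, z.re = k ∧ (k : ℝ) ^ 2 < z.im := by
    intro z hz hv
    rw [mem_poly_true] at hz
    rcases (Int.floor_le z.re).lt_or_eq with h | h
    · exact Or.inl ⟨_, h, Int.lt_floor_add_one _⟩
    · refine Or.inr ⟨_, h.symm, ?_⟩
      rw [← h, profile_int] at hz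
      refine lt_of_le_of_ne hz fun e => hv (Or.inl ⟨_, Complex.ext h e⟩)
  obtain ⟨s, z, hz, rfl⟩ := exists_pt x
  rw [pt_mem_singularities hz] at hx
  cases s
  · rcases key (-z) hz (by rwa [isVertex_neg]) with ⟨n, h0, h1⟩ | ⟨k, h0, h1⟩
    · refine Or.inl ⟨n, z + shift n false, ?_, ?_, (chart_add_shift hz).symm⟩ <;>
        simp at * <;> linarith
    · refine Or.inr (Or.inr ⟨-k, z, ?_, ?_, rfl⟩) <;> simp at * <;> linarith
  · rcases key z hz hx with ⟨n, h0, h1⟩ | h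
    · exact Or.inl ⟨n, z + shift n true, by simpa using h0, by simpa using h1,
        (chart_add_shift hz).symm⟩
    · obtain ⟨k, h0, h1⟩ := h
      exact Or.inr (Or.inl ⟨k, z, h0, h1, rfl⟩)

/-- The whole vertical line over a point of an open edge lies in one chart; it runs up into `Q⁺` and
down into `Q⁻`. -/
theorem vertical_strip {n : ℤ} {b : ℂ} {J : Set ℝ} {γ : ℝ → S1} {t₀ : ℝ}
    (h : IsTrajectory Complex.I J γ) (ht₀ : t₀ ∈ J) (h0 : (n : ℝ) < b.re) (h1 : b.re < n + 1)
    (e : γ t₀ = chart n b) :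
    J = univ ∧ EscapesForward J γ ∧ EscapesBackward J γ := by
  have h2 := h.extends_of_zero isOpen_univ ordConnected_univ (isStraight_strip h0 h1) ht₀
    (mem_univ _) (by simpa using e)
  have h3 : ∀ t, t ∈ J ∧ γ t = chart n (b + (t - t₀ : ℝ) * Complex.I) := fun t => by
    simpa using h2 (t - t₀) (mem_univ _)
  refine ⟨eq_univ_of_forall fun t => (h3 t).1, fun K hK => ?_, fun K hK => ?_⟩
  · obtain ⟨T, hT⟩ := escape_up hK b
    refine ⟨T + t₀, (h3 _).1, fun t _ ht => ?_⟩
    obtain ⟨k1, k2⟩ := hT (t - t₀) (by linarith)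
    rw [(h3 t).2, chart_of_mem (s := true) (by simpa using k1)]
    simpa using k2
  · obtain ⟨T, hT⟩ := escape_down hK (b - offset n)
    refine ⟨T + t₀, (h3 _).1, fun t _ ht => ?_⟩
    obtain ⟨k1, k2⟩ := hT (t - t₀) (by linarith)
    have e1 : b + (t - t₀ : ℝ) * Complex.I - shift n false =
      b - offset n + (t - t₀ : ℝ) * Complex.I := by simp; ring
    rw [(h3 t).2, chart_of_mem (s := false) (by rw [e1]; exact k1), e1]
    exact k2

theorem vertical_ray_up {k : ℤ} {z : ℂ} {J : Set ℝ} {γ : ℝ → S1} {t₀ : ℝ}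
    (h : IsTrajectory Complex.I J γ) (ht₀ : t₀ ∈ J) (h0 : z.re = k) (h1 : (k : ℝ) ^ 2 < z.im)
    (e : γ t₀ = pt true z) :
    SingularBackward J γ ∧ ¬ SingularForward J γ ∧ EscapesForward J γ := by
  have hmem : ∀ t : ℝ, z + t * Complex.I ∈ poly true ↔ (k : ℝ) ^ 2 - z.im ≤ t := by
    intro t
    rw [mem_poly_true]
    simp only [Complex.add_re, Complex.mul_re, Complex.ofReal_re, Complex.I_re, mul_zero,
      Complex.ofReal_im, Complex.I_im, mul_one, sub_self, add_zero, Complex.add_im, Complex.mul_im,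
      h0, profile_int]
    constructor <;> intro <;> linarith
  have hp : ∀ t ∈ Ioi ((k : ℝ) ^ 2 - z.im), z + t * Complex.I ∈ poly true := fun t ht =>
    (hmem t).2 (le_of_lt ht)
  have hb : z + ((k : ℝ) ^ 2 - z.im : ℝ) * Complex.I = vertex k := by
    apply Complex.ext <;> simp only [Complex.add_re, Complex.add_im, Complex.mul_re, Complex.mul_im,
      Complex.ofReal_re, Complex.ofReal_im, Complex.I_re, Complex.I_im, h0, vertex_re, vertex_im] <;> ring
  have hv : ∀ t ∈ Ioi ((k : ℝ) ^ 2 - z.im), ¬ IsVertex (z + t * Complex.I) := by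
    intro t ht
    rw [isVertex_of_mem_true (hp t ht)]
    rintro ⟨m, hm⟩
    have e1 := congrArg Complex.re hm
    have e2 := congrArg Complex.im hm
    simp [h0] at e1 e2
    rw [mem_Ioi] at ht
    rw [e1] at e2
    linarith
  have hend : ∀ r ∉ Ioi ((k : ℝ) ^ 2 - z.im), ∃ b ∈ uIcc 0 r, z + b * Complex.I ∈ poly true ∧
      IsVertex (z + b * Complex.I) ∧ ∃ᶠ t in 𝓝 b, t ∈ Ioi ((k : ℝ) ^ 2 - z.im) := by
    intro r hr
    rw [mem_Ioi, not_lt] at hr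
    refine ⟨_, mem_uIcc.2 (Or.inr ⟨hr, by linarith⟩), by rw [hb]; exact vertex_mem_poly k,
      by rw [hb]; exact Or.inl ⟨_, rfl⟩, ?_⟩
    have : ∃ᶠ t in 𝓝[>] ((k : ℝ) ^ 2 - z.im), t ∈ Ioi ((k : ℝ) ^ 2 - z.im) :=
      Eventually.frequently self_mem_nhdsWithin
    exact this.filter_mono nhdsWithin_le_nhds
  obtain ⟨hJ, hγ⟩ := h.eq_segment (J₀ := Ioi ((k : ℝ) ^ 2 - z.im)) ht₀ e isOpen_Ioi ordConnected_Ioi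
    (by rw [mem_Ioi]; linarith) hp hv hend
  refine ⟨singularBackward_of_segment hp (by rw [hb]; exact vertex_mem_poly k)
    (by rw [hb]; exact Or.inl ⟨_, rfl⟩) hJ hγ isGLB_Ioi self_mem_nhdsWithin, ?_, fun K hK => ?_⟩
  · rintro ⟨b, hb, -⟩
    have h3 : max b t₀ + 1 ∈ J := by
      rw [hJ, mem_Ioi]; have := le_max_right b t₀; linarith
    have := hb.1 h3
    have := le_max_left b t₀
    linarith
  · obtain ⟨T, hT⟩ := escape_up hK z
    refine ⟨max T 0 + t₀, ?_, fun t htJ ht => ?_⟩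
    · rw [hJ, mem_Ioi]; have := le_max_right T 0; linarith
    · rw [hγ t htJ]
      exact (hT _ (by have := le_max_left T 0; linarith)).2

theorem vertical_ray_down {k : ℤ} {z : ℂ} {J : Set ℝ} {γ : ℝ → S1} {t₀ : ℝ}
    (h : IsTrajectory Complex.I J γ) (ht₀ : t₀ ∈ J) (h0 : z.re = k) (h1 : z.im < -(k : ℝ) ^ 2)
    (e : γ t₀ = pt false z) :
    SingularForward J γ ∧ ¬ SingularBackward J γ ∧ EscapesBackward J γ := by
  have hmem : ∀ t : ℝ, z + t * Complex.I ∈ poly false ↔ t ≤ -(k : ℝ) ^ 2 - z.im := by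
    intro t
    rw [mem_poly_false']
    simp only [Complex.add_re, Complex.mul_re, Complex.ofReal_re, Complex.I_re, mul_zero,
      Complex.ofReal_im, Complex.I_im, mul_one, sub_self, add_zero, Complex.add_im, Complex.mul_im,
      h0, profile_int]
    constructor <;> intro <;> linarith
  have hp : ∀ t ∈ Iio (-(k : ℝ) ^ 2 - z.im), z + t * Complex.I ∈ poly false := fun t ht =>
    (hmem t).2 (le_of_lt ht)
  have hb : z + (-(k : ℝ) ^ 2 - z.im : ℝ) * Complex.I = -vertex (-k) := by
    apply Complex.ext <;> simp only [Complex.add_re, Complex.add_im, Complex.mul_re, Complex.mul_im,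
      Complex.ofReal_re, Complex.ofReal_im, Complex.I_re, Complex.I_im, h0, vertex_re, vertex_im,
      Complex.neg_re, Complex.neg_im, Int.cast_neg] <;> ring
  have hbv : IsVertex (-vertex (-k)) := isVertex_neg.2 (Or.inl ⟨_, rfl⟩)
  have hbm : -vertex (-k) ∈ poly false := by
    rw [mem_poly_false, neg_neg]; exact vertex_mem_poly _
  have hv : ∀ t ∈ Iio (-(k : ℝ) ^ 2 - z.im), ¬ IsVertex (z + t * Complex.I) := by
    intro t ht
    rw [← isVertex_neg, isVertex_of_mem_true (hp t ht)]
    rintro ⟨m, hm⟩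
    have e1 := congrArg Complex.re hm
    have e2 := congrArg Complex.im hm
    simp [h0] at e1 e2
    rw [mem_Iio] at ht
    rw [e1] at e2
    nlinarith
  have hend : ∀ r ∉ Iio (-(k : ℝ) ^ 2 - z.im), ∃ b ∈ uIcc 0 r, z + b * Complex.I ∈ poly false ∧
      IsVertex (z + b * Complex.I) ∧ ∃ᶠ t in 𝓝 b, t ∈ Iio (-(k : ℝ) ^ 2 - z.im) := by
    intro r hr
    rw [mem_Iio, not_lt] at hr
    refine ⟨_, mem_uIcc.2 (Or.inl ⟨by linarith, hr⟩), by rw [hb]; exact hbm,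
      by rw [hb]; exact hbv, ?_⟩
    have : ∃ᶠ t in 𝓝[<] (-(k : ℝ) ^ 2 - z.im), t ∈ Iio (-(k : ℝ) ^ 2 - z.im) :=
      Eventually.frequently self_mem_nhdsWithin
    exact this.filter_mono nhdsWithin_le_nhds
  obtain ⟨hJ, hγ⟩ := h.eq_segment (J₀ := Iio (-(k : ℝ) ^ 2 - z.im)) ht₀ e isOpen_Iio ordConnected_Iio
    (by rw [mem_Iio]; linarith) hp hv hend
  refine ⟨singularForward_of_segment hp (by rw [hb]; exact hbm)
    (by rw [hb]; exact hbv) hJ hγ isLUB_Iio self_mem_nhdsWithin, ?_, fun K hK => ?_⟩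
  · rintro ⟨b, hb, -⟩
    have h3 : min b t₀ - 1 ∈ J := by
      rw [hJ, mem_Iio]; have := min_le_right b t₀; linarith
    have := hb.1 h3
    have := min_le_left b t₀
    linarith
  · obtain ⟨T, hT⟩ := escape_down hK z
    refine ⟨min T 0 + t₀, ?_, fun t htJ ht => ?_⟩
    · rw [hJ, mem_Iio]; have := min_le_right T 0; linarith
    · rw [hγ t htJ]
      exact (hT _ (by have := min_le_left T 0; linarith)).2

/-- The vertical strip over an edge. -/
def verticalStrip (n : ℤ) : Set S1 := chart n '' {z | (n : ℝ) < z.re ∧ z.re < n + 1}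

theorem strip_subset_chartDomain {n : ℤ} {z : ℂ} (h : (n : ℝ) < z.re ∧ z.re < n + 1) :
    z ∈ chartDomain n := mem_chartDomain.2 (Or.inr (Or.inr h))

theorem isInfiniteStrip_verticalStrip (n : ℤ) : IsInfiniteStrip Complex.I (verticalStrip n) := by
  have hmem : ∀ z, z ∈ planeStrip Complex.I 1 ↔
      (n : ℝ) < (z + (n + 1 : ℝ)).re ∧ (z + (n + 1 : ℝ)).re < n + 1 := by
    intro z
    rw [mem_planeStrip Complex.I_ne_zero]
    simp [cross]
    constructor <;> rintro ⟨h1, h2⟩ <;> constructor <;> linarith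
  -- The plane strip of width `1` in the direction `i` is `-1 < x < 0`, whence the shift by `n + 1`.
  refine ⟨1, fun z => chart n (z + (n + 1 : ℝ)), one_pos, ?_, ?_, ?_⟩
  · rw [isTranslationMap_iff]
    intro z hz
    refine ((germ_chart (strip_subset_chartDomain ((hmem z).1 hz))).translate z).congr
      (Eventually.of_forall fun w => by ring_nf)
  · intro z hz w hw e
    exact add_right_cancel (chart_injOn n (strip_subset_chartDomain ((hmem z).1 hz))
      (strip_subset_chartDomain ((hmem w).1 hw)) e)
  · ext x
    constructor
    · rintro ⟨z, hz, rfl⟩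
      exact ⟨z - (n + 1 : ℝ), (hmem _).2 (by simpa using hz), by simp⟩
    · rintro ⟨z, hz, rfl⟩
      exact ⟨_, (hmem _).1 hz, rfl⟩

theorem disjoint_verticalStrip {n m : ℤ} (h : n ≠ m) : Disjoint (verticalStrip n) (verticalStrip m) := by
  rw [disjoint_left]
  rintro _ ⟨z, hz, rfl⟩ ⟨w, hw, e⟩
  apply h
  obtain ⟨s, hs⟩ := exists_shift (strip_subset_chartDomain hz)
  rw [chart_of_mem hs] at e
  have := eq_of_chart_eq_pt (strip_subset_chartDomain hw) hs e
  subst this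
  obtain ⟨h1, h2⟩ := hz
  obtain ⟨h3, h4⟩ := hw
  have key : (n : ℝ) < m + 1 ∧ (m : ℝ) < n + 1 := by
    cases s <;> simp at h3 h4 <;> constructor <;> linarith
  have k1 : n < m + 1 := by exact_mod_cast key.1
  have k2 : m < n + 1 := by exact_mod_cast key.2
  omega

theorem pt_mem_closure_strip {z : ℂ} (hz : z ∈ poly true) :
    ∃ n, pt true z ∈ closure (verticalStrip n) ∧ ∃ v : ℂ, ∀ ε ∈ Ioo (0 : ℝ) 1,
      z + ε * v ∈ poly true ∧ ((n : ℝ) < (z + ε * v).re ∧ (z + ε * v).re < n + 1) := by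
  have h1 : ∃ n : ℤ, ∃ v : ℂ, ∀ ε ∈ Ioo (0 : ℝ) 1,
      z + ε * v ∈ poly true ∧ ((n : ℝ) < (z + ε * v).re ∧ (z + ε * v).re < n + 1) := by
    have f0 := Int.floor_le z.re
    have f1 := Int.lt_floor_add_one z.re
    set n := ⌊z.re⌋ with hn
    -- The displacement is parallel to the edge below `z`, so the point stays in the polygon; at `ε
    -- = 1` it would reach the abscissa `n + 1`.
    refine ⟨n, ⟨n + 1 - z.re, (2 * n + 1) * (n + 1 - z.re)⟩, fun ε hε => ?_⟩
    have g0 : 0 < ε * (n + 1 - z.re) := mul_pos hε.1 (by linarith)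
    have g1 : ε * (n + 1 - z.re) < n + 1 - z.re := by
      have := hε.2
      nlinarith
    have e1 : (z + ε * (⟨n + 1 - z.re, (2 * n + 1) * (n + 1 - z.re)⟩ : ℂ)).re =
      z.re + ε * (n + 1 - z.re) := by simp
    have e2 : (z + ε * (⟨n + 1 - z.re, (2 * n + 1) * (n + 1 - z.re)⟩ : ℂ)).im =
      z.im + (2 * n + 1) * (ε * (n + 1 - z.re)) := by simp; ring
    refine ⟨?_, by rw [e1]; linarith, by rw [e1]; linarith⟩
    rw [mem_poly_true, e1, e2, profile_eq (k := n) (by linarith) (by linarith)]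
    rw [mem_poly_true, profile_eq_floor, ← hn] at hz
    unfold chord at *
    linarith
  obtain ⟨n, v, h⟩ := h1
  refine ⟨n, ?_, v, h⟩
  have hc : Continuous fun ε : ℝ => z + ε * v := by fun_prop
  have hev : ∀ᶠ ε : ℝ in 𝓝[>] 0, ε ∈ Ioo (0 : ℝ) 1 := Ioo_mem_nhdsGT one_pos
  have ht : Tendsto (fun ε : ℝ => z + ε * v) (𝓝[>] 0) (𝓝[poly true] z) := by
    refine tendsto_nhdsWithin_iff.2 ⟨?_, hev.mono fun ε hε => (h ε hε).1⟩
    have := hc.tendsto 0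
    simp only [Complex.ofReal_zero, zero_mul, add_zero] at this
    exact this.mono_left nhdsWithin_le_nhds
  refine mem_closure_of_tendsto ((continuousOn_pt true z hz).tendsto.comp ht) (hev.mono fun ε hε => ?_)
  refine ⟨_, (h ε hε).2, ?_⟩
  rw [chart_of_mem (s := true) (by simpa using (h ε hε).1)]; simp

theorem swapMap_image_verticalStrip (n : ℤ) : swapMap '' verticalStrip n ⊆ verticalStrip n := by
  rintro _ ⟨_, ⟨z, hz, rfl⟩, rfl⟩
  refine ⟨offset n - z, ?_, (swapMap_chart (strip_subset_chartDomain hz)).symm⟩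
  obtain ⟨h1, h2⟩ := hz
  constructor <;> simp <;> linarith

theorem iUnion_closure_verticalStrip : (⋃ n, closure (verticalStrip n)) = univ := by
  refine eq_univ_of_forall fun x => ?_
  obtain ⟨s, z, hz, rfl⟩ := exists_pt x
  rw [mem_iUnion]
  cases s
  · obtain ⟨n, hn, -⟩ := pt_mem_closure_strip (z := -z) hz
    refine ⟨n, closure_mono (swapMap_image_verticalStrip n) ?_⟩
    have := image_closure_subset_closure_image continuous_swapMap ⟨_, hn, rfl⟩
    rwa [swapMap_pt (s := true) hz, neg_neg] at this
  · exact (pt_mem_closure_strip hz).imp fun n h => h.1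

theorem isStripDirection_I : IsStripDirection Complex.I := by
  refine ⟨⟨range verticalStrip, ?_, ?_, ?_, fun x hx hx' => ?_⟩, fun J γ h => ?_⟩
  · rintro _ ⟨n, rfl⟩
    exact isInfiniteStrip_verticalStrip n
  · rintro _ ⟨n, rfl⟩ _ ⟨m, rfl⟩ hne
    exact disjoint_verticalStrip fun e => hne (by rw [e])
  · rw [biUnion_range]; exact iUnion_closure_verticalStrip
  · obtain ⟨J, γ, h, h0, rfl⟩ := exists_trajectory Complex.I hx
    refine ⟨J, γ, h, ⟨0, h0, rfl⟩, ?_⟩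
    rcases vertical_cases hx with ⟨n, b, h1, h2, h3⟩ | ⟨k, z, h1, h2, h3⟩ | ⟨k, z, h1, h2, h3⟩
    · exact absurd ⟨_, ⟨n, rfl⟩, ⟨b, ⟨h1, h2⟩, h3.symm⟩⟩ hx'
    · exact Or.inr (vertical_ray_up h h0 h1 h2 h3).1
    · exact Or.inl (vertical_ray_down h h0 h1 h2 h3).1
  · obtain ⟨t₀, ht₀⟩ := h.nonempty
    have hx := (isStraight_iff.1 h.straight t₀ ht₀).not_mem_singularities
    rcases vertical_cases hx with ⟨n, b, h1, h2, h3⟩ | ⟨k, z, h1, h2, h3⟩ | ⟨k, z, h1, h2, h3⟩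
    · obtain ⟨hJ, h4, h5⟩ := vertical_strip h ht₀ h1 h2 h3
      refine ⟨?_, fun _ => h4, fun _ => h5⟩
      rintro ⟨⟨b, hb, -⟩, -⟩
      have : b + 1 ≤ b := hb.1 (by rw [hJ]; exact mem_univ _)
      linarith
    · obtain ⟨h4, h5, h6⟩ := vertical_ray_up h ht₀ h1 h2 h3
      exact ⟨fun h7 => h5 h7.1, fun _ => h6, fun h7 => absurd h4 h7⟩
    · obtain ⟨h4, h5, h6⟩ := vertical_ray_down h ht₀ h1 h2 h3
      exact ⟨fun h7 => h5 h7.2, fun h7 => absurd h4 h7, fun _ => h6⟩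

end

section

/-! ### The cylinders in the directions of slope `0` and `1` -/

/-- The height of a point over the line of slope `σ` through the origin. -/
def ht (σ : ℤ) (z : ℂ) : ℝ := z.im - σ * z.re

/-- The height of the vertices `(-k, k²)` and `(k + σ, (k + σ)²)`. -/
def level (σ k : ℤ) : ℝ := k * (k + σ)

/-- The difference of the heights of two consecutive levels. -/
def gap (σ k : ℤ) : ℝ := 2 * k + 1 + σ

/-- The abscissa of the left end of the section of `Q⁺` at the height `h`. -/
def leftEnd (σ k : ℤ) (h : ℝ) : ℝ := -(h + k * (k + 1)) / gap σ k

/-- The abscissa of the right end of the section of `Q⁺` at the height `h`. -/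
def rightEnd (σ k : ℤ) (h : ℝ) : ℝ := (h + (k + σ) * (k + σ + 1)) / gap σ k

/-- The translation that generates the period lattice of the `k`-th cylinder. -/
def period (σ k : ℤ) : ℂ := ⟨2 * gap σ k, σ * (2 * gap σ k)⟩

@[simp] theorem period_re (σ k : ℤ) : (period σ k).re = 2 * gap σ k := rfl
@[simp] theorem period_im (σ k : ℤ) : (period σ k).im = σ * (2 * gap σ k) := rfl

variable {σ k : ℤ}

theorem gap_pos (hσ : σ = 0 ∨ σ = 1) (hk : 0 ≤ k) : 0 < gap σ k := by
  have : (0 : ℝ) ≤ k := by exact_mod_cast hk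
  unfold gap
  rcases hσ with rfl | rfl <;> push_cast <;> linarith

theorem level_succ (σ k : ℤ) : level σ (k + 1) = level σ k + gap σ k := by
  unfold level gap; push_cast; ring

theorem ht_add (σ : ℤ) (z w : ℂ) : ht σ (z + w) = ht σ z + ht σ w := by simp [ht]; ring
theorem ht_sub (σ : ℤ) (z w : ℂ) : ht σ (z - w) = ht σ z - ht σ w := by simp [ht]; ring
theorem ht_neg (σ : ℤ) (z : ℂ) : ht σ (-z) = -ht σ z := by simp [ht]; ring

theorem ht_int_period (j : ℤ) : ht σ (j * period σ k) = 0 := by simp [ht]; ring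

theorem ht_sub_period (z : ℂ) (j : ℤ) : ht σ (z - j * period σ k) = ht σ z := by
  rw [ht_sub, ht_int_period, sub_zero]

theorem ht_offset_right (σ k : ℤ) : ht σ (offset (k + σ)) = level σ k + level σ (k + 1) := by
  simp [ht, level]; ring

theorem ht_offset_left (σ k : ℤ) : ht σ (offset (-k - 1)) = level σ k + level σ (k + 1) := by
  simp [ht, level]; ring

/-- Going around the cylinder means leaving `Q⁺` through its right edge and coming back through its
left edge. -/
theorem period_eq (σ k : ℤ) : period σ k = offset (k + σ) - offset (-k - 1) := by
  apply Complex.ext <;> simp [gap] <;> ring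

/-- At a fixed height, lying above the line of the edge `k + σ` means lying to the left of a point
that depends linearly on the height. The ends of the sections arise in this way. -/
theorem chord_right_le (hg : 0 < gap σ k) (z : ℂ) :
    chord (k + σ) z.re ≤ z.im ↔ z.re ≤ rightEnd σ k (ht σ z) := by
  rw [rightEnd, le_div_iff₀ hg, chord, ht, gap]
  push_cast
  constructor <;> intro h <;> linarith

theorem chord_left_le (hg : 0 < gap σ k) (z : ℂ) :
    chord (-k - 1) z.re ≤ z.im ↔ leftEnd σ k (ht σ z) ≤ z.re := by
  rw [leftEnd, div_le_iff₀ hg, chord, ht, gap]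
  push_cast
  constructor <;> intro h <;> linarith

/-- Between two consecutive levels only the edges `-k - 1` and `k + σ` bound the polygon, since the
edges between them lie at or below the lower level. -/
theorem mem_poly_iff (hσ : σ = 0 ∨ σ = 1) (hk : 0 ≤ k) {z : ℂ} (h0 : level σ k ≤ ht σ z)
    (h1 : ht σ z ≤ level σ (k + 1)) : z ∈ poly true ↔
      leftEnd σ k (ht σ z) ≤ z.re ∧ z.re ≤ rightEnd σ k (ht σ z) := by
  have hg := gap_pos hσ hk
  have hk' : (0 : ℝ) ≤ k := by exact_mod_cast hk
  rw [← chord_left_le hg, ← chord_right_le hg, mem_poly_true]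
  refine ⟨fun h => ⟨(chord_le_profile _ _).trans h, (chord_le_profile _ _).trans h⟩, ?_⟩
  rintro ⟨hl, hr⟩
  rw [level_succ] at h1
  have b1 : (-k - 1 : ℝ) ≤ z.re := by
    unfold chord at hl; unfold ht level gap at *; push_cast at hl
    have : 0 ≤ (2 * k + 1 + σ : ℝ) * (z.re + k + 1) := by nlinarith
    have := nonneg_of_mul_nonneg_right this hg
    linarith
  have b2 : z.re ≤ k + σ + 1 := by
    unfold chord at hr; unfold ht level gap at *; push_cast at hr
    have : 0 ≤ (2 * k + 1 + σ : ℝ) * (k + σ + 1 - z.re) := by nlinarith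
    have := nonneg_of_mul_nonneg_right this hg
    linarith
  rcases le_or_gt z.re (-k) with c1 | c1
  · rw [profile_eq (k := -k - 1) (by push_cast; linarith) (by push_cast; linarith)]
    exact hl
  rcases le_or_gt (k + σ : ℝ) z.re with c2 | c2
  · rw [profile_eq (k := k + σ) (by push_cast; linarith) (by push_cast; linarith)]
    exact hr
  have f0 := Int.floor_le z.re
  have f1 := Int.lt_floor_add_one z.re
  rw [profile_eq_floor]
  have d1 : -k ≤ ⌊z.re⌋ := Int.le_floor.2 (by push_cast; linarith)
  have d2 : ⌊z.re⌋ < k + σ := Int.floor_lt.2 (by push_cast; linarith)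
  set j := ⌊z.re⌋
  have e1 : (0 : ℝ) ≤ k + j := by exact_mod_cast (by omega : 0 ≤ k + j)
  have e2 : (0 : ℝ) ≤ k + σ - 1 - j := by exact_mod_cast (by omega : 0 ≤ k + σ - 1 - j)
  -- The second factors here and in `k2` are the amounts by which the vertices `j` and `j + 1` lie
  -- below `level σ k`; the first are barycentric weights.
  have k1 : 0 ≤ (j + 1 - z.re) * ((k + j) * (k - j + σ)) :=
    mul_nonneg (by linarith) (mul_nonneg e1 (by linarith))
  have k2 : 0 ≤ (z.re - j) * ((k + j + 1) * (k - j - 1 + σ)) :=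
    mul_nonneg (by linarith) (mul_nonneg (by linarith) (by linarith))
  unfold chord; unfold ht level at h0
  nlinarith

/-- The reflection in the midpoint of the left edge preserves this edge and reverses the order of
the heights in the band. -/
theorem reflect_leftEnd (hg : 0 < gap σ k) (h : ℝ) :
    leftEnd σ k (level σ k + level σ (k + 1) - h) = -leftEnd σ k h - 2 * k - 1 := by
  unfold leftEnd
  field_simp
  unfold level gap; push_cast; ring

theorem reflect_rightEnd (hg : 0 < gap σ k) (h : ℝ) :
    rightEnd σ k (level σ k + level σ (k + 1) - h) = 2 * (k + σ) + 1 - rightEnd σ k h := by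
  unfold rightEnd
  field_simp
  unfold level gap; push_cast; ring

/-- The copy of `Q⁻` across the right edge is a reflected `Q⁺`. Its section continues that of `Q⁺`,
and the two together have the horizontal length `2 * gap σ k` at every height, which is why the band
closes up to a cylinder. -/
theorem sub_offset_right_mem_iff (hσ : σ = 0 ∨ σ = 1) (hk : 0 ≤ k) {z : ℂ} (h0 : level σ k ≤ ht σ z)
    (h1 : ht σ z ≤ level σ (k + 1)) : z - offset (k + σ) ∈ poly false ↔
      rightEnd σ k (ht σ z) ≤ z.re ∧ z.re ≤ leftEnd σ k (ht σ z) + 2 * gap σ k := by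
  have hg := gap_pos hσ hk
  have e : ht σ (offset (k + σ) - z) = level σ k + level σ (k + 1) - ht σ z := by
    rw [ht_sub, ht_offset_right]
  rw [mem_poly_false, neg_sub, mem_poly_iff hσ hk (by rw [e]; linarith) (by rw [e]; linarith), e,
    reflect_leftEnd hg, reflect_rightEnd hg, Complex.sub_re, offset_re]
  unfold gap; push_cast
  constructor <;> rintro ⟨h1, h2⟩ <;> constructor <;> linarith

theorem sub_offset_left_mem_iff (hσ : σ = 0 ∨ σ = 1) (hk : 0 ≤ k) {z : ℂ} (h0 : level σ k ≤ ht σ z)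
    (h1 : ht σ z ≤ level σ (k + 1)) : z - offset (-k - 1) ∈ poly false ↔
      rightEnd σ k (ht σ z) - 2 * gap σ k ≤ z.re ∧ z.re ≤ leftEnd σ k (ht σ z) := by
  have hg := gap_pos hσ hk
  have e : ht σ (offset (-k - 1) - z) = level σ k + level σ (k + 1) - ht σ z := by
    rw [ht_sub, ht_offset_left]
  rw [mem_poly_false, neg_sub, mem_poly_iff hσ hk (by rw [e]; linarith) (by rw [e]; linarith), e,
    reflect_leftEnd hg, reflect_rightEnd hg, Complex.sub_re, offset_re]
  unfold gap; push_cast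
  constructor <;> rintro ⟨h1, h2⟩ <;> constructor <;> linarith

/-- Equality occurs for `σ = k = 0` at the height `0`, where the section is the vertex at the
origin. -/
theorem leftEnd_le_rightEnd (hσ : σ = 0 ∨ σ = 1) (hk : 0 ≤ k) {h : ℝ} (h0 : level σ k ≤ h) :
    leftEnd σ k h ≤ rightEnd σ k h := by
  have hg := gap_pos hσ hk
  have hk' : (0 : ℝ) ≤ k := by exact_mod_cast hk
  unfold leftEnd rightEnd
  rw [div_le_div_iff_of_pos_right hg]
  unfold level at h0
  rcases hσ with rfl | rfl <;> push_cast at * <;> nlinarith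

theorem rightEnd_le (hσ : σ = 0 ∨ σ = 1) (hk : 0 ≤ k) {h : ℝ} (h1 : h ≤ level σ (k + 1)) :
    rightEnd σ k h ≤ leftEnd σ k h + 2 * gap σ k := by
  have hg := gap_pos hσ hk
  have hk' : (0 : ℝ) ≤ k := by exact_mod_cast hk
  have e : leftEnd σ k h + 2 * gap σ k = (-(h + k * (k + 1)) + 2 * gap σ k * gap σ k) / gap σ k := by
    unfold leftEnd; field_simp
  rw [e]
  unfold rightEnd
  rw [div_le_div_iff_of_pos_right hg]
  unfold level at h1; unfold gap
  rcases hσ with rfl | rfl <;> push_cast at * <;> nlinarith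

theorem leftEnd_lt_rightEnd (hσ : σ = 0 ∨ σ = 1) (hk : 0 ≤ k) {h : ℝ} (h0 : level σ k < h) :
    leftEnd σ k h < rightEnd σ k h := by
  have hg := gap_pos hσ hk
  have hk' : (0 : ℝ) ≤ k := by exact_mod_cast hk
  unfold leftEnd rightEnd
  rw [div_lt_div_iff_of_pos_right hg]
  unfold level at h0
  rcases hσ with rfl | rfl <;> push_cast at * <;> nlinarith

theorem rightEnd_lt (hσ : σ = 0 ∨ σ = 1) (hk : 0 ≤ k) {h : ℝ} (h1 : h < level σ (k + 1)) :
    rightEnd σ k h < leftEnd σ k h + 2 * gap σ k := by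
  have hg := gap_pos hσ hk
  have hk' : (0 : ℝ) ≤ k := by exact_mod_cast hk
  have e : leftEnd σ k h + 2 * gap σ k = (-(h + k * (k + 1)) + 2 * gap σ k * gap σ k) / gap σ k := by
    unfold leftEnd; field_simp
  rw [e]
  unfold rightEnd
  rw [div_lt_div_iff_of_pos_right hg]
  unfold level at h1; unfold gap
  rcases hσ with rfl | rfl <;> push_cast at * <;> nlinarith

open Classical in
/-- The developing map of the `k`-th cylinder in the direction of slope `σ`, on the strip of heights
between `level σ k` and `level σ (k + 1)`. -/
def cyl (σ k : ℤ) (z : ℂ) : S1 :=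
  let z' := z - ⌊(z.re - leftEnd σ k (ht σ z)) / (2 * gap σ k)⌋ * period σ k
  if z'.re ≤ rightEnd σ k (ht σ z) then pt true z' else pt false (z' - offset (k + σ))

theorem re_sub_period (z : ℂ) (j : ℤ) : (z - j * period σ k).re = z.re - j * (2 * gap σ k) := by simp

theorem floor_bounds (hσ : σ = 0 ∨ σ = 1) (hk : 0 ≤ k) (z : ℂ) :
    leftEnd σ k (ht σ z) ≤
      (z - ⌊(z.re - leftEnd σ k (ht σ z)) / (2 * gap σ k)⌋ * period σ k).re ∧
    (z - ⌊(z.re - leftEnd σ k (ht σ z)) / (2 * gap σ k)⌋ * period σ k).re <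
      leftEnd σ k (ht σ z) + 2 * gap σ k := by
  have hg : 0 < 2 * gap σ k := by linarith [gap_pos hσ hk]
  have h0 := Int.floor_le ((z.re - leftEnd σ k (ht σ z)) / (2 * gap σ k))
  have h1 := Int.lt_floor_add_one ((z.re - leftEnd σ k (ht σ z)) / (2 * gap σ k))
  rw [le_div_iff₀ hg] at h0
  rw [div_lt_iff₀ hg] at h1
  rw [re_sub_period]
  constructor <;> linarith

theorem floor_eq (hσ : σ = 0 ∨ σ = 1) (hk : 0 ≤ k) {z : ℂ} {j : ℤ}
    (h0 : leftEnd σ k (ht σ z) ≤ (z - j * period σ k).re)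
    (h1 : (z - j * period σ k).re < leftEnd σ k (ht σ z) + 2 * gap σ k) :
    ⌊(z.re - leftEnd σ k (ht σ z)) / (2 * gap σ k)⌋ = j := by
  have hg : 0 < 2 * gap σ k := by linarith [gap_pos hσ hk]
  rw [re_sub_period] at h0 h1
  rw [Int.floor_eq_iff, le_div_iff₀ hg, div_lt_iff₀ hg]
  constructor <;> linarith

theorem mem_edge_right (hσ : σ = 0 ∨ σ = 1) (hk : 0 ≤ k) {z : ℂ} (h0 : level σ k ≤ ht σ z)
    (h1 : ht σ z ≤ level σ (k + 1)) (h : z.re = rightEnd σ k (ht σ z)) : z ∈ edge (k + σ) :=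
  mem_edge_of_mem_of_mem
    ((mem_poly_iff hσ hk h0 h1).2 ⟨h ▸ leftEnd_le_rightEnd hσ hk h0, h.le⟩)
    ((sub_offset_right_mem_iff hσ hk h0 h1).2 ⟨h.ge, h ▸ rightEnd_le hσ hk h1⟩)

theorem mem_edge_left (hσ : σ = 0 ∨ σ = 1) (hk : 0 ≤ k) {z : ℂ} (h0 : level σ k ≤ ht σ z)
    (h1 : ht σ z ≤ level σ (k + 1)) (h : z.re = leftEnd σ k (ht σ z)) : z ∈ edge (-k - 1) :=
  mem_edge_of_mem_of_mem
    ((mem_poly_iff hσ hk h0 h1).2 ⟨h.ge, h ▸ leftEnd_le_rightEnd hσ hk h0⟩)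
    ((sub_offset_left_mem_iff hσ hk h0 h1).2
      ⟨by have := rightEnd_le hσ hk h1; rw [h]; linarith, h.le⟩)

theorem cyl_false (hσ : σ = 0 ∨ σ = 1) (hk : 0 ≤ k) {z : ℂ} (h0 : level σ k ≤ ht σ z)
    (h1 : ht σ z ≤ level σ (k + 1)) {j : ℤ} (h : z - j * period σ k - offset (k + σ) ∈ poly false) :
    cyl σ k z = pt false (z - j * period σ k - offset (k + σ)) := by
  have e := ht_sub_period (σ := σ) (k := k) z j
  have h2 := (sub_offset_right_mem_iff hσ hk (by rwa [e]) (by rwa [e])).1 h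
  rw [e] at h2
  rcases h2.2.lt_or_eq with h3 | h3
  · have hf := floor_eq hσ hk ((leftEnd_le_rightEnd hσ hk h0).trans h2.1) h3
    unfold cyl
    simp only [hf]
    split_ifs with h4
    -- On the right edge the definition of `cyl` prefers `Q⁺`, and the gluing reconciles it with
    -- `Q⁻`.
    · exact pt_edge (mem_edge_right hσ hk (by rwa [e]) (by rwa [e]) (by rw [e]; linarith [h2.1]))
    · rfl
  -- The far end of the fundamental interval belongs to the next period, where the point is on the
  -- left edge of `Q⁺`; the gluing across that edge gives the same point.
  · have hj : z - (j + 1 : ℤ) * period σ k = z - j * period σ k - period σ k := by push_cast; ring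
    have hl : (z - (j + 1 : ℤ) * period σ k).re = leftEnd σ k (ht σ z) := by
      rw [hj, Complex.sub_re, h3, period_re]; ring
    have e' := ht_sub_period (σ := σ) (k := k) z (j + 1)
    have hf := floor_eq hσ hk hl.ge (by rw [hl]; linarith [gap_pos hσ hk])
    unfold cyl
    simp only [hf]
    rw [if_pos (hl ▸ leftEnd_le_rightEnd hσ hk h0),
      pt_edge (mem_edge_left hσ hk (by rwa [e']) (by rwa [e']) (by rw [hl, e']))]
    congr 1
    rw [hj, period_eq]; ring

theorem cyl_true (hσ : σ = 0 ∨ σ = 1) (hk : 0 ≤ k) {z : ℂ} (h0 : level σ k ≤ ht σ z)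
    (h1 : ht σ z ≤ level σ (k + 1)) {j : ℤ} (h : z - j * period σ k ∈ poly true) :
    cyl σ k z = pt true (z - j * period σ k) := by
  have e := ht_sub_period (σ := σ) (k := k) z j
  have h2 := (mem_poly_iff hσ hk (by rwa [e]) (by rwa [e])).1 h
  rw [e] at h2
  rcases (h2.2.trans (rightEnd_le hσ hk h1)).lt_or_eq with h3 | h3
  · have hf := floor_eq hσ hk h2.1 h3
    unfold cyl
    simp only [hf]
    rw [if_pos h2.2]
  · have hr : (z - j * period σ k).re = rightEnd σ k (ht σ z) := by
      have := rightEnd_le hσ hk h1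
      linarith [h2.2]
    have hE := mem_edge_right hσ hk (z := z - j * period σ k) (by rwa [e]) (by rwa [e]) (by rw [e, hr])
    rw [pt_edge hE]
    exact cyl_false hσ hk h0 h1 (sub_offset_mem_poly hE)

theorem cyl_false_left (hσ : σ = 0 ∨ σ = 1) (hk : 0 ≤ k) {z : ℂ} (h0 : level σ k ≤ ht σ z)
    (h1 : ht σ z ≤ level σ (k + 1)) {j : ℤ} (h : z - j * period σ k - offset (-k - 1) ∈ poly false) :
    cyl σ k z = pt false (z - j * period σ k - offset (-k - 1)) := by
  have e : z - j * period σ k - offset (-k - 1) =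
      z - (j - 1 : ℤ) * period σ k - offset (k + σ) := by
    push_cast; rw [period_eq]; ring
  rw [e] at h ⊢
  exact cyl_false hσ hk h0 h1 h

theorem exists_fundamental (hσ : σ = 0 ∨ σ = 1) (hk : 0 ≤ k) {z : ℂ} (h0 : level σ k ≤ ht σ z)
    (h1 : ht σ z ≤ level σ (k + 1)) : ∃ j : ℤ, leftEnd σ k (ht σ z) ≤ (z - j * period σ k).re ∧
      (z - j * period σ k).re < leftEnd σ k (ht σ z) + 2 * gap σ k ∧
      (z - j * period σ k ∈ poly true ∨ z - j * period σ k - offset (k + σ) ∈ poly false) := by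
  obtain ⟨h2, h3⟩ := floor_bounds hσ hk z
  refine ⟨_, h2, h3, ?_⟩
  set j := ⌊(z.re - leftEnd σ k (ht σ z)) / (2 * gap σ k)⌋
  have e := ht_sub_period (σ := σ) (k := k) z j
  rw [mem_poly_iff hσ hk (by rwa [e]) (by rwa [e]), sub_offset_right_mem_iff hσ hk (by rwa [e]) (by rwa [e]), e]
  rcases le_total (z - j * period σ k).re (rightEnd σ k (ht σ z)) with h | h
  · exact Or.inl ⟨h2, h⟩
  · exact Or.inr ⟨h, h3.le⟩

theorem cyl_add_period (hσ : σ = 0 ∨ σ = 1) (hk : 0 ≤ k) {z : ℂ} (h0 : level σ k ≤ ht σ z)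
    (h1 : ht σ z ≤ level σ (k + 1)) (i : ℤ) : cyl σ k (z + i * period σ k) = cyl σ k z := by
  have e : ht σ (z + i * period σ k) = ht σ z := by rw [ht_add, ht_int_period, add_zero]
  obtain ⟨j, -, -, hj⟩ := exists_fundamental hσ hk h0 h1
  have e' : z + i * period σ k - (j + i : ℤ) * period σ k = z - j * period σ k := by push_cast; ring
  rcases hj with hj | hj
  · rw [cyl_true hσ hk h0 h1 hj, cyl_true (j := j + i) hσ hk (by rwa [e]) (by rwa [e]) (by rwa [e']), e']
  · rw [cyl_false hσ hk h0 h1 hj, cyl_false (j := j + i) hσ hk (by rwa [e]) (by rwa [e]) (by rwa [e']), e']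

end

/-! ### The cylinders of slope `0` and `1` as subsets of the surface -/

section

variable {σ k : ℤ}

theorem continuous_ht (σ : ℤ) : Continuous (ht σ) := by unfold ht; fun_prop

theorem continuous_leftEnd (σ k : ℤ) : Continuous fun z => leftEnd σ k (ht σ z) := by
  have := continuous_ht σ
  unfold leftEnd; fun_prop

theorem continuous_rightEnd (σ k : ℤ) : Continuous fun z => rightEnd σ k (ht σ z) := by
  have := continuous_ht σ
  unfold rightEnd; fun_prop

/-- The open strip that is the universal cover of the `k`-th cylinder. -/
def openStrip (σ k : ℤ) : Set ℂ := {z | level σ k < ht σ z ∧ ht σ z < level σ (k + 1)}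

theorem isOpen_openStrip (σ k : ℤ) : IsOpen (openStrip σ k) :=
  (isOpen_lt continuous_const (continuous_ht σ)).inter (isOpen_lt (continuous_ht σ) continuous_const)

theorem isOpen_rightRegion (σ k : ℤ) : IsOpen {z | z ∈ openStrip σ k ∧
    leftEnd σ k (ht σ z) < z.re ∧ z.re < leftEnd σ k (ht σ z) + 2 * gap σ k} :=
  (isOpen_openStrip σ k).inter ((isOpen_lt (continuous_leftEnd σ k) Complex.continuous_re).inter
    (isOpen_lt Complex.continuous_re ((continuous_leftEnd σ k).add_const _)))

theorem isOpen_leftRegion (σ k : ℤ) : IsOpen {z | z ∈ openStrip σ k ∧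
    rightEnd σ k (ht σ z) - 2 * gap σ k < z.re ∧ z.re < rightEnd σ k (ht σ z)} :=
  (isOpen_openStrip σ k).inter
    ((isOpen_lt ((continuous_rightEnd σ k).sub continuous_const) Complex.continuous_re).inter
    (isOpen_lt Complex.continuous_re (continuous_rightEnd σ k)))

theorem rightRegion_cases (hσ : σ = 0 ∨ σ = 1) (hk : 0 ≤ k) {z : ℂ} (hz : z ∈ openStrip σ k)
    (h0 : leftEnd σ k (ht σ z) < z.re) (h1 : z.re < leftEnd σ k (ht σ z) + 2 * gap σ k) :
    ∃ s, z - shift (k + σ) s ∈ poly s := by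
  rcases le_total z.re (rightEnd σ k (ht σ z)) with h | h
  · exact ⟨true, by simpa using (mem_poly_iff hσ hk hz.1.le hz.2.le).2 ⟨h0.le, h⟩⟩
  · exact ⟨false, (sub_offset_right_mem_iff hσ hk hz.1.le hz.2.le).2 ⟨h, h1.le⟩⟩

theorem leftRegion_cases (hσ : σ = 0 ∨ σ = 1) (hk : 0 ≤ k) {z : ℂ} (hz : z ∈ openStrip σ k)
    (h0 : rightEnd σ k (ht σ z) - 2 * gap σ k < z.re) (h1 : z.re < rightEnd σ k (ht σ z)) :
    ∃ s, z - shift (-k - 1) s ∈ poly s := by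
  rcases le_total (leftEnd σ k (ht σ z)) z.re with h | h
  · exact ⟨true, by simpa using (mem_poly_iff hσ hk hz.1.le hz.2.le).2 ⟨h, h1.le⟩⟩
  · exact ⟨false, (sub_offset_left_mem_iff hσ hk hz.1.le hz.2.le).2 ⟨h0.le, h⟩⟩

theorem mem_chartDomain_of_isOpen {n : ℤ} {U : Set ℂ} (hU : IsOpen U)
    (h : ∀ z ∈ U, ∃ s, z - shift n s ∈ poly s) {z : ℂ} (hz : z ∈ U) : z ∈ chartDomain n := by
  refine interior_maximal (fun w hw => ?_) hU hz
  obtain ⟨s, hs⟩ := h w hw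
  cases s
  · exact Or.inr hs
  · exact Or.inl (by simpa using hs)

/-- Every point of the open strip lies, up to a period, in one of two charts that represent `cyl`. -/
theorem cyl_eq_chart (hσ : σ = 0 ∨ σ = 1) (hk : 0 ≤ k) {z : ℂ} (hz : z ∈ openStrip σ k) :
    ∃ j : ℤ, leftEnd σ k (ht σ z) ≤ (z - j * period σ k).re ∧
      (z - j * period σ k).re < leftEnd σ k (ht σ z) + 2 * gap σ k ∧
      ∃ n, (n = k + σ ∧ leftEnd σ k (ht σ z) < (z - j * period σ k).re ∨
        n = -k - 1 ∧ (z - j * period σ k).re = leftEnd σ k (ht σ z)) ∧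
        z - j * period σ k ∈ chartDomain n ∧
        ∀ᶠ w in 𝓝 z, cyl σ k w = chart n (w - j * period σ k) := by
  obtain ⟨j, h0, h1, -⟩ := exists_fundamental hσ hk hz.1.le hz.2.le
  refine ⟨j, h0, h1, ?_⟩
  have hc : ContinuousAt (fun w : ℂ => w - j * period σ k) z := by fun_prop
  have hst : ∀ w, w ∈ openStrip σ k ↔ w - j * period σ k ∈ openStrip σ k := fun w => by
    unfold openStrip; rw [mem_ofPred_eq, mem_ofPred_eq, ht_sub_period]
  -- A point on the left end of the fundamental interval is not covered by the chart across the
  -- right edge; the chart across the left edge serves there.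
  rcases h0.lt_or_eq with h | h
  · have hm : z - j * period σ k ∈ {z | z ∈ openStrip σ k ∧
        leftEnd σ k (ht σ z) < z.re ∧ z.re < leftEnd σ k (ht σ z) + 2 * gap σ k} :=
      ⟨(hst z).1 hz, by rwa [ht_sub_period], by rwa [ht_sub_period]⟩
    refine ⟨k + σ, Or.inl ⟨rfl, h⟩, mem_chartDomain_of_isOpen (isOpen_rightRegion σ k)
      (fun w hw => rightRegion_cases hσ hk hw.1 hw.2.1 hw.2.2) hm, ?_⟩
    filter_upwards [hc ((isOpen_rightRegion σ k).mem_nhds hm)] with w hw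
    obtain ⟨s, hs⟩ := rightRegion_cases hσ hk hw.1 hw.2.1 hw.2.2
    have hw' := (hst w).2 hw.1
    rw [chart_of_mem hs]
    cases s
    · exact cyl_false hσ hk hw'.1.le hw'.2.le hs
    · rw [shift_true, sub_zero] at hs ⊢
      exact cyl_true hσ hk hw'.1.le hw'.2.le hs
  · have hg := gap_pos hσ hk
    have hm : z - j * period σ k ∈ {z | z ∈ openStrip σ k ∧
        rightEnd σ k (ht σ z) - 2 * gap σ k < z.re ∧ z.re < rightEnd σ k (ht σ z)} := by
      refine ⟨(hst z).1 hz, ?_, ?_⟩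
      · rw [ht_sub_period, ← h]; linarith [rightEnd_lt hσ hk hz.2]
      · rw [ht_sub_period, ← h]; exact leftEnd_lt_rightEnd hσ hk hz.1
    refine ⟨-k - 1, Or.inr ⟨rfl, h.symm⟩, mem_chartDomain_of_isOpen (isOpen_leftRegion σ k)
      (fun w hw => leftRegion_cases hσ hk hw.1 hw.2.1 hw.2.2) hm, ?_⟩
    filter_upwards [hc ((isOpen_leftRegion σ k).mem_nhds hm)] with w hw
    obtain ⟨s, hs⟩ := leftRegion_cases hσ hk hw.1 hw.2.1 hw.2.2
    have hw' := (hst w).2 hw.1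
    rw [chart_of_mem hs]
    cases s
    · exact cyl_false_left hσ hk hw'.1.le hw'.2.le hs
    · rw [shift_true, sub_zero] at hs ⊢
      exact cyl_true hσ hk hw'.1.le hw'.2.le hs

theorem germ_cyl (hσ : σ = 0 ∨ σ = 1) (hk : 0 ≤ k) {z : ℂ} (hz : z ∈ openStrip σ k) :
    Germ (cyl σ k) z := by
  obtain ⟨j, -, -, n, -, hn, h⟩ := cyl_eq_chart hσ hk hz
  exact ⟨n, _, hn, h.mono fun w hw => by rw [hw]; ring_nf⟩

theorem cyl_eq_iff (hσ : σ = 0 ∨ σ = 1) (hk : 0 ≤ k) {z z' : ℂ} (hz : z ∈ openStrip σ k)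
    (hz' : z' ∈ openStrip σ k) : cyl σ k z = cyl σ k z' ↔ ∃ j : ℤ, z' - z = j * period σ k := by
  constructor
  · intro h
    obtain ⟨j, h0, h1, n, hn, hm, he⟩ := cyl_eq_chart hσ hk hz
    obtain ⟨j', h0', h1', n', hn', hm', he'⟩ := cyl_eq_chart hσ hk hz'
    rw [he.self_of_nhds, he'.self_of_nhds] at h
    have hR : ∀ w : ℂ, ∀ i : ℤ, leftEnd σ k (ht σ w) ≤ (w - i * period σ k).re →
        (w - i * period σ k).re < leftEnd σ k (ht σ w) + 2 * gap σ k → w ∈ openStrip σ k →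
        ∃ s, w - i * period σ k - shift (k + σ) s ∈ poly s := by
      intro w i a0 a1 hw
      have e := ht_sub_period (σ := σ) (k := k) w i
      rcases le_total (w - i * period σ k).re (rightEnd σ k (ht σ w)) with h | h
      · refine ⟨true, ?_⟩
        rw [shift_true, sub_zero, mem_poly_iff hσ hk (by rw [e]; exact hw.1.le) (by rw [e]; exact hw.2.le), e]
        exact ⟨a0, h⟩
      · refine ⟨false, (sub_offset_right_mem_iff hσ hk (by rw [e]; exact hw.1.le) (by rw [e]; exact hw.2.le)).2 ?_⟩
        rw [e]; exact ⟨h, a1.le⟩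
    have hL : ∀ w : ℂ, ∀ i : ℤ, (w - i * period σ k).re = leftEnd σ k (ht σ w) →
        w ∈ openStrip σ k → w - i * period σ k ∈ poly true := by
      intro w i a0 hw
      have e := ht_sub_period (σ := σ) (k := k) w i
      rw [mem_poly_iff hσ hk (by rw [e]; exact hw.1.le) (by rw [e]; exact hw.2.le), e, a0]
      exact ⟨le_rfl, leftEnd_le_rightEnd hσ hk hw.1.le⟩
    -- Points in the same chart are compared by its injectivity. If one of them is on a left edge,
    -- its representative lies in `Q⁺`, which has the same coordinates in all charts.
    have key : z - j * period σ k = z' - j' * period σ k := by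
      rcases hn with ⟨rfl, hn⟩ | ⟨rfl, hn⟩
      · rcases hn' with ⟨rfl, hn'⟩ | ⟨rfl, hn'⟩
        · exact chart_injOn _ hm hm' h
        · have h2 := hL z' j' hn' hz'
          rw [chart_of_mem (n := -k - 1) (s := true) (z := z' - j' * period σ k) (by simpa using h2)] at h
          simpa using eq_of_chart_eq_pt hm (by simpa using h2) h
      · have h2 := hL z j hn hz
        rw [chart_of_mem (n := -k - 1) (s := true) (z := z - j * period σ k) (by simpa using h2)] at h
        simpa using (eq_of_chart_eq_pt hm' (by simpa using h2) h.symm).symm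
    exact ⟨j' - j, by push_cast; linear_combination -key⟩
  · rintro ⟨j, hj⟩
    have : z' = z + j * period σ k := by linear_combination hj
    rw [this, cyl_add_period hσ hk hz.1.le hz.2.le]

/-- The `k`-th open cylinder in the direction of slope `σ`. -/
def openCyl (σ k : ℤ) : Set S1 :=
  {x | ∃ s, ∃ z ∈ poly s, x = pt s z ∧ level σ k < sgn s * ht σ z ∧ sgn s * ht σ z < level σ (k + 1)}

/-- The heights of the vertices are levels, so an edge that enters the open band is one of the two
that cross it, and its midpoint lies at the mean height of the band. This makes `openCyl` compatible
with the gluings. -/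
theorem ht_edge_aux (hσ : σ = 0 ∨ σ = 1) (hk : 0 ≤ k) {n : ℤ} {z : ℂ} (hz : z ∈ edge n)
    (h0 : level σ k < ht σ z) (h1 : ht σ z < level σ (k + 1)) :
    ht σ (offset n - z) = level σ k + level σ (k + 1) - ht σ z := by
  rw [mem_edge] at hz
  obtain ⟨a, b, c⟩ := hz
  -- The height is a weighted mean of the integral heights of the two end vertices, so comparing
  -- these with the levels excludes the other edges.
  have hh : ht σ z = (n + 1 - z.re) * (n * (n - σ)) + (z.re - n) * ((n + 1) * (n + 1 - σ)) := by
    unfold ht; rw [c]; unfold chord; ring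
  have hn : n = k + σ ∨ n = -k - 1 := by
    have cast1 : ∀ {i l : ℤ}, i ≤ l → (i : ℝ) ≤ l := fun h => by exact_mod_cast h
    unfold level at h0 h1
    push_cast at h0 h1
    rcases lt_trichotomy n (-k - 1) with hlt | heq | hgt
    · exfalso
      have e1 : (k + 1) * (k + 1 + σ) ≤ n * (n - σ) := by rcases hσ with rfl | rfl <;> nlinarith
      have e2 : (k + 1) * (k + 1 + σ) ≤ (n + 1) * (n + 1 - σ) := by
        rcases hσ with rfl | rfl <;> nlinarith
      have := cast1 e1; have := cast1 e2; push_cast at *; nlinarith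
    · exact Or.inr heq
    · rcases lt_trichotomy n (k + σ) with hlt' | heq' | hgt'
      · exfalso
        have e1 : n * (n - σ) ≤ k * (k + σ) := by rcases hσ with rfl | rfl <;> nlinarith
        have e2 : (n + 1) * (n + 1 - σ) ≤ k * (k + σ) := by
          rcases hσ with rfl | rfl <;> nlinarith
        have := cast1 e1; have := cast1 e2; push_cast at *; nlinarith
      · exact Or.inl heq'
      · exfalso
        have e1 : (k + 1) * (k + 1 + σ) ≤ n * (n - σ) := by rcases hσ with rfl | rfl <;> nlinarith
        have e2 : (k + 1) * (k + 1 + σ) ≤ (n + 1) * (n + 1 - σ) := by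
          rcases hσ with rfl | rfl <;> nlinarith
        have := cast1 e1; have := cast1 e2; push_cast at *; nlinarith
  rw [ht_sub]
  rcases hn with rfl | rfl
  · rw [ht_offset_right]
  · rw [ht_offset_left]

theorem pt_mem_openCyl (hσ : σ = 0 ∨ σ = 1) (hk : 0 ≤ k) {s : Bool} {z : ℂ} (hz : z ∈ poly s) :
    pt s z ∈ openCyl σ k ↔ level σ k < sgn s * ht σ z ∧ sgn s * ht σ z < level σ (k + 1) := by
  refine ⟨?_, fun h => ⟨s, z, hz, rfl, h⟩⟩
  rintro ⟨s', z', hz', e, h⟩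
  refine (pt_invariant (fun s z => level σ k < sgn s * ht σ z ∧ sgn s * ht σ z < level σ (k + 1))
    (fun n w hw => ?_) hz hz' e).2 h
  simp only [sgn_true, sgn_false, one_mul, neg_mul, ← ht_neg, neg_sub]
  constructor
  · rintro ⟨h0, h1⟩
    rw [ht_edge_aux hσ hk hw h0 h1]; constructor <;> linarith
  · rintro ⟨h0, h1⟩
    have := ht_edge_aux hσ hk (offset_sub_mem_edge hw) h0 h1
    rw [sub_sub_cancel] at this
    constructor <;> linarith

theorem image_openStrip (hσ : σ = 0 ∨ σ = 1) (hk : 0 ≤ k) : cyl σ k '' openStrip σ k = openCyl σ k := by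
  ext x
  constructor
  · rintro ⟨z, hz, rfl⟩
    obtain ⟨j, -, -, hj⟩ := exists_fundamental hσ hk hz.1.le hz.2.le
    rcases hj with hj | hj
    · rw [cyl_true hσ hk hz.1.le hz.2.le hj, pt_mem_openCyl hσ hk hj, sgn_true, one_mul, ht_sub_period]
      exact hz
    · rw [cyl_false hσ hk hz.1.le hz.2.le hj, pt_mem_openCyl hσ hk hj, sgn_false, ht_sub, ht_sub_period,
        ht_offset_right]
      obtain ⟨h0, h1⟩ := hz
      constructor <;> linarith
  · rintro ⟨s, z, hz, rfl, h0, h1⟩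
    cases s
    · simp only [sgn_false, neg_mul, one_mul] at h0 h1
      have e : ht σ (z + offset (k + σ)) = ht σ z + (level σ k + level σ (k + 1)) := by
        rw [ht_add, ht_offset_right]
      have hm : z + offset (k + σ) ∈ openStrip σ k := ⟨by rw [e]; linarith, by rw [e]; linarith⟩
      refine ⟨_, hm, ?_⟩
      have := cyl_false hσ hk hm.1.le hm.2.le (j := 0) (by simpa using hz)
      simpa using this
    · simp only [sgn_true, one_mul] at h0 h1
      refine ⟨z, ⟨h0, h1⟩, ?_⟩
      have := cyl_true hσ hk h0.le h1.le (j := 0) (by simpa using hz)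
      simpa using this

theorem level_mono (hσ : σ = 0 ∨ σ = 1) {k l : ℤ} (hk : 0 ≤ k) (h : k ≤ l) : level σ k ≤ level σ l := by
  have h1 : (0 : ℝ) ≤ k := by exact_mod_cast hk
  have h2 : (k : ℝ) ≤ l := by exact_mod_cast h
  unfold level
  rcases hσ with rfl | rfl <;> push_cast <;> nlinarith

theorem disjoint_openCyl (hσ : σ = 0 ∨ σ = 1) {k l : ℤ} (hk : 0 ≤ k) (hl : 0 ≤ l) (h : k ≠ l) :
    Disjoint (openCyl σ k) (openCyl σ l) := by
  rw [disjoint_left]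
  rintro _ ⟨s, z, hz, rfl, h0, h1⟩ h2
  rw [pt_mem_openCyl hσ hl hz] at h2
  rcases lt_or_gt_of_ne h with h | h
  · have := level_mono hσ (by omega : 0 ≤ k + 1) (by omega : k + 1 ≤ l); linarith
  · have := level_mono hσ (by omega : 0 ≤ l + 1) (by omega : l + 1 ≤ k); linarith

theorem exists_level (hσ : σ = 0 ∨ σ = 1) {h : ℝ} (hh : 0 ≤ h) :
    ∃ k : ℤ, 0 ≤ k ∧ level σ k ≤ h ∧ h < level σ (k + 1) := by
  have hex : ∃ n : ℕ, h < level σ (n + 1) := by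
    obtain ⟨n, hn⟩ := exists_nat_gt h
    refine ⟨n, hn.trans_le ?_⟩
    have : (0 : ℝ) ≤ n := by positivity
    unfold level
    rcases hσ with rfl | rfl <;> push_cast <;> nlinarith
  classical
  refine ⟨Nat.find hex, by positivity, ?_, Nat.find_spec hex⟩
  rcases Nat.eq_zero_or_pos (Nat.find hex) with h0 | h0
  · rw [h0]; simpa [level] using hh
  · have := Nat.find_min hex (m := Nat.find hex - 1) (by omega)
    rw [not_lt] at this
    have e : ((Nat.find hex - 1 : ℕ) : ℤ) + 1 = Nat.find hex := by omega
    rwa [e] at this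

theorem ht_nonneg (hσ : σ = 0 ∨ σ = 1) {s : Bool} {z : ℂ} (hz : z ∈ poly s) : 0 ≤ sgn s * ht σ z := by
  have key : ∀ z ∈ poly true, 0 ≤ ht σ z := by
    intro z hz
    rw [mem_poly_true] at hz
    have h0 := (chord_le_profile 0 z.re).trans hz
    have h1 := (chord_le_profile (-1) z.re).trans hz
    unfold chord at h0 h1; unfold ht
    rcases hσ with rfl | rfl <;> push_cast at * <;> linarith
  cases s
  · simpa [ht_neg] using key _ hz
  · simpa using key _ hz

/-- At the height of a level the section of the polygon runs exactly from one vertex to another. -/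
theorem mem_poly_level (hσ : σ = 0 ∨ σ = 1) (hk : 0 ≤ k) {s : Bool} {z : ℂ}
    (h : sgn s * ht σ z = level σ k) : z ∈ poly s ↔ (-k : ℝ) ≤ sgn s * z.re ∧ sgn s * z.re ≤ k + σ := by
  have key : ∀ z, ht σ z = level σ k → (z ∈ poly true ↔ (-k : ℝ) ≤ z.re ∧ z.re ≤ k + σ) := by
    intro z hz
    have hg := gap_pos hσ hk
    rw [mem_poly_iff hσ hk hz.ge (by rw [hz, level_succ]; linarith), hz]
    have e1 : leftEnd σ k (level σ k) = -k := by
      unfold leftEnd; rw [div_eq_iff hg.ne']; unfold level gap; ring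
    have e2 : rightEnd σ k (level σ k) = k + σ := by
      unfold rightEnd; rw [div_eq_iff hg.ne']; unfold level gap; ring
    rw [e1, e2]
  cases s
  · rw [mem_poly_false, key (-z) (by rw [ht_neg]; simpa using h)]; simp
  · rw [key z (by simpa using h)]; simp

theorem isVertex_level (hσ : σ = 0 ∨ σ = 1) (hk : 0 ≤ k) {s : Bool} {z : ℂ} (hz : z ∈ poly s)
    (h : sgn s * ht σ z = level σ k) : IsVertex z ↔ sgn s * z.re = -k ∨ sgn s * z.re = k + σ := by
  have key : ∀ z ∈ poly true, ht σ z = level σ k → (IsVertex z ↔ z.re = -k ∨ z.re = k + σ) := by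
    intro z hz h
    have hb := (mem_poly_level (s := true) hσ hk (by simpa using h)).1 hz
    simp only [sgn_true, one_mul] at hb
    rw [isVertex_of_mem_true hz]
    constructor
    · rintro ⟨n, rfl⟩
      simp only [ht, vertex_im, vertex_re, level] at *
      have e : ((n : ℝ) + k) * (n - (k + σ)) = 0 := by linear_combination h
      rcases mul_eq_zero.1 e with e | e
      · left; linarith
      · right; linarith
    · unfold ht level at h
      rintro (e | e)
      · refine ⟨-k, Complex.ext (by simp [e]) ?_⟩
        rw [e] at h; simp; linarith
      · refine ⟨k + σ, Complex.ext (by simp [e]) ?_⟩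
        rw [e] at h; simp; linarith
  cases s
  · rw [← isVertex_neg, key (-z) hz (by rw [ht_neg]; simpa using h)]; simp
  · simpa using key z hz (by simpa using h)

theorem horizontal_cases (hσ : σ = 0 ∨ σ = 1) {x : S1} (hx : x ∉ singularities) :
    (∃ k, 0 ≤ k ∧ x ∈ openCyl σ k) ∨ ∃ k, 0 ≤ k ∧ ∃ s, ∃ z ∈ poly s, x = pt s z ∧
      sgn s * ht σ z = level σ k ∧ (-k : ℝ) < sgn s * z.re ∧ sgn s * z.re < k + σ := by
  obtain ⟨s, z, hz, rfl⟩ := exists_pt x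
  obtain ⟨k, hk, h0, h1⟩ := exists_level hσ (ht_nonneg hσ hz)
  rcases h0.lt_or_eq with h0 | h0
  · exact Or.inl ⟨k, hk, s, z, hz, rfl, h0, h1⟩
  · right
    have h2 := (mem_poly_level hσ hk h0.symm).1 hz
    rw [pt_mem_singularities hz, isVertex_level hσ hk hz h0.symm, not_or] at hx
    exact ⟨k, hk, s, z, hz, rfl, h0.symm, lt_of_le_of_ne h2.1 (Ne.symm hx.1), lt_of_le_of_ne h2.2 hx.2⟩

theorem IsTrajectory.isSaddleConnection_of_segment {u z : ℂ} {s : Bool} {J : Set ℝ} {γ : ℝ → S1}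
    {t₀ a b : ℝ} (h : IsTrajectory u J γ) (ht₀ : t₀ ∈ J) (e : γ t₀ = pt s z) (ha : a < 0) (hb : 0 < b)
    (hp : ∀ t ∈ Icc a b, z + t * u ∈ poly s) (hv : ∀ t ∈ Ioo a b, ¬ IsVertex (z + t * u))
    (hva : IsVertex (z + a * u)) (hvb : IsVertex (z + b * u)) : IsSaddleConnection J γ := by
  have hab : a < b := ha.trans hb
  have hp' : ∀ t ∈ Ioo a b, z + t * u ∈ poly s := fun t ht => hp t (Ioo_subset_Icc_self ht)
  have hend : ∀ r ∉ Ioo a b, ∃ c ∈ uIcc 0 r, z + c * u ∈ poly s ∧ IsVertex (z + c * u) ∧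
      ∃ᶠ t in 𝓝 c, t ∈ Ioo a b := by
    intro r hr
    rcases le_or_gt r a with h1 | h1
    · refine ⟨a, mem_uIcc.2 (Or.inr ⟨h1, ha.le⟩), hp a (left_mem_Icc.2 hab.le), hva, ?_⟩
      have : ∃ᶠ t in 𝓝[>] a, t ∈ Ioo a b := Filter.Eventually.frequently (Ioo_mem_nhdsGT hab)
      exact this.filter_mono nhdsWithin_le_nhds
    · have h2 : b ≤ r := by
        by_contra! h2
        exact hr ⟨h1, h2⟩
      refine ⟨b, mem_uIcc.2 (Or.inl ⟨hb.le, h2⟩), hp b (right_mem_Icc.2 hab.le), hvb, ?_⟩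
      have : ∃ᶠ t in 𝓝[<] b, t ∈ Ioo a b := Filter.Eventually.frequently (Ioo_mem_nhdsLT hab)
      exact this.filter_mono nhdsWithin_le_nhds
  obtain ⟨hJ, hγ⟩ := h.eq_segment ht₀ e isOpen_Ioo ordConnected_Ioo ⟨ha, hb⟩ hp' hv hend
  exact ⟨singularForward_of_segment hp' (hp b (right_mem_Icc.2 hab.le)) hvb hJ hγ (isLUB_Ioo hab)
    (Ioo_mem_nhdsLT hab), singularBackward_of_segment hp' (hp a (left_mem_Icc.2 hab.le)) hva hJ hγ
    (isGLB_Ioo hab) (Ioo_mem_nhdsGT hab)⟩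

/-- The direction vector of slope `σ`. -/
def dir (σ : ℤ) : ℂ := ⟨1, σ⟩

@[simp] theorem dir_re (σ : ℤ) : (dir σ).re = 1 := rfl
@[simp] theorem dir_im (σ : ℤ) : (dir σ).im = σ := rfl

theorem ht_add_dir (z : ℂ) (t : ℝ) : ht σ (z + t * dir σ) = ht σ z := by simp [ht]; ring

theorem period_eq_dir : period σ k = (2 * gap σ k : ℝ) * dir σ := by
  apply Complex.ext <;> simp; ring

/-- The flow keeps the height, hence runs along the section at this level, whose two ends are
vertices. -/
theorem level_trajectory (hσ : σ = 0 ∨ σ = 1) (hk : 0 ≤ k) {s : Bool} {z : ℂ}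
    (hl : sgn s * ht σ z = level σ k) (h0 : (-k : ℝ) < sgn s * z.re) (h1 : sgn s * z.re < k + σ)
    {J : Set ℝ} {γ : ℝ → S1} {t₀ : ℝ} (h : IsTrajectory (dir σ) J γ) (ht₀ : t₀ ∈ J)
    (e : γ t₀ = pt s z) : IsSaddleConnection J γ := by
  have hl' : ∀ t : ℝ, sgn s * ht σ (z + t * dir σ) = level σ k := fun t => by rw [ht_add_dir, hl]
  have hp := fun t => mem_poly_level hσ hk (hl' t)
  have hv : ∀ t : ℝ, z + t * dir σ ∈ poly s → _ := fun t ht => isVertex_level hσ hk ht (hl' t)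
  have hre : ∀ t : ℝ, (z + t * dir σ).re = z.re + t := fun t => by simp
  simp only [hre] at hp hv
  cases s
  · simp only [sgn_false, neg_mul, one_mul] at *
    have hm : ∀ t ∈ Icc (-k - σ - z.re) (k - z.re), z + t * dir σ ∈ poly false := fun t ht =>
      (hp t).2 ⟨by linarith [ht.2], by linarith [ht.1]⟩
    refine h.isSaddleConnection_of_segment (a := -k - σ - z.re) (b := k - z.re) ht₀ e (by linarith)
      (by linarith) hm (fun t ht => ?_) ?_ ?_
    · rw [hv t (hm t (Ioo_subset_Icc_self ht))]
      rintro (h | h) <;> linarith [ht.1, ht.2]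
    · exact (hv _ (hm _ ⟨le_rfl, by linarith⟩)).2 (Or.inr (by ring))
    · exact (hv _ (hm _ ⟨by linarith, le_rfl⟩)).2 (Or.inl (by ring))
  · simp only [sgn_true, one_mul] at *
    have hm : ∀ t ∈ Icc (-k - z.re) (k + σ - z.re), z + t * dir σ ∈ poly true := fun t ht =>
      (hp t).2 ⟨by linarith [ht.1], by linarith [ht.2]⟩
    refine h.isSaddleConnection_of_segment (a := -k - z.re) (b := k + σ - z.re) ht₀ e (by linarith)
      (by linarith) hm (fun t ht => ?_) ?_ ?_
    · rw [hv t (hm t (Ioo_subset_Icc_self ht))]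
      rintro (h | h) <;> linarith [ht.1, ht.2]
    · exact (hv _ (hm _ ⟨le_rfl, by linarith⟩)).2 (Or.inl (by ring))
    · exact (hv _ (hm _ ⟨by linarith, le_rfl⟩)).2 (Or.inr (by ring))

/-- The line through a lift stays in the open strip, on which `cyl` has a period parallel to the
line. -/
theorem openCyl_trajectory (hσ : σ = 0 ∨ σ = 1) (hk : 0 ≤ k) {J : Set ℝ} {γ : ℝ → S1} {t₀ : ℝ}
    (h : IsTrajectory (dir σ) J γ) (ht₀ : t₀ ∈ J) (hx : γ t₀ ∈ openCyl σ k) :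
    IsClosedTrajectory J γ := by
  rw [← image_openStrip hσ hk] at hx
  obtain ⟨z, hz, e⟩ := hx
  have hm : ∀ t : ℝ, z + t * dir σ ∈ openStrip σ k := fun t => by
    unfold openStrip; rw [mem_ofPred_eq, ht_add_dir]; exact hz
  have hs : IsStraight (dir σ) univ (fun t => cyl σ k (z + t * dir σ)) := by
    rw [isStraight_iff]
    exact fun t _ => straightAt_of_germ (germ_cyl hσ hk (hm t))
      (Eventually.of_forall fun t' => by push_cast; ring_nf)
  have h2 := h.extends_of_zero isOpen_univ ordConnected_univ hs ht₀ (mem_univ _) (by simpa using e.symm)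
  have h3 : ∀ t, t ∈ J ∧ γ t = cyl σ k (z + (t - t₀ : ℝ) * dir σ) := fun t => by
    simpa using h2 (t - t₀) (mem_univ _)
  refine ⟨eq_univ_of_forall fun t => (h3 t).1, 2 * gap σ k, by linarith [gap_pos hσ hk], fun t => ?_⟩
  have := hm (t - t₀)
  rw [(h3 _).2, (h3 t).2, ← cyl_add_period hσ hk this.1.le this.2.le 1, period_eq_dir]
  push_cast; ring_nf

theorem isCylinder_openCyl (hσ : σ = 0 ∨ σ = 1) (hk : 0 ≤ k) : IsCylinder (dir σ) (openCyl σ k) := by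
  have h0 : dir σ ≠ 0 := fun h => by simpa using congrArg Complex.re h
  have hn : 0 < Complex.normSq (dir σ) := Complex.normSq_pos.2 h0
  have hg := gap_pos hσ hk
  -- Heights are measured by `cross (dir σ)`, whereas `planeStrip` divides by the vector; the ratio
  -- of the two is the squared norm of `dir σ`, which need not be `1`.
  have hmem : ∀ z, z ∈ planeStrip (dir σ) (gap σ k / Complex.normSq (dir σ)) ↔
      z + (level σ k : ℝ) * Complex.I ∈ openStrip σ k := by
    intro z
    rw [mem_planeStrip h0, div_mul_cancel₀ _ hn.ne']
    unfold openStrip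
    rw [mem_ofPred_eq, ht_add, level_succ]
    simp [cross, ht]
    intro _
    constructor <;> intro <;> linarith
  refine ⟨_, 2 * gap σ k, fun z => cyl σ k (z + (level σ k : ℝ) * Complex.I), div_pos hg hn,
    by linarith, ?_, fun z hz z' hz' => ?_, ?_⟩
  · rw [isTranslationMap_iff]
    intro z hz
    exact ((germ_cyl hσ hk ((hmem z).1 hz)).translate z).congr (Eventually.of_forall fun w => by ring_nf)
  · rw [cyl_eq_iff hσ hk ((hmem z).1 hz) ((hmem z').1 hz'), period_eq_dir]
    push_cast
    simp only [add_sub_add_right_eq_sub, mul_assoc]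
  · rw [← image_openStrip hσ hk]
    ext x
    constructor
    · rintro ⟨z, hz, rfl⟩
      exact ⟨z - (level σ k : ℝ) * Complex.I, (hmem _).2 (by simpa using hz), by simp⟩
    · rintro ⟨z, hz, rfl⟩
      exact ⟨_, (hmem z).1 hz, rfl⟩

/-- A small vertical push, upwards in `Q⁺` and downwards in `Q⁻`, stays in the polygon and moves the
point off the lower level. -/
theorem exists_mem_closure_openCyl (hσ : σ = 0 ∨ σ = 1) (x : S1) :
    ∃ k, 0 ≤ k ∧ x ∈ closure (openCyl σ k) := by
  obtain ⟨s, z, hz, rfl⟩ := exists_pt x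
  obtain ⟨k, hk, h0, h1⟩ := exists_level hσ (ht_nonneg hσ hz)
  refine ⟨k, hk, ?_⟩
  have hss : sgn s * sgn s = 1 := by cases s <;> simp
  have hm : ∀ ε : ℝ, 0 ≤ ε → z + (sgn s * ε : ℝ) * Complex.I ∈ poly s := by
    intro ε hε
    cases s
    · rw [mem_poly_false'] at *; simp; linarith
    · rw [mem_poly_true] at *; simp; linarith
  have hh : ∀ ε : ℝ, sgn s * ht σ (z + (sgn s * ε : ℝ) * Complex.I) = sgn s * ht σ z + ε := by
    intro ε
    rw [ht_add, mul_add]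
    have : ht σ ((sgn s * ε : ℝ) * Complex.I) = sgn s * ε := by simp [ht]
    rw [this, ← mul_assoc, hss, one_mul]
  have hc : Continuous fun ε : ℝ => z + (sgn s * ε : ℝ) * Complex.I := by fun_prop
  have ht : Tendsto (fun ε : ℝ => z + (sgn s * ε : ℝ) * Complex.I) (𝓝[>] 0) (𝓝[poly s] z) := by
    refine tendsto_nhdsWithin_iff.2 ⟨?_, ?_⟩
    · have := hc.tendsto 0
      simp only [mul_zero, Complex.ofReal_zero, zero_mul, add_zero] at this
      exact this.mono_left nhdsWithin_le_nhds
    · filter_upwards [self_mem_nhdsWithin] with ε hε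
      exact hm ε (le_of_lt hε)
  refine mem_closure_of_tendsto ((continuousOn_pt s z hz).tendsto.comp ht) ?_
  filter_upwards [Ioo_mem_nhdsGT (sub_pos.2 h1)] with ε hε
  refine (pt_mem_openCyl hσ hk (hm ε hε.1.le)).2 ?_
  rw [hh]
  exact ⟨by linarith [hε.1], by linarith [hε.2]⟩

theorem isCompletelyPeriodic_dir (hσ : σ = 0 ∨ σ = 1) : IsCompletelyPeriodic (dir σ) := by
  have key : ∀ (J : Set ℝ) (γ : ℝ → S1), IsTrajectory (dir σ) J γ → ∀ t₀ ∈ J,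
      (∃ k, 0 ≤ k ∧ γ t₀ ∈ openCyl σ k ∧ IsClosedTrajectory J γ) ∨ IsSaddleConnection J γ := by
    intro J γ h t₀ ht₀
    have hx := (isStraight_iff.1 h.straight t₀ ht₀).not_mem_singularities
    rcases horizontal_cases hσ hx with ⟨k, hk, h1⟩ | ⟨k, hk, s, z, hz, e, h0, h1, h2⟩
    · exact Or.inl ⟨k, hk, h1, openCyl_trajectory hσ hk h ht₀ h1⟩
    · exact Or.inr (level_trajectory hσ hk h0 h1 h2 h ht₀ e)
  refine ⟨⟨openCyl σ '' {k | 0 ≤ k}, ?_, ?_, ?_, fun x hx hx' => ?_⟩, fun J γ h => ?_⟩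
  · rintro _ ⟨k, hk, rfl⟩
    exact isCylinder_openCyl hσ hk
  · rintro _ ⟨k, hk, rfl⟩ _ ⟨l, hl, rfl⟩ hne
    exact disjoint_openCyl hσ hk hl fun e => hne (by rw [e])
  · refine eq_univ_of_forall fun x => ?_
    obtain ⟨k, hk, h⟩ := exists_mem_closure_openCyl hσ x
    rw [biUnion_image]
    exact mem_biUnion hk h
  · obtain ⟨J, γ, h, h0, rfl⟩ := exists_trajectory (dir σ) hx
    refine ⟨J, γ, h, ⟨0, h0, rfl⟩, ?_⟩
    rcases key J γ h 0 h0 with ⟨k, hk, h1, -⟩ | h1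
    · exact absurd ⟨_, ⟨k, hk, rfl⟩, h1⟩ hx'
    · exact Or.inl h1.1
  · obtain ⟨t₀, ht₀⟩ := h.nonempty
    exact (key J γ h t₀ ht₀).imp_left fun ⟨_, _, _, h⟩ => h

end

section

/-! ### The multitwist in the horizontal cylinders -/

section

variable {σ k : ℤ}

theorem cyl_of_mem (hσ : σ = 0 ∨ σ = 1) (hk : 0 ≤ k) {z : ℂ} (h0 : level σ k ≤ ht σ z)
    (h1 : ht σ z ≤ level σ (k + 1)) {j : ℤ} {s : Bool}
    (h : z - j * period σ k - shift (k + σ) s ∈ poly s) :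
    cyl σ k z = pt s (z - j * period σ k - shift (k + σ) s) := by
  cases s
  · exact cyl_false hσ hk h0 h1 h
  · simp only [shift_true, sub_zero] at h ⊢
    exact cyl_true hσ hk h0 h1 h

/-- The closed strip whose interior is `openStrip σ k`. -/
def closedStrip (σ k : ℤ) : Set ℂ := {z | level σ k ≤ ht σ z ∧ ht σ z ≤ level σ (k + 1)}

theorem convex_closedStrip (σ k : ℤ) : Convex ℝ (closedStrip σ k) := by
  intro z hz w hw a b ha hb hab
  have e : ht σ (a • z + b • w) = a * ht σ z + b * ht σ w := by simp [ht]; ring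
  unfold closedStrip at *
  rw [mem_ofPred_eq, e]
  have hb' : b = 1 - a := by linarith
  subst hb'
  constructor <;> nlinarith [hz.1, hz.2, hw.1, hw.2]

/-- Nearby points of the strip have representatives in a common polygon at the same distance;
convexity of the strip globalizes the estimate. -/
theorem edist_cyl_le (hσ : σ = 0 ∨ σ = 1) (hk : 0 ≤ k) {z w : ℂ} (hz : z ∈ closedStrip σ k)
    (hw : w ∈ closedStrip σ k) : edist (cyl σ k z) (cyl σ k w) ≤ edist z w := by
  have := edist_le_of_locally_convex (convex_closedStrip σ k) (g := cyl σ k) (C := 1) ?_ hz hw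
  · simpa using this
  clear hz hw z w
  intro z hz
  let r : ℂ → ℝ := fun w => (w.re - leftEnd σ k (ht σ w)) / (2 * gap σ k)
  have hr : Continuous r := (Complex.continuous_re.sub (continuous_leftEnd σ k)).div_const _
  have h1 : ∀ᶠ w in 𝓝 z, ⌊r w⌋ ∈ Finset.Icc (⌊r z⌋ - 1) (⌊r z⌋ + 1) := by
    have : ∀ᶠ w in 𝓝 z, r w ∈ Ioo (r z - 1) (r z + 1) :=
      hr.continuousAt.eventually (Ioo_mem_nhds (by linarith) (by linarith))
    filter_upwards [this] with w hw
    have e1 := Int.floor_mono hw.1.le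
    have e2 := Int.floor_mono hw.2.le
    rw [Int.floor_sub_one] at e1
    rw [Int.floor_add_one] at e2
    exact Finset.mem_Icc.2 ⟨e1, e2⟩
  -- Only finitely many closed pieces of the strip come near `z`, so every piece that contains a
  -- nearby point contains `z`.
  have h2 : ∀ᶠ w in 𝓝 z, ∀ j ∈ Finset.Icc (⌊r z⌋ - 1) (⌊r z⌋ + 1), ∀ s : Bool,
      w - j * period σ k - shift (k + σ) s ∈ poly s → z - j * period σ k - shift (k + σ) s ∈ poly s := by
    rw [Filter.eventually_all_finset]
    intro j _
    rw [Filter.eventually_all]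
    intro s
    by_cases h : z - j * period σ k - shift (k + σ) s ∈ poly s
    · exact Eventually.of_forall fun _ _ => h
    · have hc : Continuous fun w : ℂ => w - j * period σ k - shift (k + σ) s := by fun_prop
      filter_upwards [hc.continuousAt.eventually ((isClosed_poly s).isOpen_compl.mem_nhds h)] with w hw h'
      exact absurd h' hw
  filter_upwards [nhdsWithin_le_nhds h1, nhdsWithin_le_nhds h2, self_mem_nhdsWithin] with w hw1 hw2 hw
  obtain ⟨h3, h4⟩ := floor_bounds hσ hk w
  have e := ht_sub_period (σ := σ) (k := k) w ⌊r w⌋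
  have h5 : ∃ s, w - ⌊r w⌋ * period σ k - shift (k + σ) s ∈ poly s := by
    rcases le_total (w - ⌊r w⌋ * period σ k).re (rightEnd σ k (ht σ w)) with h | h
    · refine ⟨true, ?_⟩
      rw [shift_true, sub_zero, mem_poly_iff hσ hk (by rw [e]; exact hw.1) (by rw [e]; exact hw.2), e]
      exact ⟨h3, h⟩
    · refine ⟨false, ?_⟩
      rw [shift_false, sub_offset_right_mem_iff hσ hk (by rw [e]; exact hw.1) (by rw [e]; exact hw.2), e]
      exact ⟨h, h4.le⟩
  obtain ⟨s, hs⟩ := h5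
  have hs' := hw2 _ hw1 s hs
  rw [cyl_of_mem hσ hk hz.1 hz.2 hs', cyl_of_mem hσ hk hw.1 hw.2 hs]
  refine (edist_pt_le hs' hs).trans ?_
  simp [edist_sub_right]

/-- A boundary point of the strip has a representative whose height is a level, in `Q⁺` and in `Q⁻`
alike, since the reflection exchanges the two levels. -/
theorem cyl_not_mem_openCyl (hσ : σ = 0 ∨ σ = 1) (hk : 0 ≤ k) {z : ℂ}
    (h : ht σ z = level σ k ∨ ht σ z = level σ (k + 1)) {l : ℤ} (hl : 0 ≤ l) :
    cyl σ k z ∉ openCyl σ l := by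
  have hg := gap_pos hσ hk
  have hs := level_succ σ k
  have hz : z ∈ closedStrip σ k := by rcases h with h | h <;> constructor <;> linarith
  have key : ∀ i : ℤ, 0 ≤ i → ¬ (level σ l < level σ i ∧ level σ i < level σ (l + 1)) := by
    rintro i hi ⟨a, b⟩
    rcases le_or_gt i l with h | h
    · exact a.not_ge (level_mono hσ hi h)
    · exact b.not_ge (level_mono hσ (by omega) (by omega : l + 1 ≤ i))
  have key' : ∃ i : ℤ, 0 ≤ i ∧ ht σ z = level σ i := by
    rcases h with h | h
    · exact ⟨k, hk, h⟩
    · exact ⟨k + 1, by omega, h⟩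
  obtain ⟨j, -, -, hj | hj⟩ := exists_fundamental hσ hk hz.1 hz.2
  · rw [cyl_true hσ hk hz.1 hz.2 hj, pt_mem_openCyl hσ hl hj, sgn_true, one_mul, ht_sub_period]
    obtain ⟨i, hi, e⟩ := key'
    rw [e]; exact key i hi
  · rw [cyl_false hσ hk hz.1 hz.2 hj, pt_mem_openCyl hσ hl hj, sgn_false, ht_sub, ht_sub_period,
      ht_offset_right]
    rcases h with h | h
    · have e : -1 * (ht σ z - (level σ k + level σ (k + 1))) = level σ (k + 1) := by linarith
      rw [e]; exact key _ (by omega)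
    · have e : -1 * (ht σ z - (level σ k + level σ (k + 1))) = level σ k := by linarith
      rw [e]; exact key _ hk

/-- On the universal cover of a cylinder the rotation by `π` is the reflection in the midpoint of
the right edge. -/
theorem swapMap_cyl (hσ : σ = 0 ∨ σ = 1) (hk : 0 ≤ k) {z : ℂ} (hz : z ∈ closedStrip σ k) :
    swapMap (cyl σ k z) = cyl σ k (offset (k + σ) - z) := by
  have e : ht σ (offset (k + σ) - z) = level σ k + level σ (k + 1) - ht σ z := by
    rw [ht_sub, ht_offset_right]
  have h0 : level σ k ≤ ht σ (offset (k + σ) - z) := by rw [e]; linarith [hz.2]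
  have h1 : ht σ (offset (k + σ) - z) ≤ level σ (k + 1) := by rw [e]; linarith [hz.1]
  obtain ⟨j, -, -, hj⟩ := exists_fundamental hσ hk hz.1 hz.2
  rcases hj with hj | hj
  · have e2 : offset (k + σ) - z - (-j : ℤ) * period σ k - offset (k + σ) = -(z - j * period σ k) := by
      push_cast; ring
    rw [cyl_true hσ hk hz.1 hz.2 hj, swapMap_pt hj, cyl_false (j := -j) hσ hk h0 h1, e2]
    · rfl
    · rw [e2]; exact neg_mem_poly_not hj
  · have e2 : offset (k + σ) - z - (-j : ℤ) * period σ k = -(z - j * period σ k - offset (k + σ)) := by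
      push_cast; ring
    rw [cyl_false hσ hk hz.1 hz.2 hj, swapMap_pt hj, cyl_true (j := -j) hσ hk h0 h1, e2]
    · rfl
    · rw [e2]; exact neg_mem_poly_not hj

theorem exists_cyl (hσ : σ = 0 ∨ σ = 1) (x : S1) : ∃ k, 0 ≤ k ∧ ∃ z ∈ closedStrip σ k, x = cyl σ k z := by
  obtain ⟨s, z, hz, rfl⟩ := exists_pt x
  obtain ⟨k, hk, h0, h1⟩ := exists_level hσ (ht_nonneg hσ hz)
  refine ⟨k, hk, ?_⟩
  cases s
  · simp only [sgn_false, neg_mul, one_mul] at h0 h1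
    have e : ht σ (z + offset (k + σ)) = ht σ z + (level σ k + level σ (k + 1)) := by
      rw [ht_add, ht_offset_right]
    have hm : z + offset (k + σ) ∈ closedStrip σ k := ⟨by rw [e]; linarith, by rw [e]; linarith⟩
    refine ⟨_, hm, ?_⟩
    have := cyl_false hσ hk hm.1 hm.2 (j := 0) (by simpa using hz)
    simpa using this.symm
  · simp only [sgn_true, one_mul] at h0 h1
    refine ⟨z, ⟨h0, h1.le⟩, ?_⟩
    have := cyl_true hσ hk h0 h1.le (j := 0) (by simpa using hz)
    simpa using this.symm

end

/-! ### The twist map and its affine structure -/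

section

variable {k : ℤ}

/-- The lift of the `e`-fold twist of the `k`-th horizontal cylinder. -/
def twistLift (e : ℤ) (k : ℤ) (z : ℂ) : ℂ := z + (2 * e * (ht 0 z - level 0 k) : ℝ)

@[simp] theorem ht_twistLift (e k : ℤ) (z : ℂ) : ht 0 (twistLift e k z) = ht 0 z := by
  simp [twistLift, ht]

theorem twistLift_add (e k : ℤ) (z w : ℂ) : twistLift e k (z + w) = twistLift e k z + hshear e w := by
  apply Complex.ext <;> simp [twistLift, ht]; ring

theorem twistLift_add_period (e k i : ℤ) (z : ℂ) :
    twistLift e k (z + i * period 0 k) = twistLift e k z + i * period 0 k := by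
  apply Complex.ext <;> simp [twistLift, ht]; ring

theorem twistLift_twistLift (e k : ℤ) (z : ℂ) : twistLift (-e) k (twistLift e k z) = z := by
  have := ht_twistLift e k z
  unfold twistLift at *
  rw [this]; push_cast; ring

theorem twistLift_mem_openStrip {e k : ℤ} {z : ℂ} :
    twistLift e k z ∈ openStrip 0 k ↔ z ∈ openStrip 0 k := by
  simp [openStrip]

theorem twistLift_mem_closedStrip {e k : ℤ} {z : ℂ} :
    twistLift e k z ∈ closedStrip 0 k ↔ z ∈ closedStrip 0 k := by
  simp [closedStrip]

open Classical in
/-- The `e`-fold multitwist in the horizontal cylinders, as a map. -/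
def twistMap (e : ℤ) (x : S1) : S1 :=
  if h : ∃ p : ℤ × ℂ, 0 ≤ p.1 ∧ p.2 ∈ openStrip 0 p.1 ∧ cyl 0 p.1 p.2 = x
  then cyl 0 h.choose.1 (twistLift e h.choose.1 h.choose.2) else x

/-- The formula persists on the boundary, where `twistMap` is the identity: the lift fixes the lower
line and moves the upper one by `2 * e * gap 0 k`, that is by `e` periods. Here the common ratio of
circumference and height is used. -/
theorem twistMap_cyl (e : ℤ) (hk : 0 ≤ k) {z : ℂ} (hz : z ∈ closedStrip 0 k) :
    twistMap e (cyl 0 k z) = cyl 0 k (twistLift e k z) := by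
  have hσ : (0 : ℤ) = 0 ∨ (0 : ℤ) = 1 := Or.inl rfl
  by_cases hz' : z ∈ openStrip 0 k
  · have h : ∃ p : ℤ × ℂ, 0 ≤ p.1 ∧ p.2 ∈ openStrip 0 p.1 ∧ cyl 0 p.1 p.2 = cyl 0 k z :=
      ⟨(k, z), hk, hz', rfl⟩
    unfold twistMap
    rw [dif_pos h]
    obtain ⟨h1, h2, h3⟩ := h.choose_spec
    set p := h.choose
    have hp : p.1 = k := by
      by_contra hne
      refine disjoint_left.1 (disjoint_openCyl hσ h1 hk hne) (?_ : cyl 0 k z ∈ _) ?_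
      · rw [← h3, ← image_openStrip hσ h1]; exact mem_image_of_mem _ h2
      · rw [← image_openStrip hσ hk]; exact mem_image_of_mem _ hz'
    rw [hp] at h1 h2 h3 ⊢
    obtain ⟨j, hj⟩ := (cyl_eq_iff hσ hk h2 hz').1 h3
    have e1 : z = p.2 + j * period 0 k := by linear_combination hj
    rw [e1, twistLift_add_period]
    have := twistLift_mem_openStrip (e := e).2 h2
    rw [cyl_add_period hσ hk this.1.le this.2.le]
  · have hb : ht 0 z = level 0 k ∨ ht 0 z = level 0 (k + 1) := by
      by_contra! h
      exact hz' ⟨lt_of_le_of_ne hz.1 h.1.symm, lt_of_le_of_ne hz.2 h.2⟩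
    have h : ¬ ∃ p : ℤ × ℂ, 0 ≤ p.1 ∧ p.2 ∈ openStrip 0 p.1 ∧ cyl 0 p.1 p.2 = cyl 0 k z := by
      rintro ⟨p, h1, h2, h3⟩
      refine cyl_not_mem_openCyl hσ hk hb h1 ?_
      rw [← h3, ← image_openStrip hσ h1]; exact mem_image_of_mem _ h2
    unfold twistMap
    rw [dif_neg h]
    rcases hb with hb | hb
    · unfold twistLift; rw [hb]; simp
    · have e1 : twistLift e k z = z + e * period 0 k := by
        unfold twistLift
        rw [hb, level_succ]
        apply Complex.ext <;> simp; ring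
      rw [e1, cyl_add_period hσ hk hz.1 hz.2]

theorem twistMap_twistMap (e : ℤ) (x : S1) : twistMap (-e) (twistMap e x) = x := by
  obtain ⟨k, hk, z, hz, rfl⟩ := exists_cyl (Or.inl rfl : (0 : ℤ) = 0 ∨ (0 : ℤ) = 1) x
  rw [twistMap_cyl e hk hz, twistMap_cyl _ hk (twistLift_mem_closedStrip.2 hz), twistLift_twistLift]

/-- This symmetry reduces questions about the twist on `Q⁻` to `Q⁺`. The two lifts differ by `e`
periods. -/
theorem twistMap_swapMap (e : ℤ) (x : S1) : twistMap e (swapMap x) = swapMap (twistMap e x) := by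
  have hσ : (0 : ℤ) = 0 ∨ (0 : ℤ) = 1 := Or.inl rfl
  obtain ⟨k, hk, z, hz, rfl⟩ := exists_cyl hσ x
  have hz' := twistLift_mem_closedStrip (e := e).2 hz
  have hr : ∀ w ∈ closedStrip 0 k, offset (k + 0) - w ∈ closedStrip 0 k := fun w hw => by
    have e : ht 0 (offset (k + 0) - w) = level 0 k + level 0 (k + 1) - ht 0 w := by
      rw [ht_sub, ht_offset_right]
    exact ⟨by rw [e]; linarith [hw.2], by rw [e]; linarith [hw.1]⟩
  rw [twistMap_cyl e hk hz, swapMap_cyl hσ hk hz, swapMap_cyl hσ hk hz', twistMap_cyl e hk (hr _ hz)]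
  have e1 : twistLift e k (offset (k + 0) - z) = offset (k + 0) - twistLift e k z + e * period 0 k := by
    apply Complex.ext <;> simp [twistLift, ht, level, gap, sq]; ring
  rw [e1, cyl_add_period hσ hk (hr _ hz').1 (hr _ hz').2]

theorem twistMap_pt_true (e : ℤ) (hk : 0 ≤ k) {z : ℂ} (h : z ∈ poly true) (hz : z ∈ closedStrip 0 k) :
    twistMap e (pt true z) = cyl 0 k (twistLift e k z) := by
  have := cyl_true (Or.inl rfl) hk hz.1 hz.2 (j := 0) (by simpa using h)
  rw [← twistMap_cyl e hk hz, this]; simp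

/-- Each point of `Q⁺` near `z` shares a closed band with `z`; there the twist is a shear followed
by the nonexpanding map `cyl`. -/
theorem edist_twistMap_le (e : ℤ) {z w : ℂ} (hz : z ∈ poly true) (hw : w ∈ poly true) :
    edist (twistMap e (pt true z)) (twistMap e (pt true w)) ≤
      (‖(hshear e : ℂ →L[ℝ] ℂ)‖₊ : ℝ≥0∞) * edist z w := by
  have hσ : (0 : ℤ) = 0 ∨ (0 : ℤ) = 1 := Or.inl rfl
  refine edist_le_of_locally_convex (convex_poly true) (g := fun z => twistMap e (pt true z)) ?_ hz hw
  clear hz hw z w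
  intro z hz
  have hnn : ∀ w ∈ poly true, 0 ≤ ht 0 w := fun w hw => by simpa using ht_nonneg hσ hw
  have key : ∀ w ∈ poly true, ∀ k, 0 ≤ k → z ∈ closedStrip 0 k → w ∈ closedStrip 0 k →
      edist (twistMap e (pt true z)) (twistMap e (pt true w)) ≤
      (‖(hshear e : ℂ →L[ℝ] ℂ)‖₊ : ℝ≥0∞) * edist z w := by
    intro w hw k hk h1 h2
    rw [twistMap_pt_true e hk hz h1, twistMap_pt_true e hk hw h2]
    refine (edist_cyl_le hσ hk (twistLift_mem_closedStrip.2 h1) (twistLift_mem_closedStrip.2 h2)).trans ?_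
    have e1 : ∀ w, twistLift e k w = hshear e w + twistLift e k 0 := fun w => by
      rw [add_comm, ← twistLift_add, zero_add]
    rw [e1 z, e1 w, edist_add_right]
    exact (hshear e : ℂ →L[ℝ] ℂ).lipschitz z w
  obtain ⟨k, hk, h0, h1⟩ := exists_level hσ (hnn z hz)
  have hup : ∀ᶠ w in 𝓝 z, ht 0 w < level 0 (k + 1) :=
    (continuous_ht 0).continuousAt.eventually (gt_mem_nhds h1)
  rcases h0.lt_or_eq with h0 | h0
  · have hlo : ∀ᶠ w in 𝓝 z, level 0 k < ht 0 w :=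
      (continuous_ht 0).continuousAt.eventually (lt_mem_nhds h0)
    filter_upwards [nhdsWithin_le_nhds hup, nhdsWithin_le_nhds hlo, self_mem_nhdsWithin] with w a b hw
    exact key w hw k hk ⟨h0.le, h1.le⟩ ⟨b.le, a.le⟩
  -- On a level the neighbours below are compared in the cylinder `k - 1`. At level `0` the polygon
  -- has no points below.
  · rcases hk.lt_or_eq with hk' | rfl
    · have hg := gap_pos hσ (by omega : 0 ≤ k - 1)
      have hs := level_succ 0 (k - 1)
      rw [sub_add_cancel] at hs
      have hlo : ∀ᶠ w in 𝓝 z, level 0 (k - 1) < ht 0 w :=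
        (continuous_ht 0).continuousAt.eventually (lt_mem_nhds (by linarith))
      filter_upwards [nhdsWithin_le_nhds hup, nhdsWithin_le_nhds hlo, self_mem_nhdsWithin] with w a b hw
      rcases le_total (level 0 k) (ht 0 w) with h | h
      · exact key w hw k hk ⟨h0.le, h1.le⟩ ⟨h, a.le⟩
      · exact key w hw (k - 1) (by omega) ⟨by linarith, by rw [sub_add_cancel]; exact h0.ge⟩
          ⟨b.le, by rw [sub_add_cancel]; exact h⟩
    · filter_upwards [nhdsWithin_le_nhds hup, self_mem_nhdsWithin] with w a hw
      exact key w hw 0 le_rfl ⟨h0.le, h1.le⟩ ⟨by simpa [level] using hnn w hw, a.le⟩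

theorem pt_false_eq_swapMap {z : ℂ} (hz : z ∈ poly false) : pt false z = swapMap (pt true (-z)) := by
  have := swapMap_pt (s := true) (neg_mem_poly_not hz)
  rw [neg_neg] at this
  exact this.symm

theorem edist_swapMap_le (x y : S1) : edist (swapMap x) (swapMap y) ≤ edist x y := by
  have : LipschitzWith 1 swapMap := by
    refine lipschitzWith_of_poly (by positivity) fun s z hz w hw => ?_
    rw [swapMap_pt hz, swapMap_pt hw]
    refine (edist_pt_le (neg_mem_poly_not hz) (neg_mem_poly_not hw)).trans ?_
    simp
  simpa using this x y

theorem continuous_twistMap (e : ℤ) : Continuous (twistMap e) := by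
  have : LipschitzWith (‖(hshear e : ℂ →L[ℝ] ℂ)‖₊ + 1) (twistMap e) := by
    refine lipschitzWith_of_poly (by positivity) fun s z hz w hw => ?_
    have key : ∀ z ∈ poly true, ∀ w ∈ poly true, edist (twistMap e (pt true z)) (twistMap e (pt true w)) ≤
        ((‖(hshear e : ℂ →L[ℝ] ℂ)‖₊ + 1 : NNReal) : ℝ≥0∞) * edist z w := fun z hz w hw => by
      refine (edist_twistMap_le e hz hw).trans ?_
      gcongr
      simp
    cases s
    · rw [pt_false_eq_swapMap hz, pt_false_eq_swapMap hw, twistMap_swapMap, twistMap_swapMap]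
      refine (edist_swapMap_le _ _).trans ((key _ (neg_mem_poly_not hz) _ (neg_mem_poly_not hw)).trans ?_)
      simp
    · exact key z hz w hw
  exact this.continuous

/-- The `e`-fold multitwist in the horizontal cylinders. -/
def twistHomeo (e : ℤ) : S1 ≃ₜ S1 where
  toFun := twistMap e
  invFun := twistMap (-e)
  left_inv := twistMap_twistMap e
  right_inv x := by simpa using twistMap_twistMap (-e) x
  continuous_toFun := continuous_twistMap e
  continuous_invFun := continuous_twistMap (-e)

/-- By strict convexity of the parabola the segment between the vertices `-k` and `k` is interior
except at its ends. -/
theorem poly_mem_nhds_level (hk : 0 ≤ k) {z : ℂ} (h : ht 0 z = level 0 k) (h0 : (-k : ℝ) < z.re)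
    (h1 : z.re < k) : poly true ∈ 𝓝 z := by
  have hσ : (0 : ℤ) = 0 ∨ (0 : ℤ) = 1 := Or.inl rfl
  have hp : profile z.re < z.im := by
    have hz : z ∈ poly true := (mem_poly_level (s := true) hσ hk (by simpa using h)).2
      (by simp; constructor <;> linarith)
    have hm : (⟨z.re, z.im⟩ : ℂ) = z := rfl
    rw [mem_poly_true] at hz
    refine lt_of_le_of_ne hz fun e => ?_
    have a1 : -k ≤ ⌊z.re⌋ := Int.le_floor.2 (by push_cast; linarith)
    have a2 : ⌊z.re⌋ < k := Int.floor_lt.2 h1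
    have a3 : (-k : ℝ) ≤ ⌊z.re⌋ := by exact_mod_cast a1
    have a4 : (⌊z.re⌋ : ℝ) + 1 ≤ k := by exact_mod_cast a2
    have f0 := Int.floor_le z.re
    have f1 := Int.lt_floor_add_one z.re
    rw [profile_eq_floor] at e
    unfold chord at e
    unfold ht level at h
    push_cast at h
    set j : ℝ := (⌊z.re⌋ : ℝ)
    -- If `z` were on the boundary, these two nonnegative terms would add up to zero. That forces `j
    -- = -k` and `j + 1 = k`, which is impossible for an integer `k`.
    have k1 : 0 ≤ (j + 1 - z.re) * ((k + j) * (k - j)) :=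
      mul_nonneg (by linarith) (mul_nonneg (by linarith) (by linarith))
    have k2 : 0 ≤ (z.re - j) * ((k + j + 1) * (k - j - 1)) :=
      mul_nonneg (by linarith) (mul_nonneg (by linarith) (by linarith))
    have k3 : (j + 1 - z.re) * ((k + j) * (k - j)) + (z.re - j) * ((k + j + 1) * (k - j - 1)) = 0 := by
      linear_combination -e - h
    have k4 : (j + 1 - z.re) * ((k + j) * (k - j)) = 0 := by linarith
    have k5 : (z.re - j) * ((k + j + 1) * (k - j - 1)) = 0 := by linarith
    have k6 : (k : ℝ) - j > 0 := by linarith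
    have k7 : (k : ℝ) + j = 0 := by
      rcases mul_eq_zero.1 k4 with h | h
      · linarith
      · rcases mul_eq_zero.1 h with h | h
        · exact h
        · linarith
    rcases mul_eq_zero.1 k5 with h | h
    · linarith
    · rcases mul_eq_zero.1 h with h | h
      · linarith
      · have h2 : (2 * k : ℝ) = 1 := by linarith
        have h3 : 2 * k = 1 := by exact_mod_cast h2
        omega
  have ho : IsOpen {z : ℂ | profile z.re < z.im} :=
    isOpen_lt (continuous_profile.comp Complex.continuous_re) Complex.continuous_im
  filter_upwards [ho.mem_nhds hp] with w hw
  exact (mem_poly_true).2 (le_of_lt hw)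

/-- The twists of adjacent cylinders fit along a level: the upper one fixes the line, the lower one
moves it by `e` full periods. Both have the linear part `hshear e`, so together they are one affine
map. -/
theorem twistMap_pt_level (e : ℤ) (hk : 0 ≤ k) {z : ℂ} (h : ht 0 z = level 0 k) (h0 : (-k : ℝ) < z.re)
    (h1 : z.re < k) : ∀ᶠ w in 𝓝 0, z + w ∈ poly true ∧ z + hshear e w ∈ poly true ∧
      twistMap e (pt true (z + w)) = pt true (z + hshear e w) := by
  have hσ : (0 : ℤ) = 0 ∨ (0 : ℤ) = 1 := Or.inl rfl
  have hp := poly_mem_nhds_level hk h h0 h1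
  have hk1 : 0 ≤ k - 1 := by
    have : (0 : ℝ) < k := by linarith
    have : 0 < k := by exact_mod_cast this
    omega
  have c1 : Tendsto (fun w : ℂ => z + w) (𝓝 0) (𝓝 z) := by
    have : Continuous fun w : ℂ => z + w := by fun_prop
    simpa using this.tendsto 0
  have c2 : Tendsto (fun w : ℂ => z + hshear e w) (𝓝 0) (𝓝 z) := by
    have : Continuous fun w : ℂ => z + hshear e w := by fun_prop
    simpa using this.tendsto 0
  have hs := level_succ 0 (k - 1)
  rw [sub_add_cancel] at hs
  have g1 := gap_pos hσ hk
  have g2 := gap_pos hσ hk1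
  have hup : ∀ᶠ w in 𝓝 z, ht 0 w < level 0 (k + 1) :=
    (continuous_ht 0).continuousAt.eventually (gt_mem_nhds (by rw [h, level_succ]; linarith))
  have hlo : ∀ᶠ w in 𝓝 z, level 0 (k - 1) < ht 0 w :=
    (continuous_ht 0).continuousAt.eventually (lt_mem_nhds (by linarith))
  filter_upwards [c1.eventually hp, c2.eventually hp, c1.eventually hup, c1.eventually hlo] with w a b c d
  refine ⟨a, b, ?_⟩
  have hh : ht 0 (z + hshear e w) = ht 0 (z + w) := by simp [ht]
  rcases le_total (level 0 k) (ht 0 (z + w)) with h' | h'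
  · rw [twistMap_pt_true e hk a ⟨h', c.le⟩, twistLift_add]
    have e1 : twistLift e k z = z := by unfold twistLift; rw [h]; simp
    rw [e1, cyl_true (j := 0) hσ hk (by rwa [hh]) (by rw [hh]; exact c.le)
      (by simp only [Int.cast_zero, zero_mul, sub_zero]; exact b)]
    simp
  · rw [twistMap_pt_true e hk1 a ⟨d.le, by rwa [sub_add_cancel]⟩, twistLift_add]
    have e1 : twistLift e (k - 1) z = z + e * period 0 (k - 1) := by
      unfold twistLift
      rw [h, hs]
      apply Complex.ext <;> simp; ring
    have e2 : z + e * period 0 (k - 1) + hshear e w - e * period 0 (k - 1) = z + hshear e w := by ring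
    have e3 : ht 0 (z + e * period 0 (k - 1) + hshear e w) = ht 0 (z + w) := by
      rw [← hh, ht_add, ht_add, ht_add, ht_int_period, add_zero]
    rw [e1, cyl_true (j := e) hσ hk1 (by rw [e3]; exact d.le) (by rwa [e3, sub_add_cancel])
      (by rwa [e2]), e2]

theorem germ_twistMap (e : ℤ) {x : S1} (hx : x ∉ singularities) :
    ∃ f g z z', Germ f z ∧ f z = x ∧ Germ g z' ∧ ∀ᶠ w in 𝓝 0, twistMap e (f (z + w)) = g (z' + hshear e w) := by
  have hσ : (0 : ℤ) = 0 ∨ (0 : ℤ) = 1 := Or.inl rfl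
  rcases horizontal_cases hσ hx with ⟨k, hk, h⟩ | ⟨k, hk, s, z, hz, rfl, h0, h1, h2⟩
  · rw [← image_openStrip hσ hk] at h
    obtain ⟨z, hz, rfl⟩ := h
    refine ⟨cyl 0 k, cyl 0 k, z, twistLift e k z, germ_cyl hσ hk hz, rfl,
      germ_cyl hσ hk (twistLift_mem_openStrip.2 hz), ?_⟩
    have c1 : Tendsto (fun w : ℂ => z + w) (𝓝 0) (𝓝 z) := by
      have : Continuous fun w : ℂ => z + w := by fun_prop
      simpa using this.tendsto 0
    filter_upwards [c1.eventually ((isOpen_openStrip 0 k).mem_nhds hz)] with w hw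
    rw [twistMap_cyl e hk ⟨hw.1.le, hw.2.le⟩, twistLift_add]
  · simp only [Int.cast_zero, add_zero] at h2
    cases s
    · simp only [sgn_false, neg_mul, one_mul] at *
      rw [← ht_neg] at h0
      have h1' : (-k : ℝ) < (-z).re := by simpa using h1
      have h2' : (-z).re < k := by simpa using h2
      have hp : poly false ∈ 𝓝 z := by
        have := poly_mem_nhds_level hk h0 h1' h2'
        have hc : Continuous fun w : ℂ => -w := by fun_prop
        filter_upwards [hc.continuousAt.eventually this] with w hw
        exact (mem_poly_false).2 hw
      refine ⟨pt false, pt false, z, z, germ_pt hp, rfl, germ_pt hp, ?_⟩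
      have hc : Tendsto (fun w : ℂ => -w) (𝓝 0) (𝓝 0) := by
        have : Continuous fun w : ℂ => -w := by fun_prop
        simpa using this.tendsto 0
      filter_upwards [hc.eventually (twistMap_pt_level e hk h0 h1' h2')] with w hw
      obtain ⟨a, b, c⟩ := hw
      have e1 : -z + -w = -(z + w) := by ring
      have e2 : -z + hshear e (-w) = -(z + hshear e w) := by rw [map_neg]; ring
      rw [e1] at a c
      rw [e2] at b c
      rw [pt_false_eq_swapMap ((mem_poly_false).2 a), twistMap_swapMap, c,
        ← pt_false_eq_swapMap ((mem_poly_false).2 b)]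
    · simp only [sgn_true, one_mul] at *
      have hp := poly_mem_nhds_level hk h0 h1 h2
      exact ⟨pt true, pt true, z, z, germ_pt hp, rfl, germ_pt hp,
        (twistMap_pt_level e hk h0 h1 h2).mono fun w hw => hw.2.2⟩

theorem twistMap_not_mem (e : ℤ) {x : S1} (hx : x ∉ singularities) : twistMap e x ∉ singularities := by
  obtain ⟨f, g, z, z', -, rfl, hg, h⟩ := germ_twistMap e hx
  have := h.self_of_nhds
  rw [map_zero, add_zero, add_zero] at this
  rw [this]
  exact hg.not_mem_singularities

theorem affineAut_twist (e : ℤ) : AffineAut (hshear e) (twistHomeo e) := by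
  refine affineAut_of_exists (cross_hshear e) (fun x => ?_) fun x hx => germ_twistMap e hx
  refine ⟨fun h => ?_, fun h => ?_⟩
  · by_contra hx
    exact twistMap_not_mem e hx h
  · by_contra hx
    have := twistMap_not_mem (-e) hx
    exact this (by rwa [← (twistHomeo e).symm_apply_apply x] at h)

end

end

section

/-! ### Rational directions -/

/-- Some affine automorphism takes the reduction modulo `2` of `(q, p)` to `(q, p)`. -/
def Liftable (q p : ℤ) : Prop :=
  ∃ (L : ℂ ≃L[ℝ] ℂ) (φ : S1 ≃ₜ S1), AffineAut L φ ∧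
    L ⟨((q % 2 : ℤ) : ℝ), ((p % 2 : ℤ) : ℝ)⟩ = ⟨(q : ℝ), (p : ℝ)⟩

theorem Liftable.vshear {q p : ℤ} (h : Liftable q p) (a : ℤ) : Liftable q (p + 2 * a * q) := by
  obtain ⟨L, φ, hL, e⟩ := h
  refine ⟨_, _, hL.trans (affineAut_slide a), ?_⟩
  have : (p + 2 * a * q) % 2 = p % 2 := by rw [mul_assoc]; omega
  rw [this, ContinuousLinearEquiv.trans_apply, e]
  apply Complex.ext <;> simp

theorem Liftable.hshear {q p : ℤ} (h : Liftable q p) (a : ℤ) : Liftable (q + 2 * a * p) p := by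
  obtain ⟨L, φ, hL, e⟩ := h
  refine ⟨_, _, hL.trans (affineAut_twist a), ?_⟩
  have : (q + 2 * a * p) % 2 = q % 2 := by rw [mul_assoc]; omega
  rw [this, ContinuousLinearEquiv.trans_apply, e]
  apply Complex.ext <;> simp

theorem Liftable.neg {q p : ℤ} (h : Liftable q p) : Liftable (-q) (-p) := by
  obtain ⟨L, φ, hL, e⟩ := h
  refine ⟨_, _, hL.trans affineAut_swap, ?_⟩
  have h1 : (-q) % 2 = q % 2 := by omega
  have h2 : (-p) % 2 = p % 2 := by omega
  rw [h1, h2, ContinuousLinearEquiv.trans_apply, e]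
  apply Complex.ext <;> simp

theorem liftable_mod_two (q p : ℤ) : Liftable (q % 2) (p % 2) :=
  ⟨_, _, AffineAut.refl, by simp⟩

/-- Euclid's algorithm with even quotients keeps parities and stops only at vectors with entries in
`{0, 1, -1}`. -/
theorem liftable_of_isCoprime {q p : ℤ} (h : IsCoprime p q) : Liftable q p := by
  induction hn : q.natAbs + p.natAbs using Nat.strong_induction_on generalizing q p with
  | _ n ih =>
    rcases lt_trichotomy q.natAbs p.natAbs with hlt | heq | hgt
    · rcases eq_or_ne q 0 with rfl | hq
      · rw [isCoprime_zero_right, Int.isUnit_iff] at h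
        rcases h with rfl | rfl
        · exact liftable_mod_two 0 1
        · exact (liftable_mod_two 0 1).neg
      -- As `0 < |q| < |p|`, one of `p - 2q` and `p + 2q` has absolute value `||p| - 2|q||`, which
      -- is less than `|p|`.
      · have key : ∀ a : ℤ, (p + 2 * a * q).natAbs < p.natAbs → Liftable q p := by
          intro a ha
          have hc : IsCoprime (p + 2 * a * q) q := IsCoprime.add_mul_right_left h (2 * a)
          have := (ih _ (by omega) hc rfl).vshear (-a)
          convert this using 1; ring
        rcases le_or_gt (p - 2 * q).natAbs (p + 2 * q).natAbs with h' | h'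
        · exact key (-1) (by rw [show p + 2 * (-1) * q = p - 2 * q by ring]; omega)
        · exact key 1 (by rw [show p + 2 * 1 * q = p + 2 * q by ring]; omega)
    · have h1 : p.natAbs = 1 := by
        have := Int.isCoprime_iff_gcd_eq_one.1 h
        rwa [Int.gcd, heq, Nat.gcd_self] at this
      have hp : p = 1 ∨ p = -1 := by omega
      have hq : q = 1 ∨ q = -1 := by omega
      rcases hp with rfl | rfl <;> rcases hq with rfl | rfl
      · exact liftable_mod_two 1 1
      · exact (liftable_mod_two 1 1).hshear (-1)
      · exact (liftable_mod_two 1 1).vshear (-1)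
      · exact (liftable_mod_two 1 1).neg
    · rcases eq_or_ne p 0 with rfl | hq
      · rw [isCoprime_zero_left, Int.isUnit_iff] at h
        rcases h with rfl | rfl
        · exact liftable_mod_two 1 0
        · exact (liftable_mod_two 1 0).neg
      · have key : ∀ a : ℤ, (q + 2 * a * p).natAbs < q.natAbs → Liftable q p := by
          intro a ha
          have hc : IsCoprime p (q + 2 * a * p) := IsCoprime.add_mul_right_right h (2 * a)
          have := (ih _ (by omega) hc rfl).hshear (-a)
          convert this using 1; ring
        rcases le_or_gt (q - 2 * p).natAbs (q + 2 * p).natAbs with h' | h'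
        · exact key (-1) (by rw [show q + 2 * (-1) * p = q - 2 * p by ring]; omega)
        · exact key 1 (by rw [show q + 2 * 1 * p = q + 2 * p by ring]; omega)

theorem exists_eq_mul_of_slope {p q : ℤ} (h : IsCoprime p q) {u : ℂ} (hu : u ≠ 0)
    (hs : slope u = frac p q) : ∃ r : ℝ, r ≠ 0 ∧ u = r * (⟨q, p⟩ : ℂ) := by
  unfold slope frac at hs
  split_ifs at hs with h1 h2 h2
  · have hq : q = 0 := by exact_mod_cast h2
    have hp : (p : ℝ) ≠ 0 := by
      rintro h0
      have : p = 0 := by exact_mod_cast h0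
      subst hq this
      exact not_isCoprime_zero_zero h
    refine ⟨u.im / p, div_ne_zero (fun h3 => hu (Complex.ext h1 h3)) hp, ?_⟩
    apply Complex.ext
    · simp [h1, hq]
    · simp [div_mul_cancel₀ _ hp]
  · exact absurd hs.symm (OnePoint.coe_ne_infty _)
  · exact absurd hs (OnePoint.coe_ne_infty _)
  · have e := OnePoint.coe_injective hs
    refine ⟨u.re / q, div_ne_zero h1 h2, ?_⟩
    rw [div_eq_div_iff h1 h2] at e
    apply Complex.ext
    · simp [div_mul_cancel₀ _ h2]
    · simp only [Complex.im_ofReal_mul]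
      field_simp; linarith

/-- A slope determines a vector up to a real factor; the rotation by `π` makes this factor positive.
-/
theorem exists_affineAut_of_slope {p q : ℤ} (h : IsCoprime p q) {u : ℂ} (hu : u ≠ 0)
    (hs : slope u = frac p q) : ∃ (L : ℂ ≃L[ℝ] ℂ) (φ : S1 ≃ₜ S1) (c : ℝ), AffineAut L φ ∧ 0 < c ∧
      u = c * L ⟨((q % 2 : ℤ) : ℝ), ((p % 2 : ℤ) : ℝ)⟩ := by
  obtain ⟨r, hr, e⟩ := exists_eq_mul_of_slope h hu hs
  obtain ⟨L, φ, hL, eL⟩ := liftable_of_isCoprime h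
  rcases lt_or_gt_of_ne hr with h0 | h0
  · refine ⟨_, _, -r, hL.trans affineAut_swap, by linarith, ?_⟩
    rw [ContinuousLinearEquiv.trans_apply, eL, e]
    apply Complex.ext <;> simp
  · exact ⟨L, φ, r, hL, h0, by rw [eL, e]⟩

theorem isCompletelyPeriodic_of_slope {u : ℂ} (hu : u ≠ 0)
    (h : IsRationalCongr (slope u) 0 1 ∨ IsRationalCongr (slope u) 1 1) : IsCompletelyPeriodic u := by
  have key : ∀ σ : ℤ, σ = 0 ∨ σ = 1 → IsRationalCongr (slope u) σ 1 → IsCompletelyPeriodic u := by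
    rintro σ hσ ⟨p, q, hc, hs, hp, hq⟩
    obtain ⟨L, φ, c, hL, h0, e⟩ := exists_affineAut_of_slope hc hu hs
    have h1 : q % 2 = 1 := hq
    have h2 : p % 2 = σ := by
      rcases hσ with rfl | rfl
      · exact hp
      · exact hp
    rw [h1, h2] at e
    have e' : u = c * L (dir σ) := by rw [e]; simp [dir]
    exact hL.isCompletelyPeriodic_map h0 e'
      (fun h => by simpa using congrArg Complex.re h) (isCompletelyPeriodic_dir hσ)
  rcases h with h | h
  · exact key 0 (Or.inl rfl) h
  · exact key 1 (Or.inr rfl) h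

theorem isStripDirection_of_slope {u : ℂ} (hu : u ≠ 0) (h : IsRationalCongr (slope u) 1 0) :
    IsStripDirection u := by
  obtain ⟨p, q, hc, hs, hp, hq⟩ := h
  obtain ⟨L, φ, c, hL, h0, e⟩ := exists_affineAut_of_slope hc hu hs
  have h1 : q % 2 = 0 := hq
  have h2 : p % 2 = 1 := hp
  rw [h1, h2] at e
  have e' : u = c * L Complex.I := by
    rw [e]; congr 2; apply Complex.ext <;> simp
  exact hL.isStripDirection_map h0 e' Complex.I_ne_zero isStripDirection_I

end

section

/-! ### Representatives modulo the integer lattice -/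

/-- The lattice of the points with integer coordinates. -/
def lat : AddSubgroup ℂ where
  carrier := {z | (∃ a : ℤ, z.re = a) ∧ ∃ b : ℤ, z.im = b}
  zero_mem' := ⟨⟨0, by simp⟩, ⟨0, by simp⟩⟩
  add_mem' := by
    rintro z w ⟨⟨a, ha⟩, b, hb⟩ ⟨⟨c, hc⟩, d, hd⟩
    exact ⟨⟨a + c, by simp [ha, hc]⟩, b + d, by simp [hb, hd]⟩
  neg_mem' := by
    rintro z ⟨⟨a, ha⟩, b, hb⟩
    exact ⟨⟨-a, by simp [ha]⟩, -b, by simp [hb]⟩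

theorem mem_lat {z : ℂ} : z ∈ lat ↔ (∃ a : ℤ, z.re = a) ∧ ∃ b : ℤ, z.im = b := Iff.rfl

theorem isClosed_lat : IsClosed (lat : Set ℂ) := by
  have h := Int.isClosedEmbedding_coe_real.isClosed_range
  have e : (lat : Set ℂ) = Complex.re ⁻¹' range ((↑) : ℤ → ℝ) ∩ Complex.im ⁻¹' range ((↑) : ℤ → ℝ) := by
    ext z
    simp [mem_lat, eq_comm]
  rw [e]
  exact (h.preimage Complex.continuous_re).inter (h.preimage Complex.continuous_im)

theorem countable_lat : (lat : Set ℂ).Countable := by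
  refine (countable_range fun p : ℤ × ℤ => (⟨p.1, p.2⟩ : ℂ)).mono ?_
  rintro z ⟨⟨a, ha⟩, b, hb⟩
  exact ⟨(a, b), Complex.ext ha.symm hb.symm⟩

theorem vertex_mem_lat (n : ℤ) : vertex n ∈ lat := ⟨⟨n, rfl⟩, n ^ 2, by simp⟩

theorem offset_mem_lat (n : ℤ) : offset n ∈ lat := lat.add_mem (vertex_mem_lat _) (vertex_mem_lat _)

theorem shift_mem_lat (n : ℤ) (s : Bool) : shift n s ∈ lat := by
  cases s
  · exact offset_mem_lat n
  · exact lat.zero_mem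

theorem IsVertex.mem_lat {z : ℂ} (h : IsVertex z) : z ∈ lat := by
  rcases h with ⟨n, rfl⟩ | ⟨n, hn⟩
  · exact vertex_mem_lat n
  · rw [← neg_neg z, ← hn]; exact lat.neg_mem (vertex_mem_lat n)

/-- The class modulo the lattice of the representatives of a point. -/
def cls : S1 → ℂ ⧸ lat :=
  liftPt (fun _ z => (z : ℂ ⧸ lat)) fun n z _ => by
    rw [eq_comm, QuotientAddGroup.eq]
    have := offset_mem_lat n
    convert this using 1; ring

theorem cls_pt {s : Bool} {z : ℂ} (hz : z ∈ poly s) : cls (pt s z) = (z : ℂ ⧸ lat) := liftPt_pt _ hz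

theorem coe_add_lat {z w : ℂ} (hw : w ∈ lat) : ((z + w : ℂ) : ℂ ⧸ lat) = z := by
  rw [eq_comm, QuotientAddGroup.eq]; simpa using hw

theorem cls_chart {n : ℤ} {z : ℂ} (hz : z ∈ chartDomain n) : cls (chart n z) = (z : ℂ ⧸ lat) := by
  obtain ⟨s, hs⟩ := exists_shift hz
  rw [chart_of_mem hs, cls_pt hs, sub_eq_add_neg, coe_add_lat (lat.neg_mem (shift_mem_lat n s))]

theorem cls_eq_zero_of_mem_singularities {x : S1} (hx : x ∈ singularities) : cls x = 0 := by
  obtain ⟨s, z, hz, rfl⟩ := exists_pt x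
  rw [cls_pt hz]
  exact (QuotientAddGroup.eq_zero_iff z).2 ((pt_mem_singularities hz).1 hx).mem_lat

/-- No topology on the values is involved; it is applied to classes modulo the lattice and to
propositions that depend on time. -/
theorem eq_of_locally_eq {α : Type*} {J : Set ℝ} (hJ : J.OrdConnected) {g : ℝ → α}
    (h : ∀ t ∈ J, ∀ᶠ t' in 𝓝 t, g t' = g t) {t₀ t : ℝ} (h0 : t₀ ∈ J) (ht : t ∈ J) : g t = g t₀ := by
  have := hJ.isPreconnected.subset_of_closure_inter_subset (u := {t | ∀ᶠ t' in 𝓝 t, g t' = g t₀})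
    isOpen_setOfPred_eventually_nhds ⟨t₀, h0, h t₀ h0⟩ (by
      rintro r ⟨hr, hrJ⟩
      have h1 : ∃ᶠ t' in 𝓝 r, g t' = g t₀ :=
        (mem_closure_iff_frequently.1 hr).mono fun t' h => h.self_of_nhds
      obtain ⟨t', h2, h3⟩ := (h1.and_eventually (h r hrJ)).exists
      have e : g r = g t₀ := h3.symm.trans h2
      exact (h r hrJ).mono fun t' h => h.trans e)
  exact (this ht).self_of_nhds

/-- Charts differ from polygon coordinates by lattice vectors, so modulo the lattice a straight
curve is one straight line. -/
theorem IsStraight.cls_eq {u : ℂ} {J : Set ℝ} {γ : ℝ → S1} (hJ : J.OrdConnected) (h : IsStraight u J γ)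
    {t₀ t : ℝ} (h0 : t₀ ∈ J) (ht : t ∈ J) :
    cls (γ t) = cls (γ t₀) + ((((t - t₀ : ℝ) : ℂ) * u : ℂ) : ℂ ⧸ lat) := by
  have := eq_of_locally_eq hJ (g := fun t => cls (γ t) - (((t : ℂ) * u : ℂ) : ℂ ⧸ lat)) ?_ h0 ht
  · rw [sub_eq_iff_eq_add] at this
    rw [this, sub_add_eq_add_sub, add_sub_assoc, ← QuotientAddGroup.mk_sub]
    congr 2; push_cast; ring
  · intro t ht
    rw [isStraight_iff] at h
    obtain ⟨n, a, ha, h1⟩ := straightAt_iff.1 (h t ht)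
    have e := h1.self_of_nhds
    simp only [sub_self, Complex.ofReal_zero, zero_mul, add_zero] at e
    filter_upwards [h1, eventually_line_mem_chartDomain ha u t] with t' h2 h3
    rw [h2, e, cls_chart h3, cls_chart ha, ← QuotientAddGroup.mk_sub, ← QuotientAddGroup.mk_sub]
    congr 1; push_cast; ring

theorem infDist_lat_eq {z w : ℂ} (h : (z : ℂ ⧸ lat) = w) :
    Metric.infDist z lat = Metric.infDist w lat := by
  have key : ∀ z w : ℂ, (z : ℂ ⧸ lat) = w → Metric.infDist z lat ≤ Metric.infDist w lat := by
    intro z w h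
    rw [QuotientAddGroup.eq] at h
    refine (Metric.le_infDist ⟨0, lat.zero_mem⟩).2 fun l hl => ?_
    have h1 : l - (-z + w) ∈ lat := lat.sub_mem hl h
    refine (Metric.infDist_le_dist_of_mem h1).trans (le_of_eq ?_)
    rw [dist_eq_norm, dist_eq_norm]; congr 1; ring
  exact le_antisymm (key z w h) (key w z h.symm)

/-- The distance of the representatives of a point to the lattice. -/
def latDist : S1 → ℝ :=
  liftPt (fun _ z => Metric.infDist z lat) fun n z _ => infDist_lat_eq (by
    rw [sub_eq_add_neg, coe_add_lat (lat.neg_mem (offset_mem_lat n))])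

theorem latDist_pt {s : Bool} {z : ℂ} (hz : z ∈ poly s) : latDist (pt s z) = Metric.infDist z lat :=
  liftPt_pt _ hz

theorem latDist_eq {x : S1} {w : ℂ} (h : cls x = w) : latDist x = Metric.infDist w lat := by
  obtain ⟨s, z, hz, rfl⟩ := exists_pt x
  rw [latDist_pt hz]
  rw [cls_pt hz] at h
  exact infDist_lat_eq h

theorem continuous_latDist : Continuous latDist := by
  have : LipschitzWith 1 latDist := by
    refine lipschitzWith_of_poly one_ne_zero fun s z hz w hw => ?_
    rw [latDist_pt hz, latDist_pt hw]
    exact Metric.lipschitz_infDist_pt _ z w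
  exact this.continuous

/-- The limit is detected by the continuous function `latDist`, which vanishes at singularities. -/
theorem mem_lat_of_tendsto {u z : ℂ} {J : Set ℝ} {γ : ℝ → S1} {b : ℝ} {l : Filter ℝ} [l.NeBot]
    (hl : l ≤ 𝓝 b) (hJ : ∀ᶠ t in l, t ∈ J) (h : ∀ t ∈ J, cls (γ t) = ((z + (t : ℂ) * u : ℂ) : ℂ ⧸ lat))
    {p : S1} (hp : p ∈ singularities) (ht : Tendsto γ l (𝓝 p)) : z + (b : ℂ) * u ∈ lat := by
  have h1 : Tendsto (fun t => latDist (γ t)) l (𝓝 (latDist p)) := (continuous_latDist.tendsto p).comp ht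
  have hc : Continuous fun t : ℝ => Metric.infDist (z + (t : ℂ) * u) lat :=
    (Metric.continuous_infDist_pt _).comp (by fun_prop)
  have h2 : Tendsto (fun t => latDist (γ t)) l (𝓝 (Metric.infDist (z + (b : ℂ) * u) lat)) :=
    ((hc.tendsto b).mono_left hl).congr' (hJ.mono fun t ht => (latDist_eq (h t ht)).symm)
  have h3 : latDist p = 0 := by
    rw [latDist_eq (w := 0) (cls_eq_zero_of_mem_singularities hp)]
    exact Metric.infDist_zero_of_mem lat.zero_mem
  have h4 := tendsto_nhds_unique h2 h1
  rw [h3] at h4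
  exact (isClosed_lat.mem_iff_infDist_zero ⟨0, lat.zero_mem⟩).2 h4

/-- No nonzero multiple of `u` lies in the lattice. -/
def IrrationalDir (u : ℂ) : Prop := ∀ r : ℝ, (r : ℂ) * u ∈ lat → r = 0

theorem IrrationalDir.not_isClosedTrajectory {u : ℂ} (hu : IrrationalDir u) {J : Set ℝ} {γ : ℝ → S1}
    (h : IsTrajectory u J γ) : ¬ IsClosedTrajectory J γ := by
  rintro ⟨rfl, T, hT, hp⟩
  have h1 := h.straight.cls_eq ordConnected_univ (mem_univ 0) (mem_univ T)
  have h2 := hp 0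
  rw [zero_add] at h2
  rw [h2, left_eq_add, QuotientAddGroup.eq_zero_iff, sub_zero] at h1
  exact hT.ne' (hu T h1)

/-- Both ends lift to lattice points on one line, so their difference `(b - a) * u` is a nonzero
lattice vector. -/
theorem IrrationalDir.not_isSaddleConnection {u : ℂ} (hu : IrrationalDir u) {J : Set ℝ} {γ : ℝ → S1}
    (h : IsTrajectory u J γ) : ¬ IsSaddleConnection J γ := by
  rintro ⟨⟨b, hb, p, hp, htb⟩, a, ha, q, hq, hta⟩
  obtain ⟨t₀, ht₀⟩ := h.nonempty
  obtain ⟨z, hz⟩ := QuotientAddGroup.mk_surjective (cls (γ t₀) - ((((t₀ : ℝ) : ℂ) * u : ℂ) : ℂ ⧸ lat))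
  have hcls : ∀ t ∈ J, cls (γ t) = ((z + (t : ℂ) * u : ℂ) : ℂ ⧸ lat) := fun t ht => by
    rw [h.straight.cls_eq h.ordConnected ht₀ ht, QuotientAddGroup.mk_add, hz, sub_add_eq_add_sub,
      add_sub_assoc, ← QuotientAddGroup.mk_sub]
    congr 2; push_cast; ring
  have hlt : ∀ t ∈ J, a < t ∧ t < b := by
    intro t ht
    obtain ⟨l, r, hlr, hI⟩ := mem_nhds_iff_exists_Ioo_subset.1 (h.isOpen.mem_nhds ht)
    have h1 : (l + t) / 2 ∈ J := hI ⟨by linarith [hlr.1], by linarith [hlr.1, hlr.2]⟩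
    have h2 : (t + r) / 2 ∈ J := hI ⟨by linarith [hlr.1, hlr.2], by linarith [hlr.2]⟩
    have h3 := ha.1 h1
    have h4 := hb.1 h2
    constructor <;> linarith [hlr.1, hlr.2]
  have hIoo : Ioo a b ⊆ J := by
    rintro t ⟨h1, h2⟩
    obtain ⟨t₁, h3, -, h4⟩ := ha.exists_between h1
    obtain ⟨t₂, h5, h6, -⟩ := hb.exists_between h2
    exact h.ordConnected.out h3 h5 ⟨h4.le, h6.le⟩
  have hab := (hlt t₀ ht₀).1.trans (hlt t₀ ht₀).2
  have hB := mem_lat_of_tendsto nhdsWithin_le_nhds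
    (mem_of_superset (Ioo_mem_nhdsLT hab) hIoo) hcls hp htb
  have hA := mem_lat_of_tendsto nhdsWithin_le_nhds
    (mem_of_superset (Ioo_mem_nhdsGT hab) hIoo) hcls hq hta
  have := hu (b - a) (by
    have := lat.sub_mem hB hA
    convert this using 1; push_cast; ring)
  linarith

/-! ### Completeness of the lines that miss the lattice -/

theorem profile_le_of_abs_le {k : ℤ} (hk : 1 ≤ k) {x ε : ℝ} (h0 : 0 < ε) (h1 : ε ≤ 1)
    (hx : |x| ≤ k - ε) :
    profile x ≤ k ^ 2 - ε := by
  have key : ∀ x : ℝ, 0 ≤ x → x ≤ k - ε → profile x ≤ k ^ 2 - ε := by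
    intro x h2 hx
    have hk' : (1 : ℝ) ≤ k := by exact_mod_cast hk
    have f0 := Int.floor_le x
    have f1 := Int.lt_floor_add_one x
    have f2 : (0 : ℝ) ≤ ⌊x⌋ := by exact_mod_cast Int.floor_nonneg.2 h2
    rw [profile_eq_floor, chord]
    rcases le_or_gt (k - 1) ⌊x⌋ with h | h
    · have h' : (k : ℝ) - 1 ≤ ⌊x⌋ := by exact_mod_cast h
      have h4 : ⌊x⌋ < k := Int.floor_lt.2 (by linarith)
      have h3 : (⌊x⌋ : ℝ) = k - 1 := by
        rw [show ⌊x⌋ = k - 1 by omega]; push_cast; ring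
      rw [h3] at f0 f1 ⊢
      nlinarith
    · have h3 : (⌊x⌋ : ℝ) + 2 ≤ k := by exact_mod_cast (by omega : ⌊x⌋ + 2 ≤ k)
      set j : ℝ := (⌊x⌋ : ℝ)
      nlinarith
  rcases le_total 0 x with h | h
  · exact key x h (by rwa [abs_of_nonneg h] at hx)
  · rw [← profile_neg]
    exact key (-x) (by linarith) (by rwa [abs_of_nonpos h] at hx)

/-- At a height close to `k²` the distance to the lattice keeps the abscissa away from all integers,
in particular from `±k`. The point then lies well inside the polygon, and the interior of the
polygon belongs to every chart domain. -/
theorem ball_subset_of_near_level {δ : ℝ} (h0 : 0 < δ) (h1 : δ ≤ 1) {z : ℂ} (hz : z ∈ poly true)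
    (hd : ∀ l ∈ lat, δ ≤ dist z l) {k : ℤ} (hk : 0 ≤ k) (hy : |z.im - k ^ 2| < δ / 4) (n : ℤ) :
    Metric.ball z (δ / 8) ⊆ chartDomain n := by
  have hk' : (0 : ℝ) ≤ k := by exact_mod_cast hk
  have hx : ∀ j : ℤ, 3 * δ / 4 < |z.re - j| := by
    intro j
    have h2 := hd ⟨j, (k : ℝ) ^ 2⟩ ⟨⟨j, rfl⟩, k ^ 2, by simp⟩
    rw [dist_eq_norm] at h2
    have h3 := Complex.norm_le_abs_re_add_abs_im (z - ⟨j, (k : ℝ) ^ 2⟩)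
    simp only [Complex.sub_re, Complex.sub_im] at h3
    linarith
  rw [mem_poly_true] at hz
  obtain ⟨y1, y2⟩ := abs_lt.1 hy
  have b1 := (chord_le_profile k z.re).trans hz
  have b2 := (chord_le_profile (-k - 1) z.re).trans hz
  unfold chord at b1 b2
  push_cast at b2
  have c1 : z.re < k - 3 * δ / 4 := by
    rcases lt_abs.1 (hx k) with h | h
    · nlinarith
    · linarith
  have c2 : -k + 3 * δ / 4 < z.re := by
    rcases lt_abs.1 (hx (-k)) with h | h
    · push_cast at h; linarith
    · push_cast at h; nlinarith
  have hk1 : 1 ≤ k := by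
    have : (0 : ℝ) < k := by linarith
    exact_mod_cast this
  intro w hw
  rw [Metric.mem_ball, dist_eq_norm] at hw
  obtain ⟨r1, r2⟩ := abs_lt.1 ((Complex.abs_re_le_norm (w - z)).trans_lt hw)
  obtain ⟨i1, i2⟩ := abs_lt.1 ((Complex.abs_im_le_norm (w - z)).trans_lt hw)
  simp only [Complex.sub_re, Complex.sub_im] at r1 r2 i1 i2
  rw [mem_chartDomain]
  left
  have := profile_le_of_abs_le hk1 (x := w.re) (ε := 5 * δ / 8) (by linarith) (by linarith)
    (abs_le.2 ⟨by linarith, by linarith⟩)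
  linarith

/-- Away from the levels the ball stays in one band. Depending on the sign of the abscissa, it
avoids the left or the right edge, and the chart across the other edge contains it. -/
theorem ball_subset_of_far_level {δ : ℝ} (h0 : 0 < δ) (h1 : δ ≤ 1) {z : ℂ} (hz : z ∈ poly true) {k : ℤ}
    (hk : 0 ≤ k) (hl : k ^ 2 + δ / 4 ≤ z.im) (hu : z.im ≤ (k + 1) ^ 2 - δ / 4) :
    ∃ n, Metric.ball z (δ / 8) ⊆ chartDomain n := by
  have hσ : (0 : ℤ) = 0 ∨ (0 : ℤ) = 1 := Or.inl rfl
  have hk' : (0 : ℝ) ≤ k := by exact_mod_cast hk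
  have hg := gap_pos hσ hk
  rw [mem_poly_true] at hz
  have b1 := (chord_le_profile k z.re).trans hz
  have b2 := (chord_le_profile (-k - 1) z.re).trans hz
  unfold chord at b1 b2
  push_cast at b2
  have hw : ∀ w ∈ Metric.ball z (δ / 8), -(δ / 8) < w.re - z.re ∧ w.re - z.re < δ / 8 ∧
      -(δ / 8) < w.im - z.im ∧ w.im - z.im < δ / 8 := by
    intro w hw
    rw [Metric.mem_ball, dist_eq_norm] at hw
    obtain ⟨r1, r2⟩ := abs_lt.1 ((Complex.abs_re_le_norm (w - z)).trans_lt hw)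
    obtain ⟨i1, i2⟩ := abs_lt.1 ((Complex.abs_im_le_norm (w - z)).trans_lt hw)
    exact ⟨r1, r2, i1, i2⟩
  have hgap : gap 0 k = 2 * k + 1 := by simp [gap]
  have hs : ∀ w ∈ Metric.ball z (δ / 8), w ∈ openStrip 0 k := by
    intro w h
    obtain ⟨r1, r2, i1, i2⟩ := hw w h
    refine ⟨?_, ?_⟩ <;> simp only [ht, level] <;> push_cast <;> nlinarith
  have hle : ∀ w : ℂ, leftEnd 0 k (ht 0 w) = -(w.im + k * (k + 1)) / (2 * k + 1) := by
    intro w; simp [leftEnd, ht, hgap]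
  have hre : ∀ w : ℂ, rightEnd 0 k (ht 0 w) = (w.im + k * (k + 1)) / (2 * k + 1) := by
    intro w; simp [rightEnd, ht, hgap]
  have hg' : (0 : ℝ) < 2 * k + 1 := by linarith
  have hkδ : (k : ℝ) * δ ≤ k := by nlinarith
  have hkk : (k : ℝ) ≤ k * k := by
    rcases hk.eq_or_lt with h | h
    · simp [← h]
    · have : (1 : ℝ) ≤ k := by exact_mod_cast h
      nlinarith
  rcases le_total 0 z.re with hx | hx
  · refine ⟨k + 0, fun w h => mem_chartDomain_of_isOpen (isOpen_rightRegion 0 k)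
      (fun w hw => rightRegion_cases hσ hk hw.1 hw.2.1 hw.2.2) ⟨hs w h, ?_, ?_⟩⟩
    · obtain ⟨r1, r2, i1, i2⟩ := hw w h
      rw [hle, div_lt_iff₀ hg']
      nlinarith
    · obtain ⟨r1, r2, i1, i2⟩ := hw w h
      rw [hle, hgap, ← sub_lt_iff_lt_add, lt_div_iff₀ hg']
      nlinarith
  · refine ⟨-k - 1, fun w h => mem_chartDomain_of_isOpen (isOpen_leftRegion 0 k)
      (fun w hw => leftRegion_cases hσ hk hw.1 hw.2.1 hw.2.2) ⟨hs w h, ?_, ?_⟩⟩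
    · obtain ⟨r1, r2, i1, i2⟩ := hw w h
      rw [hre, hgap, sub_lt_iff_lt_add, div_lt_iff₀ hg']
      nlinarith
    · obtain ⟨r1, r2, i1, i2⟩ := hw w h
      rw [hre, lt_div_iff₀ hg']
      nlinarith

/-- The radius depends on the distance to the lattice only, and not on the height of the point; this
is what prevents a trajectory from ending at infinity in finite time. -/
theorem exists_ball_subset {δ : ℝ} (h0 : 0 < δ) (h1 : δ ≤ 1) {s : Bool} {z : ℂ} (hz : z ∈ poly s)
    (hd : ∀ l ∈ lat, δ ≤ dist z l) : ∃ n, Metric.ball (z + shift n s) (δ / 8) ⊆ chartDomain n := by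
  have hσ : (0 : ℤ) = 0 ∨ (0 : ℤ) = 1 := Or.inl rfl
  have key : ∀ z ∈ poly true, (∀ l ∈ lat, δ ≤ dist z l) → ∃ n, Metric.ball z (δ / 8) ⊆ chartDomain n := by
    intro z hz hd
    have h2 := ht_nonneg hσ hz
    rw [sgn_true, one_mul] at h2
    obtain ⟨k, hk, h3, h4⟩ := exists_level hσ h2
    simp only [ht, level, Int.cast_zero, zero_mul, sub_zero, add_zero, Int.cast_add, Int.cast_one] at h3 h4
    rcases lt_or_ge (z.im - k ^ 2) (δ / 4) with h5 | h5
    · exact ⟨0, ball_subset_of_near_level h0 h1 hz hd hk (abs_lt.2 ⟨by linarith, h5⟩) 0⟩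
    rcases lt_or_ge ((k + 1) ^ 2 - z.im) (δ / 4) with h6 | h6
    · exact ⟨0, ball_subset_of_near_level h0 h1 hz hd (by omega : 0 ≤ k + 1)
        (abs_lt.2 ⟨by push_cast; linarith, by push_cast; linarith⟩) 0⟩
    · exact ball_subset_of_far_level h0 h1 hz hk (by linarith) (by linarith)
  cases s
  · obtain ⟨n, hn⟩ := key (-z) hz fun l hl => by
      rw [← dist_neg_neg, neg_neg]; exact hd _ (lat.neg_mem hl)
    refine ⟨n, fun w hw => offset_sub_mem_chartDomain.1 (hn ?_)⟩
    rw [Metric.mem_ball, dist_eq_norm] at *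
    have e : offset n - w - -z = -(w - (z + shift n false)) := by rw [shift_false]; ring
    rw [e, norm_neg]; exact hw
  · obtain ⟨n, hn⟩ := key z hz hd
    exact ⟨n, by simpa using hn⟩

/-- The points whose line in the direction `u` misses the lattice. -/
def generic (u : ℂ) : Set S1 := {x | ∀ t : ℝ, cls x + (((t : ℂ) * u : ℂ) : ℂ ⧸ lat) ≠ 0}

theorem generic_not_mem_singularities {u : ℂ} {x : S1} (hx : x ∈ generic u) : x ∉ singularities := by
  intro h
  have := hx 0
  simp [cls_eq_zero_of_mem_singularities h] at this

theorem pt_mem_generic {u : ℂ} {s : Bool} {z : ℂ} (hz : z ∈ poly s) :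
    pt s z ∈ generic u ↔ ∀ t : ℝ, z + (t : ℂ) * u ∉ lat := by
  unfold generic
  rw [mem_ofPred_eq, cls_pt hz]
  refine forall_congr' fun t => ?_
  rw [← QuotientAddGroup.mk_add, Ne, QuotientAddGroup.eq_zero_iff]

theorem IsStraight.mem_generic {u : ℂ} {J : Set ℝ} {γ : ℝ → S1} (hJ : J.OrdConnected)
    (h : IsStraight u J γ) {t₀ t : ℝ} (h0 : t₀ ∈ J) (ht : t ∈ J) (hx : γ t₀ ∈ generic u) :
    γ t ∈ generic u := by
  intro r
  rw [h.cls_eq hJ h0 ht, add_assoc, ← QuotientAddGroup.mk_add]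
  have := hx (t - t₀ + r)
  convert this using 3
  push_cast; ring

/-- The domain is open and also closed: near a limit time the lifted line keeps a distance to the
lattice, so a chart ball of uniform radius continues the trajectory past that time. -/
theorem IsTrajectory.eq_univ_of_generic {u : ℂ} (hu : ‖u‖ = 1) {J : Set ℝ} {γ : ℝ → S1}
    (h : IsTrajectory u J γ) {t₀ : ℝ} (h0 : t₀ ∈ J) (hx : γ t₀ ∈ generic u) : J = univ := by
  refine IsClopen.eq_univ ⟨isClosed_of_closure_subset fun r hr => ?_, h.isOpen⟩ h.nonempty
  obtain ⟨s₀, z₀, hz₀, e₀⟩ := exists_pt (γ t₀)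
  rw [e₀, pt_mem_generic hz₀] at hx
  have hc : Continuous fun t : ℝ => Metric.infDist (z₀ + ((t - t₀ : ℝ) : ℂ) * u) lat :=
    (Metric.continuous_infDist_pt _).comp (by fun_prop)
  have hpos : ∀ t : ℝ, 0 < Metric.infDist (z₀ + ((t - t₀ : ℝ) : ℂ) * u) lat := fun t =>
    (isClosed_lat.notMem_iff_infDist_pos ⟨0, lat.zero_mem⟩).1 (hx _)
  have hev := (hc.tendsto r).eventually (lt_mem_nhds (half_lt_self (hpos r)))
  -- Half of the distance at `r` remains a lower bound at nearby times.
  set δ := min 1 (Metric.infDist (z₀ + ((r - t₀ : ℝ) : ℂ) * u) lat / 2) with hδ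
  have hδ0 : 0 < δ := lt_min one_pos (half_pos (hpos r))
  have hball : ∀ᶠ t in 𝓝 r, dist r t < δ / 8 := by
    have := Metric.ball_mem_nhds r (by linarith : 0 < δ / 8)
    filter_upwards [this] with t ht
    rwa [dist_comm]
  obtain ⟨t, htJ, ht, hd⟩ := ((mem_closure_iff_frequently.1 hr).and_eventually (hev.and hball)).exists
  obtain ⟨s, z, hz, e⟩ := exists_pt (γ t)
  have hcls : (z : ℂ ⧸ lat) = ((z₀ + ((t - t₀ : ℝ) : ℂ) * u : ℂ) : ℂ ⧸ lat) := by
    rw [← cls_pt hz, ← e, h.straight.cls_eq h.ordConnected h0 htJ, e₀, cls_pt hz₀, QuotientAddGroup.mk_add]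
  obtain ⟨n, hn⟩ := exists_ball_subset hδ0 (min_le_left _ _) hz fun l hl => by
    refine le_trans ?_ (Metric.infDist_le_dist_of_mem hl)
    rw [infDist_lat_eq hcls]
    exact (min_le_right _ _).trans ht.le
  have hm : ∀ τ ∈ Metric.ball t (δ / 8), z + shift n s + ((τ - t : ℝ) : ℂ) * u ∈ chartDomain n := by
    intro τ hτ
    refine hn ?_
    rw [Metric.mem_ball, dist_eq_norm] at *
    rwa [add_sub_cancel_left, norm_mul, hu, mul_one, Complex.norm_real]
  have hs : IsStraight u (Metric.ball t (δ / 8)) (fun τ => chart n (z + shift n s + ((τ - t : ℝ) : ℂ) * u)) := by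
    rw [isStraight_iff]
    intro τ hτ
    refine straightAt_of_germ (germ_chart (hm τ hτ)) (Eventually.of_forall fun τ' => ?_)
    congr 1; push_cast; ring
  refine (h.extends Metric.isOpen_ball (Real.ball_eq_Ioo t _ ▸ ordConnected_Ioo) hs htJ
    (Metric.mem_ball_self (by linarith)) ?_).1 hd
  rw [e, ← chart_add_shift (n := n) hz]; simp

theorem exists_straight_of_generic {u : ℂ} (hu : ‖u‖ = 1) {x : S1} (hx : x ∈ generic u) :
    ∃ γ, IsTrajectory u univ γ ∧ γ 0 = x := by
  obtain ⟨J, γ, h, h0, rfl⟩ := exists_trajectory u (generic_not_mem_singularities hx)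
  obtain rfl := h.eq_univ_of_generic hu h0 hx
  exact ⟨γ, h, rfl⟩

end

section

/-! ### The area measure -/

/-- The determinant with a fixed vector, as a linear form. -/
def crossLM (v : ℂ) : ℂ →ₗ[ℝ] ℝ where
  toFun := cross v
  map_add' z w := by simp [cross]; ring
  map_smul' r z := by simp [cross]; ring

theorem volume_cross_eq {v : ℂ} (hv : v ≠ 0) (c : ℝ) : volume {z : ℂ | cross v z = c} = 0 := by
  rcases eq_empty_or_nonempty {z : ℂ | cross v z = c} with h | ⟨z₀, h₀⟩
  · rw [h, measure_empty]
  · have e : {z : ℂ | cross v z = c} = (AffineSubspace.mk' z₀ (LinearMap.ker (crossLM v)) : Set ℂ) := by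
      ext z
      rw [SetLike.mem_coe, AffineSubspace.mem_mk', LinearMap.mem_ker, vsub_eq_sub, map_sub, sub_eq_zero]
      change _ ↔ cross v z = cross v z₀
      rw [show cross v z₀ = c from h₀]; rfl
    rw [e]
    refine Measure.addHaar_affineSubspace _ _ fun h => ?_
    have h1 : z₀ + Complex.I * v ∈ AffineSubspace.mk' z₀ (LinearMap.ker (crossLM v)) := by
      rw [h]; exact AffineSubspace.mem_top _ _ _
    rw [AffineSubspace.mem_mk', LinearMap.mem_ker, vsub_eq_sub, add_sub_cancel_left] at h1
    have h2 : cross v (Complex.I * v) = Complex.normSq v := by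
      simp [cross, Complex.normSq_apply]
    have h3 : cross v (Complex.I * v) = 0 := h1
    rw [h2, Complex.normSq_eq_zero] at h3
    exact hv h3

theorem volume_edge (n : ℤ) : volume (edge n) = 0 := by
  have hv : (⟨1, 2 * n + 1⟩ : ℂ) ≠ 0 := fun h => by simpa using congrArg Complex.re h
  refine measure_mono_null (fun z hz => ?_) (volume_cross_eq hv (-(n * (n + 1))))
  rw [mem_edge] at hz
  rw [mem_ofPred_eq, cross, hz.2.2, chord]
  ring

/-- The trace of a set on a polygon. -/
def tr (s : Bool) (S : Set S1) : Set ℂ := {z | z ∈ poly s ∧ pt s z ∈ S}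

theorem tr_eq (s : Bool) (S : Set S1) : tr s S = (↑) '' (point s ⁻¹' S) := by
  ext z
  constructor
  · rintro ⟨h, h'⟩
    rw [pt_of_mem h] at h'
    exact ⟨⟨z, h⟩, h', rfl⟩
  · rintro ⟨z, h, rfl⟩
    refine ⟨z.2, ?_⟩
    rw [pt_of_mem z.2]; exact h

theorem measurableSet_poly (s : Bool) : MeasurableSet (poly s) := (isClosed_poly s).measurableSet

theorem measurableSet_iff {S : Set S1} : MeasurableSet S ↔ ∀ s, MeasurableSet (tr s S) := by
  constructor
  · intro h s
    rw [tr_eq]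
    exact (MeasurableEmbedding.subtype_coe (measurableSet_poly s)).measurableSet_image.2
      (measurable_point s h)
  · intro h
    change MeasurableSet (Quot.mk Glue ⁻¹' S)
    refine MeasurableSpace.measurableSet_iInf.2 fun s => ?_
    have := h s
    rw [tr_eq] at this
    exact (MeasurableEmbedding.subtype_coe (measurableSet_poly s)).measurableSet_image.1 this

theorem area_eq {S : Set S1} (hS : MeasurableSet S) :
    area S = volume (tr true S) + volume (tr false S) := by
  rw [area, Measure.sum_apply _ hS, tsum_fintype, Fintype.sum_bool]
  have key : ∀ s, Measure.map (point s) (Measure.comap ((↑) : poly s → ℂ) volume) S =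
      volume (tr s S) := by
    intro s
    rw [Measure.map_apply (measurable_point s) hS, tr_eq,
      (MeasurableEmbedding.subtype_coe (measurableSet_poly s)).comap_apply]
  rw [key, key]

theorem tr_image_chart {n : ℤ} {E : Set ℂ} (hE : E ⊆ chartDomain n) (s : Bool) :
    tr s (chart n '' E) = {z | z ∈ poly s ∧ z + shift n s ∈ E} := by
  ext z
  constructor
  · rintro ⟨h, w, hw, e⟩
    exact ⟨h, eq_of_chart_eq_pt (hE hw) h e ▸ hw⟩
  · rintro ⟨h, h'⟩
    exact ⟨h, _, h', chart_add_shift h⟩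

theorem measurableSet_image_chart {n : ℤ} {E : Set ℂ} (hE : E ⊆ chartDomain n) (hm : MeasurableSet E) :
    MeasurableSet (chart n '' E) := by
  refine measurableSet_iff.2 fun s => ?_
  rw [tr_image_chart hE]
  exact (measurableSet_poly s).inter ((measurable_add_const _) hm)

theorem volume_tr_image_chart {n : ℤ} {E : Set ℂ} (hE : E ⊆ chartDomain n) (s : Bool) :
    volume (tr s (chart n '' E)) = volume (E ∩ {z | z - shift n s ∈ poly s}) := by
  rw [tr_image_chart hE,
    ← measure_preimage_add_right volume (shift n s) (E ∩ {z | z - shift n s ∈ poly s})]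
  congr 1
  ext z
  simp [and_comm]

/-- A chart domain is covered by translates of the two polygons that overlap in an edge, which is a
null set. -/
theorem area_image_chart {n : ℤ} {E : Set ℂ} (hE : E ⊆ chartDomain n) (hm : MeasurableSet E) :
    area (chart n '' E) = volume E := by
  have hp : ∀ s, MeasurableSet {z | z - shift n s ∈ poly s} := fun s =>
    (measurable_sub_const _) (measurableSet_poly s)
  rw [area_eq (measurableSet_image_chart hE hm), volume_tr_image_chart hE, volume_tr_image_chart hE]
  have hU : E = E ∩ {z | z - shift n true ∈ poly true} ∪ E ∩ {z | z - shift n false ∈ poly false} := by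
    rw [← inter_union_distrib_left, eq_comm, inter_eq_left]
    intro z hz
    obtain ⟨s, hs⟩ := exists_shift (hE hz)
    cases s
    · exact Or.inr hs
    · exact Or.inl hs
  have hd : AEDisjoint volume (E ∩ {z | z - shift n true ∈ poly true})
      (E ∩ {z | z - shift n false ∈ poly false}) := by
    refine measure_mono_null ?_ (volume_edge n)
    rintro z ⟨⟨-, h1⟩, -, h2⟩
    exact mem_edge_of_mem_of_mem (by simpa using h1) h2
  conv_rhs => rw [hU]
  rw [measure_union₀ (hm.inter (hp false)).nullMeasurableSet hd]

/-- The determinant of `L` is `cross (L 1) (L i)`. -/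
theorem volume_image_of_cross {L : ℂ ≃L[ℝ] ℂ} (h : ∀ z w, cross (L z) (L w) = cross z w) (E : Set ℂ) :
    volume (L '' E) = volume E := by
  rw [Measure.addHaar_image_continuousLinearEquiv]
  have hd : LinearMap.det ((L : ℂ →L[ℝ] ℂ) : ℂ →ₗ[ℝ] ℂ) = 1 := by
    rw [← LinearMap.det_toMatrix Complex.basisOneI, Matrix.det_fin_two]
    have := h 1 Complex.I
    simp only [cross, Complex.one_re, Complex.one_im, Complex.I_im, Complex.I_re] at this
    simp [LinearMap.toMatrix_apply]
    linarith
  have e : LinearMap.det (L : ℂ →ₗ[ℝ] ℂ) = 1 := hd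
  rw [e]; simp

end

section

/-! ### Locally affine maps -/

/-- The set is cut into countably many disjoint pieces, one in each member of the cover. An
inequality suffices, since for the flow it is applied to the inverse map as well. -/
theorem image_measure_le_of_cover {α β : Type*} [MeasurableSpace α] [MeasurableSpace β] {μ : Measure α}
    {ν : Measure β} {ψ : α → β} {𝒞 : Set (Set α)} (hc : 𝒞.Countable) (hm : ∀ C ∈ 𝒞, MeasurableSet C)
    {X : Set α} (h : ∀ C ∈ 𝒞, ∀ S ⊆ C ∩ X, MeasurableSet S → MeasurableSet (ψ '' S) ∧ ν (ψ '' S) ≤ μ S)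
    (hX : X ⊆ ⋃₀ 𝒞) {S : Set α} (hSX : S ⊆ X) (hS : MeasurableSet S) :
    MeasurableSet (ψ '' S) ∧ ν (ψ '' S) ≤ μ S := by
  rcases S.eq_empty_or_nonempty with rfl | ⟨x, hx⟩
  · simp
  obtain ⟨C₀, hC₀, -⟩ := hX (hSX hx)
  obtain ⟨C, rfl⟩ := hc.exists_eq_range ⟨C₀, hC₀⟩
  have hC : ∀ i, MeasurableSet (C i) := fun i => hm _ (mem_range_self i)
  let D : ℕ → Set α := fun i => S ∩ disjointed C i
  have hD : ∀ i, MeasurableSet (D i) := fun i => hS.inter (MeasurableSet.disjointed hC i)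
  have hSD : S = ⋃ i, D i := by
    rw [← inter_iUnion, iUnion_disjointed, ← sUnion_range, inter_eq_self_of_subset_left (hSX.trans hX)]
  have hi : ∀ i, MeasurableSet (ψ '' D i) ∧ ν (ψ '' D i) ≤ μ (D i) := fun i =>
    h _ (mem_range_self i) _ (fun y hy => ⟨disjointed_subset C i hy.2, hSX hy.1⟩) (hD i)
  have hI : ψ '' S = ⋃ i, ψ '' D i := by rw [← image_iUnion, ← hSD]
  refine ⟨hI ▸ MeasurableSet.iUnion fun i => (hi i).1, ?_⟩
  rw [hI]
  refine (measure_iUnion_le _).trans ((ENNReal.tsum_le_tsum fun i => (hi i).2).trans (le_of_eq ?_))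
  conv_rhs => rw [hSD]
  rw [measure_iUnion (fun i j hij => ?_) hD]
  exact ((disjoint_disjointed C) hij).mono inter_subset_right inter_subset_right

/-- On the set `X`, the map `ψ` is locally affine with linear part `L`. -/
def LocallyAffineOn (L : ℂ ≃L[ℝ] ℂ) (X : Set S1) (ψ : S1 → S1) : Prop :=
  ∀ x ∈ X, ∃ f g z z', Germ f z ∧ f z = x ∧ Germ g z' ∧
    ∀ᶠ w in 𝓝 0, f (z + w) ∈ X → ψ (f (z + w)) = g (z' + L w)

theorem LocallyAffineOn.exists_chart {L : ℂ ≃L[ℝ] ℂ} {X : Set S1} {ψ : S1 → S1}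
    (h : LocallyAffineOn L X ψ) {n : ℤ} {a : ℂ} (ha : a ∈ chartDomain n) (hx : chart n a ∈ X) :
    ∃ m b, ∀ᶠ w in 𝓝 a, w ∈ chartDomain n ∧ b + L (w - a) ∈ chartDomain m ∧
      (chart n w ∈ X → ψ (chart n w) = chart m (b + L (w - a))) := by
  obtain ⟨f, g, z, z', hf, e, ⟨m, b, hb, hg⟩, hw⟩ := h _ hx
  have h1 := (germ_chart ha).eventuallyEq hf e.symm
  have t1 : Tendsto (fun w => w - a) (𝓝 a) (𝓝 0) := by
    have h : Continuous fun w : ℂ => w - a := by fun_prop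
    simpa using h.tendsto a
  have t2 : Tendsto (fun w => z' + L (w - a)) (𝓝 a) (𝓝 z') := tendsto_clm_sub L z' a
  have t3 : Tendsto (fun w => b + L (w - a)) (𝓝 a) (𝓝 b) := tendsto_clm_sub L b a
  refine ⟨m, b, ?_⟩
  filter_upwards [(isOpen_chartDomain n).mem_nhds ha, t3.eventually ((isOpen_chartDomain m).mem_nhds hb),
    h1, t1.eventually hw, t2.eventually hg] with w h2 h3 h4 h5 h6
  refine ⟨h2, h3, fun h7 => ?_⟩
  rw [h4] at h7 ⊢
  rw [h5 h7, h6, add_sub_cancel_left]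

/-- By the Lindelöf property countably many open sets in the charts suffice. On each of them the map
is, in charts, `L` between two translations, and this preserves measurability and area. -/
theorem LocallyAffineOn.measure_image_le {L : ℂ ≃L[ℝ] ℂ} (hL : ∀ z w, cross (L z) (L w) = cross z w)
    {X : Set S1} {ψ : S1 → S1} (hX : ∀ x ∈ X, x ∉ singularities) (h : LocallyAffineOn L X ψ) {S : Set S1}
    (hS : MeasurableSet S) (hSX : S ⊆ X) : MeasurableSet (ψ '' S) ∧ area (ψ '' S) ≤ area S := by
  let P : ℤ → Set ℂ → Prop := fun n U => ∃ m b a, ∀ w ∈ U, w ∈ chartDomain n ∧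
    b + L (w - a) ∈ chartDomain m ∧ (chart n w ∈ X → ψ (chart n w) = chart m (b + L (w - a)))
  have hcov : ∀ n : ℤ, ∃ T : Set (Set ℂ), T.Countable ∧ (∀ U ∈ T, IsOpen U ∧ P n U) ∧
      ∀ a ∈ chartDomain n, chart n a ∈ X → a ∈ ⋃₀ T := by
    intro n
    obtain ⟨T, hT, hTc, hTU⟩ := TopologicalSpace.isOpen_sUnion_countable {U | IsOpen U ∧ P n U}
      (fun U hU => hU.1)
    refine ⟨T, hT, fun U hU => hTc hU, fun a ha hx => ?_⟩
    rw [hTU]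
    obtain ⟨m, b, hw⟩ := h.exists_chart ha hx
    obtain ⟨U, hU, hUo, haU⟩ := eventually_nhds_iff.1 hw
    exact ⟨U, ⟨hUo, m, b, a, hU⟩, haU⟩
  choose T hTc hT hTX using hcov
  refine image_measure_le_of_cover (𝒞 := ⋃ n, (fun U => chart n '' U) '' T n)
    (countable_iUnion fun n => (hTc n).image _) ?_ (X := X) ?_ ?_ hSX hS
  · rintro C hC
    obtain ⟨n, U, hU, rfl⟩ := mem_iUnion.1 hC
    obtain ⟨hUo, m, b, a, hP⟩ := hT n U hU
    exact measurableSet_image_chart (fun w hw => (hP w hw).1) hUo.measurableSet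
  · rintro C hC S hSC hS
    obtain ⟨n, U, hU, rfl⟩ := mem_iUnion.1 hC
    obtain ⟨hUo, m, b, a, hP⟩ := hT n U hU
    let E : Set ℂ := {w | w ∈ U ∧ chart n w ∈ S}
    have hSE : S = chart n '' E := by
      ext x
      constructor
      · intro hx
        obtain ⟨w, hw, rfl⟩ := (hSC hx).1
        exact ⟨w, ⟨hw, hx⟩, rfl⟩
      · rintro ⟨w, hw, rfl⟩
        exact hw.2
    have hEn : E ⊆ chartDomain n := fun w hw => (hP w hw.1).1
    have hE : MeasurableSet E := by
      have e : E = ⋃ s, U ∩ {w | w - shift n s ∈ tr s S} := by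
        ext w
        rw [mem_iUnion]
        constructor
        · rintro ⟨h1, h2⟩
          obtain ⟨s, hs⟩ := exists_shift (hP w h1).1
          exact ⟨s, h1, hs, by rwa [chart_of_mem hs] at h2⟩
        · rintro ⟨s, h1, hs, h2⟩
          exact ⟨h1, by rwa [chart_of_mem hs]⟩
      rw [e]
      exact MeasurableSet.iUnion fun s => hUo.measurableSet.inter
        ((measurable_sub_const _) (measurableSet_iff.1 hS s))
    let E' : Set ℂ := (fun w => b + L (w - a)) '' E
    have hE' : E' = (fun w => b + w) '' (L '' ((fun w => w - a) '' E)) := by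
      simp only [E', image_image]
    have hEm : E' ⊆ chartDomain m := by
      rintro _ ⟨w, hw, rfl⟩
      exact (hP w hw.1).2.1
    have hEmeas : MeasurableSet E' := by
      rw [hE']
      refine (Homeomorph.addLeft b).measurableEmbedding.measurableSet_image.2 ?_
      refine L.toHomeomorph.measurableEmbedding.measurableSet_image.2 ?_
      exact (Homeomorph.subRight a).measurableEmbedding.measurableSet_image.2 hE
    have hvol : volume E' = volume E := by
      rw [hE', image_add_left, measure_preimage_add, volume_image_of_cross hL]
      simp only [sub_eq_add_neg]
      rw [image_add_right, measure_preimage_add_right]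
    have hψ : ψ '' S = chart m '' E' := by
      conv_lhs => rw [hSE]
      rw [image_image, image_image]
      refine image_congr fun w hw => (hP w hw.1).2.2 (hSC hw.2).2
    rw [hψ]
    refine ⟨measurableSet_image_chart hEm hEmeas, ?_⟩
    rw [area_image_chart hEm hEmeas, hvol, ← area_image_chart hEn hE, ← hSE]
  · intro x hx
    obtain ⟨n, a, ha, rfl⟩ := ParabolaSurface.exists_chart (hX x hx)
    obtain ⟨U, hU, haU⟩ := hTX n a ha hx
    exact ⟨_, mem_iUnion.2 ⟨n, U, hU, rfl⟩, a, haU, rfl⟩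

theorem AffineAut.locallyAffineOn {L : ℂ ≃L[ℝ] ℂ} {φ : S1 ≃ₜ S1} (h : AffineAut L φ) :
    LocallyAffineOn L singularitiesᶜ φ := by
  intro x hx
  obtain ⟨f, hf, e⟩ := exists_germ hx 0
  refine ⟨f, fun w => φ (f (L.symm w)), 0, 0, hf, e, ?_, Eventually.of_forall fun w _ => ?_⟩
  · have := h.germ f 0 hf
    rw [map_zero] at this
    exact this
  · simp

theorem countable_vertices : {z : ℂ | IsVertex z}.Countable := by
  refine ((countable_range vertex).union ((countable_range vertex).image fun z => -z)).mono ?_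
  rintro z (h | h)
  · exact Or.inl h
  · exact Or.inr ⟨-z, h, neg_neg z⟩

theorem tr_subset_vertices {S : Set S1} (hS : S ⊆ singularities) (s : Bool) :
    tr s S ⊆ {z | IsVertex z} := fun _ hz => (pt_mem_singularities hz.1).1 (hS hz.2)

theorem measurableSet_of_subset_singularities {S : Set S1} (hS : S ⊆ singularities) : MeasurableSet S :=
  measurableSet_iff.2 fun s => (countable_vertices.mono (tr_subset_vertices hS s)).measurableSet

theorem area_singularities : area singularities = 0 := by
  rw [area_eq (measurableSet_of_subset_singularities subset_rfl)]
  have : ∀ s, volume (tr s singularities) = 0 := fun s =>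
    (countable_vertices.mono (tr_subset_vertices subset_rfl s)).measure_zero _
  rw [this, this, add_zero]

/-- Charts see nonsingular points only; the singularities are treated apart, as a null set all of
whose subsets are measurable. -/
theorem AffineAut.measurable_image {L : ℂ ≃L[ℝ] ℂ} {φ : S1 ≃ₜ S1} (h : AffineAut L φ) {S : Set S1}
    (hS : MeasurableSet S) : MeasurableSet (φ '' S) ∧ area (φ '' S) ≤ area S := by
  have hm := measurableSet_of_subset_singularities subset_rfl
  obtain ⟨h1, h2⟩ := h.locallyAffineOn.measure_image_le h.cross_map (fun _ hx => hx)
    (hS.inter hm.compl) inter_subset_right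
  have h3 : φ '' (S ∩ singularities) ⊆ singularities := by
    rintro _ ⟨x, hx, rfl⟩
    exact (h.sing x).2 hx.2
  rw [← inter_union_compl S singularities, image_union]
  refine ⟨(measurableSet_of_subset_singularities h3).union h1, ?_⟩
  refine (measure_union_le _ _).trans ?_
  rw [measure_mono_null h3 area_singularities, zero_add]
  exact h2.trans (measure_mono subset_union_right)

/-! ### Generic points have full measure -/

/-- A point is not generic exactly when it lies on one of the countably many lines through lattice
points in the direction `u`. -/
theorem tr_generic (u : ℂ) (hu : u ≠ 0) (s : Bool) :
    tr s (generic u) = poly s \ ⋃ l ∈ (lat : Set ℂ), {z | cross u z = cross u l} := by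
  ext z
  have key : ∀ t : ℝ, cross u ((t : ℂ) * u) = 0 := fun t => by simp [cross]; ring
  have hadd : ∀ a b : ℂ, cross u (a + b) = cross u a + cross u b := (crossLM u).map_add
  constructor
  · rintro ⟨h1, h2⟩
    refine ⟨h1, fun h => ?_⟩
    simp only [mem_iUnion, mem_ofPred_eq] at h
    obtain ⟨l, hl, h⟩ := h
    rw [pt_mem_generic h1] at h2
    have hn := Complex.normSq_pos.2 hu
    -- The coordinate along `u` of the vector `l - z`, which is parallel to `u`.
    let t : ℝ := (u.re * (l - z).re + u.im * (l - z).im) / Complex.normSq u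
    refine h2 t ?_
    have e : z + (t : ℂ) * u = l := by
      have h3 : cross u (l - z) = 0 := by
        have := hadd (l - z) z
        rw [sub_add_cancel, ← h] at this
        linarith
      have h4 : (t : ℂ) * u = l - z := by
        unfold cross at h3
        rw [Complex.normSq_apply] at hn
        apply Complex.ext <;> simp only [Complex.re_ofReal_mul, Complex.im_ofReal_mul, t, Complex.normSq_apply]
        · rw [div_mul_eq_mul_div, div_eq_iff hn.ne']
          linear_combination u.im * h3
        · rw [div_mul_eq_mul_div, div_eq_iff hn.ne']
          linear_combination -u.re * h3
      rw [h4]; ring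
    rw [e]; exact hl
  · rintro ⟨h1, h2⟩
    refine ⟨h1, (pt_mem_generic h1).2 fun t ht => h2 ?_⟩
    refine mem_iUnion₂.2 ⟨_, ht, ?_⟩
    rw [mem_ofPred_eq, hadd, key, add_zero]

theorem measurableSet_cross_eq (u : ℂ) (c : ℝ) : MeasurableSet {z : ℂ | cross u z = c} := by
  have : Continuous (cross u) := by unfold cross; fun_prop
  exact (isClosed_eq this continuous_const).measurableSet

theorem measurableSet_generic {u : ℂ} (hu : u ≠ 0) : MeasurableSet (generic u) := by
  refine measurableSet_iff.2 fun s => ?_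
  rw [tr_generic u hu]
  exact (measurableSet_poly s).diff
    (MeasurableSet.biUnion countable_lat fun l _ => measurableSet_cross_eq u _)

theorem area_compl_generic {u : ℂ} (hu : u ≠ 0) : area (generic u)ᶜ = 0 := by
  rw [area_eq (measurableSet_generic hu).compl]
  have : ∀ s, volume (tr s (generic u)ᶜ) = 0 := by
    intro s
    refine measure_mono_null (t := ⋃ l ∈ (lat : Set ℂ), {z | cross u z = cross u l}) ?_
      ((measure_biUnion_null_iff countable_lat).2 fun l _ => volume_cross_eq hu _)
    intro z hz
    by_contra h
    have h1 : z ∈ tr s (generic u) := by rw [tr_generic u hu]; exact ⟨hz.1, h⟩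
    exact hz.2 h1.2
  rw [this, this, add_zero]

end

section

/-! ### The flow on the generic points -/

open Classical in
/-- The geodesic flow in the direction `u`, on the generic points. -/
def flow (u : ℂ) (t : ℝ) (x : S1) : S1 :=
  if h : x ∈ generic u ∧ ∃ γ, IsTrajectory u univ γ ∧ γ 0 = x then h.2.choose t else x

theorem flow_of_not_mem {u : ℂ} {t : ℝ} {x : S1} (hx : x ∉ generic u) : flow u t x = x :=
  dif_neg fun h => hx h.1

section

variable {u : ℂ}

theorem isTrajectory_flow (hu : ‖u‖ = 1) {x : S1} (hx : x ∈ generic u) : IsTrajectory u univ (fun t => flow u t x) := by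
  have h : x ∈ generic u ∧ ∃ γ, IsTrajectory u univ γ ∧ γ 0 = x := ⟨hx, exists_straight_of_generic hu hx⟩
  have e : (fun t => flow u t x) = h.2.choose := by
    funext t; exact dif_pos h
  rw [e]
  exact h.2.choose_spec.1

theorem flow_zero (hu : ‖u‖ = 1) {x : S1} : flow u 0 x = x := by
  by_cases hx : x ∈ generic u
  · have h : x ∈ generic u ∧ ∃ γ, IsTrajectory u univ γ ∧ γ 0 = x := ⟨hx, exists_straight_of_generic hu hx⟩
    have e : flow u 0 x = h.2.choose 0 := dif_pos h
    rw [e]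
    exact h.2.choose_spec.2
  · exact flow_of_not_mem hx

theorem flow_mem_generic (hu : ‖u‖ = 1) {x : S1} (hx : x ∈ generic u) (t : ℝ) : flow u t x ∈ generic u :=
  (isTrajectory_flow hu hx).straight.mem_generic ordConnected_univ (mem_univ 0) (mem_univ t)
    (by simpa only [flow_zero hu] using hx)

theorem flow_flow (hu : ‖u‖ = 1) (s t : ℝ) (x : S1) : flow u s (flow u t x) = flow u (s + t) x := by
  by_cases hx : x ∈ generic u
  · have h1 := (isTrajectory_flow hu (flow_mem_generic hu hx t)).straight
    have h2 := (isTrajectory_flow hu hx).straight.comp_add t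
    have e : {r : ℝ | r + t ∈ univ} = univ := by simp
    rw [e] at h2
    exact h1.eqOn ordConnected_univ h2 (mem_univ 0) (by simp only [flow_zero hu, zero_add]) (mem_univ s)
  · rw [flow_of_not_mem hx, flow_of_not_mem hx, flow_of_not_mem hx]

theorem isStraight_chart {v a : ℂ} {n : ℤ} {J : Set ℝ} {t : ℝ}
    (h : ∀ τ ∈ J, a + ((τ - t : ℝ) : ℂ) * v ∈ chartDomain n) :
    IsStraight v J (fun τ => chart n (a + ((τ - t : ℝ) : ℂ) * v)) := by
  rw [isStraight_iff]
  intro τ hτ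
  refine straightAt_of_germ (germ_chart (h τ hτ)) (Eventually.of_forall fun τ' => ?_)
  congr 1; push_cast; ring

/-- The property that the time `t` map is a translation near `x` is locally constant in `t`, because
during a short time all neighbouring orbits stay in one chart. It holds at `t = 0`, hence always. -/
theorem locallyAffineOn_flow (hu : ‖u‖ = 1) (t : ℝ) :
    LocallyAffineOn (ContinuousLinearEquiv.refl ℝ ℂ) (generic u) (flow u t) := by
  intro x hx
  obtain ⟨f, hf, e⟩ := exists_germ (generic_not_mem_singularities hx) 0
  let P : ℝ → Prop := fun t => ∃ g z', Germ g z' ∧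
    ∀ᶠ w in 𝓝 0, f (0 + w) ∈ generic u → flow u t (f (0 + w)) = g (z' + w)
  have hP0 : P 0 := ⟨f, 0, hf, Eventually.of_forall fun w _ => flow_zero hu⟩
  have hloc : ∀ t ∈ (univ : Set ℝ), ∀ᶠ t' in 𝓝 t, P t' = P t := by
    intro t _
    obtain ⟨n, a, ha, h1⟩ := exists_chart (generic_not_mem_singularities (flow_mem_generic hu hx t))
    obtain ⟨r, hr, hball⟩ := Metric.isOpen_iff.1 (isOpen_chartDomain n) a ha
    -- One third of the radius is allotted to the displacement of the point and one third to the
    -- passage of time.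
    have hm : ∀ (w : ℂ) (τ : ℝ), ‖w‖ < r / 3 → τ ∈ Metric.ball t (r / 3) →
        a + w + ((τ - t : ℝ) : ℂ) * u ∈ chartDomain n := by
      intro w τ hw hτ
      refine hball ?_
      rw [Metric.mem_ball, dist_eq_norm] at *
      rw [add_assoc, add_sub_cancel_left]
      refine (norm_add_le _ _).trans_lt ?_
      rw [norm_mul, hu, mul_one, Complex.norm_real]
      linarith
    have hI : (Metric.ball t (r / 3)).OrdConnected := Real.ball_eq_Ioo t _ ▸ ordConnected_Ioo
    have key : ∀ (w : ℂ), ‖w‖ < r / 3 → ∀ y ∈ generic u, ∀ t₁ ∈ Metric.ball t (r / 3),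
        flow u t₁ y = chart n (a + w + ((t₁ - t : ℝ) : ℂ) * u) → ∀ t₂ ∈ Metric.ball t (r / 3),
        flow u t₂ y = chart n (a + w + ((t₂ - t : ℝ) : ℂ) * u) := by
      intro w hw y hy t₁ h₁ e t₂ h₂
      exact IsStraight.eqOn hI ((isTrajectory_flow hu hy).straight.mono (subset_univ _))
        (isStraight_chart fun τ hτ => hm w τ hw hτ) h₁ e h₂
    have hr3 : 0 < r / 3 := by linarith
    have hx' : ∀ t' ∈ Metric.ball t (r / 3), flow u t' x = chart n (a + 0 + ((t' - t : ℝ) : ℂ) * u) :=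
      key 0 (by simpa using hr3) x hx t (Metric.mem_ball_self hr3) (by rw [h1]; simp)
    have step : ∀ t₁ ∈ Metric.ball t (r / 3), ∀ t₂ ∈ Metric.ball t (r / 3), P t₁ → P t₂ := by
      rintro t₁ h₁ t₂ h₂ ⟨g, z', hg, hw⟩
      have e0 := hw.self_of_nhds
      simp only [add_zero, e] at e0
      have e1 := (e0 hx).symm.trans (hx' t₁ h₁)
      have hD : ∀ t' ∈ Metric.ball t (r / 3), a + 0 + ((t' - t : ℝ) : ℂ) * u ∈ chartDomain n :=
        fun t' h' => hm 0 t' (by simpa using hr3) h'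
      have e2 := hg.eventuallyEq (germ_chart (hD t₁ h₁)) e1
      have c : Tendsto (fun w : ℂ => z' + w) (𝓝 0) (𝓝 z') := by
        have : Continuous fun w : ℂ => z' + w := by fun_prop
        simpa using this.tendsto 0
      refine ⟨chart n, a + 0 + ((t₂ - t : ℝ) : ℂ) * u, germ_chart (hD t₂ h₂), ?_⟩
      have hsmall : ∀ᶠ w : ℂ in 𝓝 0, ‖w‖ < r / 3 := by
        filter_upwards [Metric.ball_mem_nhds (0 : ℂ) hr3] with w hw
        simpa using hw
      filter_upwards [hw, c.eventually e2, hsmall] with w h3 h4 h5 h6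
      have := key w h5 _ h6 t₁ h₁ (by rw [h3 h6, h4]; congr 1; ring) t₂ h₂
      rw [this]; congr 1; ring
    filter_upwards [Metric.ball_mem_nhds t hr3] with t' ht'
    exact propext ⟨step t' ht' t (Metric.mem_ball_self hr3), step t (Metric.mem_ball_self hr3) t' ht'⟩
  have hPt : P t = P 0 := eq_of_locally_eq ordConnected_univ hloc (mem_univ 0) (mem_univ t)
  obtain ⟨g, z', hg, hw⟩ : P t := hPt ▸ hP0
  exact ⟨f, g, 0, z', hf, e, hg, hw⟩

theorem measure_image_flow_le (hu : ‖u‖ = 1) (t : ℝ) {S : Set S1} (hS : MeasurableSet S) :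
    MeasurableSet (flow u t '' S) ∧ area (flow u t '' S) ≤ area S := by
  have h0 : u ≠ 0 := fun h => by simp [h] at hu
  have hm := measurableSet_generic h0
  obtain ⟨h1, h2⟩ := (locallyAffineOn_flow hu t).measure_image_le (fun _ _ => rfl)
    (fun x hx => generic_not_mem_singularities hx) (hS.inter hm) inter_subset_right
  have h3 : flow u t '' (S ∩ (generic u)ᶜ) = S ∩ (generic u)ᶜ := by
    conv_rhs => rw [← image_id (S ∩ (generic u)ᶜ)]
    exact image_congr fun x hx => flow_of_not_mem hx.2
  have h4 : flow u t '' S = flow u t '' (S ∩ generic u) ∪ (S ∩ (generic u)ᶜ) := by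
    rw [← h3, ← image_union, inter_union_compl]
  rw [h4]
  refine ⟨h1.union (hS.inter hm.compl), (measure_union_le _ _).trans ?_⟩
  rw [measure_mono_null inter_subset_right (area_compl_generic h0), add_zero]
  exact h2.trans (measure_mono inter_subset_left)

theorem flow_neg_flow (hu : ‖u‖ = 1) (t : ℝ) (x : S1) : flow u (-t) (flow u t x) = x := by
  rw [flow_flow hu, neg_add_cancel, flow_zero hu]

theorem preimage_flow (hu : ‖u‖ = 1) (t : ℝ) (S : Set S1) : flow u t ⁻¹' S = flow u (-t) '' S := by
  ext x
  constructor
  · intro h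
    exact ⟨_, h, flow_neg_flow hu t x⟩
  · rintro ⟨y, hy, rfl⟩
    have := flow_neg_flow hu (-t) y
    rw [neg_neg] at this
    rw [mem_preimage, this]; exact hy

/-- The time `1` map of the flow. -/
def flowEquiv (hu : ‖u‖ = 1) : S1 ≃ᵐ S1 where
  toFun := flow u 1
  invFun := flow u (-1)
  left_inv := flow_neg_flow hu 1
  right_inv x := by simpa using flow_neg_flow hu (-1) x
  measurable_toFun S hS := by
    change MeasurableSet (flow u 1 ⁻¹' S)
    rw [preimage_flow hu]
    exact (measure_image_flow_le hu _ hS).1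
  measurable_invFun S hS := by
    change MeasurableSet (flow u (-1) ⁻¹' S)
    rw [preimage_flow hu]
    exact (measure_image_flow_le hu _ hS).1

theorem flowEquiv_iterate (hu : ‖u‖ = 1) (n : ℕ) (x : S1) : (flowEquiv hu)^[n] x = flow u n x := by
  induction n with
  | zero => simpa using (flow_zero hu).symm
  | succ n ih =>
    rw [Function.iterate_succ_apply', ih]
    change flow u 1 (flow u n x) = _
    rw [flow_flow hu]; congr 1; push_cast; ring

/-- Neither the time `1` map nor its inverse increases the area. -/
theorem measurePreserving_flowEquiv (hu : ‖u‖ = 1) : MeasurePreserving (flowEquiv hu) area area := by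
  refine ⟨(flowEquiv hu).measurable, Measure.ext fun S hS => ?_⟩
  rw [Measure.map_apply (flowEquiv hu).measurable hS]
  change area (flow u 1 ⁻¹' S) = area S
  rw [preimage_flow hu]
  obtain ⟨h1, h2⟩ := measure_image_flow_le hu (-1) hS
  refine le_antisymm h2 ?_
  have h3 := (measure_image_flow_le hu 1 h1).2
  have h4 : flow u 1 '' (flow u 1 ⁻¹' S) = S := image_preimage_eq S (flowEquiv hu).surjective
  rwa [← preimage_flow hu, h4, preimage_flow hu] at h3

end

/-! ### A criterion for conservativity -/

theorem measurableEmbedding_iterate {α : Type*} [MeasurableSpace α] (e : α ≃ᵐ α) (n : ℕ) :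
    MeasurableEmbedding e^[n] := by
  induction n with
  | zero => exact MeasurableEmbedding.id
  | succ n ih => exact ih.comp e.measurableEmbedding

/-- An invertible measure preserving map is conservative if every set of an exhaustion is contained in
sets of finite measure whose points rarely leave them. -/
theorem conservative_of_small_exit {α : Type*} [MeasurableSpace α] {μ : Measure α} (e : α ≃ᵐ α)
    (he : MeasurePreserving e μ μ) {U : ℕ → Set α} (hU : ∀ c, MeasurableSet (U c)) (hc : ⋃ c, U c = univ)
    (h : ∀ c, ∀ ε : ℝ≥0∞, ε ≠ 0 → ∃ F, MeasurableSet F ∧ U c ⊆ F ∧ μ F ≠ ∞ ∧ μ (F \ e ⁻¹' F) ≤ ε) :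
    Conservative e μ := by
  refine ⟨he.quasiMeasurePreserving, fun s hs hμ => ?_⟩
  by_contra! hw
  have hpos : ∃ c, μ (s ∩ U c) ≠ 0 := by
    by_contra! h0
    refine hμ ?_
    rw [← inter_univ s, ← hc, inter_iUnion]
    exact measure_iUnion_null h0
  obtain ⟨c, hc⟩ := hpos
  set W := s ∩ U c with hW
  have hWm : MeasurableSet W := hs.inter (hU c)
  have hdisj : ∀ m n : ℕ, m < n → Disjoint (e^[m] '' W) (e^[n] '' W) := by
    intro m n hmn
    rw [disjoint_left]
    rintro _ ⟨x, hx, rfl⟩ ⟨y, hy, hxy⟩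
    obtain ⟨k, rfl⟩ := Nat.exists_eq_add_of_lt hmn
    rw [add_assoc, Function.iterate_add_apply] at hxy
    have := (measurableEmbedding_iterate e m).injective hxy
    exact hw y hy.1 (k + 1) (by omega) (this ▸ hx.1)
  have hdisj' : Pairwise (Function.onFun Disjoint fun n => e^[n] '' W) := by
    intro m n hmn
    rcases lt_or_gt_of_ne hmn with h | h
    · exact hdisj m n h
    · exact (hdisj n m h).symm
  have himg : ∀ (n : ℕ) (A : Set α), MeasurableSet A → MeasurableSet (e^[n] '' A) ∧ μ (e^[n] '' A) = μ A := by
    intro n A hA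
    have hE := measurableEmbedding_iterate e n
    have hm := hE.measurableSet_image.2 hA
    refine ⟨hm, ?_⟩
    rw [← (he.iterate n).measure_preimage hm.nullMeasurableSet, preimage_image_eq _ hE.injective]
  refine hc (le_antisymm (le_of_forall_pos_le_add fun ε hε => ?_) bot_le)
  obtain ⟨F, hF, hUF, hFfin, hFε⟩ := h c ε hε.ne'
  have hmp : ∀ n, Measurable e^[n] := fun n => (measurableEmbedding_iterate e n).measurable
  -- The wandering set `W` splits into the points that never leave `F` and those that are in `F` at
  -- some time `n` but not at time `n + 1`.
  let V : Set α := W ∩ ⋂ n, e^[n] ⁻¹' F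
  let D : ℕ → Set α := fun n => W ∩ (e^[n] ⁻¹' F \ e^[n + 1] ⁻¹' F)
  have hVm : MeasurableSet V := hWm.inter (MeasurableSet.iInter fun n => hmp n hF)
  have hDm : ∀ n, MeasurableSet (D n) := fun n => hWm.inter ((hmp n hF).diff (hmp (n + 1) hF))
  have hcov : W ⊆ V ∪ ⋃ n, D n := by
    intro x hx
    by_cases hall : ∀ n, e^[n] x ∈ F
    · exact Or.inl ⟨hx, mem_iInter.2 hall⟩
    · right
      push Not at hall
      classical
      have h0 : Nat.find hall ≠ 0 := fun h0 => by
        have := Nat.find_spec hall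
        rw [h0] at this
        exact this (hUF hx.2)
      obtain ⟨n, hn⟩ := Nat.exists_eq_succ_of_ne_zero h0
      refine mem_iUnion.2 ⟨n, hx, ?_, ?_⟩
      · have := Nat.find_min hall (m := n) (by omega)
        exact not_not.1 this
      · have := Nat.find_spec hall
        rw [hn] at this
        exact this
  -- The images of `V` are disjoint, of equal measure and all contained in the set `F` of finite
  -- measure.
  have hV : μ V = 0 := by
    by_contra hne
    have h1 : ∑' n : ℕ, μ (e^[n] '' V) ≤ μ F := by
      rw [← measure_iUnion (fun m n hmn => ((hdisj' hmn).mono (image_mono inter_subset_left)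
        (image_mono inter_subset_left))) fun n => (himg n V hVm).1]
      refine measure_mono (iUnion_subset fun n => ?_)
      rintro _ ⟨x, hx, rfl⟩
      exact mem_iInter.1 hx.2 n
    simp only [fun n => (himg n V hVm).2] at h1
    rw [ENNReal.tsum_const_eq_top_of_ne_zero hne] at h1
    exact hFfin (top_le_iff.1 h1)
  -- The images of the sets `D n` at their exit times are disjoint subsets of the exit set of `F`.
  have hD : ∑' n, μ (D n) ≤ ε := by
    refine le_trans ?_ hFε
    have h1 : ∑' n, μ (D n) = ∑' n, μ (e^[n] '' D n) := tsum_congr fun n => (himg n _ (hDm n)).2.symm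
    rw [h1, ← measure_iUnion (fun m n hmn => ((hdisj' hmn).mono (image_mono inter_subset_left)
        (image_mono inter_subset_left))) fun n => (himg n _ (hDm n)).1]
    refine measure_mono (iUnion_subset fun n => ?_)
    rintro _ ⟨x, hx, rfl⟩
    refine ⟨hx.2.1, fun h' => hx.2.2 ?_⟩
    rw [mem_preimage, Function.iterate_succ_apply']
    exact h'
  calc μ W ≤ μ V + μ (⋃ n, D n) := (measure_mono hcov).trans (measure_union_le _ _)
    _ ≤ 0 + ∑' n, μ (D n) := add_le_add hV.le (measure_iUnion_le _)
    _ ≤ 0 + ε := by gcongr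

end

section

/-! ### The part of the surface below a level -/

/-- The part of `S₁` made of the points of height at most `(N + 1)²` in the polygons. -/
def lowPart (N : ℕ) : Set S1 :=
  {x | ∃ s, ∃ z ∈ poly s, x = pt s z ∧ (IsVertex z ∨ sgn s * z.im ≤ (N + 1) ^ 2)}

theorem ht_zero (z : ℂ) : ht 0 z = z.im := by simp [ht]

theorem level_zero (k : ℤ) : level 0 k = (k : ℝ) ^ 2 := by simp [level, sq]

/-- The ends of an edge have consecutive integers as abscissae and their squares as heights. If a
point between them has height at most `(N + 1)²`, then both ends do, hence so does the reflected
point. At vertices this fails, which is why `lowPart` contains them all. -/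
theorem low_edge {N : ℕ} {n : ℤ} {z : ℂ} (hz : z ∈ edge n) (hv : ¬ IsVertex z)
    (h : z.im ≤ (N + 1) ^ 2) : (offset n - z).im ≤ (N + 1) ^ 2 := by
  rw [isVertex_of_mem_edge hz, not_or] at hv
  rw [mem_edge] at hz
  obtain ⟨h0, h1, h2⟩ := hz
  have h0' : (n : ℝ) < z.re := by
    refine lt_of_le_of_ne h0 fun e => hv.1 (Complex.ext (by simp [e]) ?_)
    rw [h2, ← e]; simp [chord]; ring
  have h1' : z.re < n + 1 := by
    refine lt_of_le_of_ne h1 fun e => hv.2 (Complex.ext (by simp [e]) ?_)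
    rw [h2, e]; simp [chord]; ring
  have key : n ^ 2 ≤ ((N : ℤ) + 1) ^ 2 ∧ (n + 1) ^ 2 ≤ ((N : ℤ) + 1) ^ 2 := by
    unfold chord at h2
    rcases le_or_gt 0 n with hn | hn
    · have hn' : (0 : ℝ) ≤ n := by exact_mod_cast hn
      have h3 : (n : ℝ) ^ 2 < (N + 1) ^ 2 := by nlinarith
      have h4 : n ^ 2 < ((N : ℤ) + 1) ^ 2 := by exact_mod_cast h3
      have h5 : n < (N : ℤ) + 1 := lt_of_pow_lt_pow_left₀ 2 (by positivity) h4
      constructor <;> nlinarith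
    · have hn' : (n : ℝ) + 1 ≤ 0 := by exact_mod_cast hn
      have h3 : ((n : ℝ) + 1) ^ 2 < (N + 1) ^ 2 := by nlinarith
      have h4 : (n + 1) ^ 2 < ((N : ℤ) + 1) ^ 2 := by exact_mod_cast h3
      have h5 : -(n + 1) < (N : ℤ) + 1 := lt_of_pow_lt_pow_left₀ 2 (by positivity) (by linarith)
      constructor <;> nlinarith
  have k1 : (n : ℝ) ^ 2 ≤ (N + 1) ^ 2 := by exact_mod_cast key.1
  have k2 : ((n : ℝ) + 1) ^ 2 ≤ (N + 1) ^ 2 := by exact_mod_cast key.2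
  simp only [Complex.sub_im, offset_im]
  unfold chord at h2
  nlinarith

theorem pt_mem_lowPart {N : ℕ} {s : Bool} {z : ℂ} (hz : z ∈ poly s) :
    pt s z ∈ lowPart N ↔ IsVertex z ∨ sgn s * z.im ≤ (N + 1) ^ 2 := by
  refine ⟨?_, fun h => ⟨s, z, hz, rfl, h⟩⟩
  rintro ⟨s', z', hz', e, h⟩
  refine (pt_invariant (fun s z => IsVertex z ∨ sgn s * z.im ≤ (N + 1) ^ 2) (fun n w hw => ?_) hz hz' e).2 h
  have hv : IsVertex w ↔ IsVertex (w - offset n) := by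
    rw [isVertex_of_mem_edge hw, ← isVertex_neg, neg_sub, isVertex_of_mem_edge (offset_sub_mem_edge hw)]
    unfold offset
    constructor <;> rintro (h | h)
    · right; rw [h]; ring
    · left; rw [h]; ring
    · right; linear_combination -h
    · left; linear_combination -h
  rw [← hv]
  by_cases hw' : IsVertex w
  · simp [hw']
  · have e2 : sgn false * (w - offset n).im = (offset n - w).im := by simp
    simp only [hw', false_or, e2, sgn_true, one_mul]
    refine ⟨low_edge hw hw', fun h => ?_⟩
    have hv' : ¬ IsVertex (offset n - w) := by rwa [← isVertex_neg, neg_sub, ← hv]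
    simpa using low_edge (offset_sub_mem_edge hw) hv' h

theorem tr_lowPart (N : ℕ) (s : Bool) :
    tr s (lowPart N) = poly s ∩ ({z | IsVertex z} ∪ {z | sgn s * z.im ≤ (N + 1) ^ 2}) := by
  ext z
  exact and_congr_right fun h => pt_mem_lowPart h

theorem measurableSet_lowPart (N : ℕ) : MeasurableSet (lowPart N) := by
  refine measurableSet_iff.2 fun s => ?_
  rw [tr_lowPart]
  refine (measurableSet_poly s).inter (countable_vertices.measurableSet.union ?_)
  have h : IsClosed {z : ℂ | sgn s * z.im ≤ (N + 1) ^ 2} :=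
    isClosed_le (by fun_prop) continuous_const
  exact h.measurableSet

theorem iUnion_lowPart : ⋃ N, lowPart N = univ := by
  refine eq_univ_of_forall fun x => mem_iUnion.2 ?_
  obtain ⟨s, z, hz, rfl⟩ := exists_pt x
  obtain ⟨n, hn⟩ := exists_nat_gt (sgn s * z.im)
  refine ⟨n, (pt_mem_lowPart hz).2 (Or.inr ?_)⟩
  have : (0 : ℝ) ≤ n := by positivity
  nlinarith

theorem sq_le_im {s : Bool} {z : ℂ} (hz : z ∈ poly s) : z.re ^ 2 ≤ sgn s * z.im := by
  cases s
  · rw [mem_poly_false'] at hz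
    have := sq_le_profile z.re
    simp only [sgn_false]; linarith
  · rw [mem_poly_true] at hz
    have := sq_le_profile z.re
    simp only [sgn_true]; linarith

theorem abs_re_le {s : Bool} {z : ℂ} (hz : z ∈ poly s) {a : ℝ} (ha : 0 ≤ a) (h : sgn s * z.im ≤ a ^ 2) :
    |z.re| ≤ a := abs_le_of_sq_le_sq ((sq_le_im hz).trans h) ha

theorem volume_rect (a b c d : ℝ) : volume {z : ℂ | z.re ∈ Icc a b ∧ z.im ∈ Icc c d} =
    ENNReal.ofReal (b - a) * ENNReal.ofReal (d - c) := by
  have e : {z : ℂ | z.re ∈ Icc a b ∧ z.im ∈ Icc c d} =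
      Complex.measurableEquivRealProd ⁻¹' (Icc a b ×ˢ Icc c d) := by
    ext z; simp [Complex.measurableEquivRealProd]; tauto
  rw [e, Complex.volume_preserving_equiv_real_prod.measure_preimage
    (measurableSet_Icc.prod measurableSet_Icc).nullMeasurableSet, Measure.volume_eq_prod,
    Measure.prod_prod, Real.volume_Icc, Real.volume_Icc]

theorem area_lowPart (N : ℕ) : area (lowPart N) ≠ ∞ := by
  rw [area_eq (measurableSet_lowPart N)]
  have key : ∀ s, volume (tr s (lowPart N)) ≠ ∞ := by
    intro s
    refine ne_top_of_le_ne_top (b := volume {z : ℂ | IsVertex z} + volume {z : ℂ |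
      z.re ∈ Icc (-(N + 1) : ℝ) (N + 1) ∧ z.im ∈ Icc (-((N + 1) ^ 2) : ℝ) ((N + 1) ^ 2)}) ?_ ?_
    · rw [countable_vertices.measure_zero, volume_rect]
      exact ENNReal.add_ne_top.2 ⟨ENNReal.zero_ne_top, ENNReal.mul_ne_top ENNReal.ofReal_ne_top ENNReal.ofReal_ne_top⟩
    · refine (measure_mono ?_).trans (measure_union_le _ _)
      rw [tr_lowPart]
      rintro z ⟨h1, h2 | h2⟩
      · exact Or.inl h2
      · have h3 := abs_le.1 (abs_re_le h1 (by positivity) h2)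
        have h4 := (sq_nonneg _).trans (sq_le_im h1)
        refine Or.inr ⟨h3, ?_⟩
        rw [mem_ofPred_eq] at h2
        cases s
        · simp only [sgn_false] at h2 h4
          constructor <;> nlinarith
        · simp only [sgn_true] at h2 h4
          constructor <;> nlinarith
  exact ENNReal.add_ne_top.2 ⟨key _, key _⟩

theorem singularities_subset_lowPart (N : ℕ) : singularities ⊆ lowPart N := by
  intro x hx
  obtain ⟨s, z, hz, rfl⟩ := exists_pt x
  exact (pt_mem_lowPart hz).2 (Or.inl ((pt_mem_singularities hz).1 hx))

theorem lowPart_mono {M N : ℕ} (h : M ≤ N) : lowPart M ⊆ lowPart N := by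
  rintro _ ⟨s, z, hz, rfl, h1⟩
  refine ⟨s, z, hz, rfl, h1.imp_right fun h2 => h2.trans ?_⟩
  gcongr

/-- Below the height `(N + 1)²` abscissae are at most `N + 1` in absolute value, so the new height
is at most `(N + 1)² + 2|k|(N + 1) + k² = (N + 1 + |k|)²`. -/
theorem slideMap_mem_lowPart (k : ℤ) {N : ℕ} {x : S1} (hx : x ∈ lowPart N) :
    slideMap k x ∈ lowPart (N + k.natAbs) := by
  by_cases hxs : x ∈ singularities
  · exact singularities_subset_lowPart _ (((affineAut_slide k).sing x).2 hxs)
  obtain ⟨s, z, hz, rfl⟩ := exists_pt x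
  rw [pt_mem_singularities hz] at hxs
  have h1 := ((pt_mem_lowPart hz).1 hx).resolve_left hxs
  rw [slideMap_pt k hz, pt_mem_lowPart (slide_mem_poly k hz)]
  right
  have h2 := abs_re_le hz (by positivity) h1
  have h3 : ((k.natAbs : ℕ) : ℝ) = |(k : ℝ)| := by rw [Nat.cast_natAbs]; push_cast; rfl
  have h4 : |2 * k * (sgn s * z.re)| ≤ 2 * |(k : ℝ)| * (N + 1) := by
    rw [abs_mul, abs_mul, abs_mul, abs_two]
    have : |sgn s| = 1 := by cases s <;> simp
    rw [this, one_mul]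
    gcongr
  have h5 := (abs_le.1 h4).2
  have hss : sgn s * sgn s = 1 := by cases s <;> simp
  rw [slide_im]
  push_cast
  rw [h3]
  have h6 := sq_abs (k : ℝ)
  nlinarith

theorem openCyl_subset_or {k : ℤ} (hk : 0 ≤ k) (N : ℕ) :
    openCyl 0 k ⊆ lowPart N ∨ Disjoint (openCyl 0 k) (lowPart N) := by
  have hσ : (0 : ℤ) = 0 ∨ (0 : ℤ) = 1 := Or.inl rfl
  have hl : level 0 ((N : ℤ) + 1) = ((N : ℝ) + 1) ^ 2 := by rw [level_zero]; push_cast; rfl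
  rcases le_or_gt k N with h | h
  · left
    rintro _ ⟨s, z, hz, rfl, h1, h2⟩
    refine (pt_mem_lowPart hz).2 (Or.inr ?_)
    rw [ht_zero] at h2
    have := level_mono hσ (by omega : 0 ≤ k + 1) (by omega : k + 1 ≤ (N : ℤ) + 1)
    linarith
  · right
    rw [disjoint_left]
    rintro _ ⟨s, z, hz, rfl, h1, h2⟩ h3
    rcases (pt_mem_lowPart hz).1 h3 with h4 | h4
    · have h5 : pt s z ∈ openCyl 0 k := ⟨s, z, hz, rfl, h1, h2⟩
      rw [← image_openStrip hσ hk] at h5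
      obtain ⟨w, hw, e⟩ := h5
      exact (germ_cyl hσ hk hw).not_mem_singularities (e ▸ (pt_mem_singularities hz).2 h4)
    · rw [ht_zero] at h1
      have := level_mono hσ (by omega : (0 : ℤ) ≤ N + 1) (by omega : (N : ℤ) + 1 ≤ k)
      linarith

/-- The twist preserves each open horizontal cylinder, which lies either inside the low part or
outside it, and it fixes all other points. -/
theorem twistMap_mem_lowPart (e : ℤ) {N : ℕ} {x : S1} (hx : x ∈ lowPart N) : twistMap e x ∈ lowPart N := by
  have hσ : (0 : ℤ) = 0 ∨ (0 : ℤ) = 1 := Or.inl rfl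
  by_cases h : ∃ p : ℤ × ℂ, 0 ≤ p.1 ∧ p.2 ∈ openStrip 0 p.1 ∧ cyl 0 p.1 p.2 = x
  · obtain ⟨⟨k, z⟩, hk, hz, rfl⟩ := h
    dsimp only at hk hz hx ⊢
    rw [twistMap_cyl e hk ⟨hz.1.le, hz.2.le⟩]
    have h1 : ∀ w ∈ openStrip 0 k, cyl 0 k w ∈ openCyl 0 k := fun w hw => by
      rw [← image_openStrip hσ hk]; exact mem_image_of_mem _ hw
    rcases openCyl_subset_or hk N with h2 | h2
    · exact h2 (h1 _ (twistLift_mem_openStrip.2 hz))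
    · exact absurd hx (disjoint_left.1 h2 (h1 z hz))
  · unfold twistMap
    rwa [dif_neg h]

end

section

/-! ### The points that leave the part below a level in unit time -/

/-- The boundary of a polygon. -/
def sides (s : Bool) : Set ℂ := {z | ∃ n, (sgn s : ℂ) * z ∈ edge n}

/-- The points of height `δ`-close to one of three consecutive squares, together with the edges. -/
def collar (N : ℕ) (δ : ℝ) : Set S1 :=
  {x | ∃ s, ∃ z ∈ poly s, x = pt s z ∧
    (z ∈ sides s ∨ ∃ k ∈ Finset.Icc N (N + 2), |sgn s * z.im - k ^ 2| ≤ δ)}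

theorem tr_collar (N : ℕ) (δ : ℝ) (s : Bool) : tr s (collar N δ) =
    poly s ∩ (sides s ∪ ⋃ k ∈ Finset.Icc N (N + 2), {z | |sgn s * z.im - k ^ 2| ≤ δ}) := by
  ext z
  refine and_congr_right fun hz => ?_
  have e : z ∈ sides s ∪ ⋃ k ∈ Finset.Icc N (N + 2), {z : ℂ | |sgn s * z.im - k ^ 2| ≤ δ} ↔
      z ∈ sides s ∨ ∃ k ∈ Finset.Icc N (N + 2), |sgn s * z.im - k ^ 2| ≤ δ := by
    simp only [mem_union, mem_iUnion₂, mem_ofPred_eq, exists_prop]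
  rw [e]
  refine ⟨?_, fun h => ⟨s, z, hz, rfl, h⟩⟩
  rintro ⟨s', z', hz', e, h⟩
  refine (pt_invariant (fun s z => z ∈ sides s ∨ ∃ k ∈ Finset.Icc N (N + 2), |sgn s * z.im - k ^ 2| ≤ δ)
    (fun n w hw => ?_) hz hz' e).2 h
  -- Since the collar contains all edges, it is compatible with the gluings for trivial reasons; the
  -- edges have no area.
  have h1 : w ∈ sides true := ⟨n, by simpa using hw⟩
  have h2 : w - offset n ∈ sides false := ⟨n, by simpa using offset_sub_mem_edge hw⟩
  simp only [h1, h2, true_or]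

theorem volume_sides (s : Bool) : volume (sides s) = 0 ∧ MeasurableSet (sides s) := by
  have e : sides s = ⋃ n, (fun z => (sgn s : ℂ) * z) ⁻¹' edge n := by
    ext z; simp [sides]
  have hcl : ∀ n, IsClosed (edge n) := fun n => by
    have := (isCompact_Icc (a := (0 : ℝ)) (b := 1)).image
      (AffineMap.lineMap_continuous (R := ℝ) (p := vertex n) (q := vertex (n + 1)))
    rw [edge, segment_eq_image_lineMap]
    exact this.isClosed
  have hc : Continuous fun z : ℂ => (sgn s : ℂ) * z := by fun_prop
  rw [e]
  refine ⟨measure_iUnion_null fun n => ?_, MeasurableSet.iUnion fun n => ((hcl n).preimage hc).measurableSet⟩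
  cases s
  · have : (fun z : ℂ => (sgn false : ℂ) * z) ⁻¹' edge n = Neg.neg ⁻¹' edge n := by
      ext z; simp
    rw [this, Measure.measure_preimage_neg]
    exact volume_edge n
  · have : (fun z : ℂ => (sgn true : ℂ) * z) ⁻¹' edge n = edge n := by
      ext z; simp
    rw [this]
    exact volume_edge n

theorem measurableSet_collar (N : ℕ) (δ : ℝ) : MeasurableSet (collar N δ) := by
  refine measurableSet_iff.2 fun s => ?_
  rw [tr_collar]
  refine (measurableSet_poly s).inter ((volume_sides s).2.union ?_)
  refine Finset.measurableSet_biUnion _ fun k _ => ?_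
  have h : IsClosed {z : ℂ | |sgn s * z.im - (k : ℝ) ^ 2| ≤ δ} :=
    isClosed_le (by fun_prop) continuous_const
  exact h.measurableSet

/-- In each of the two polygons the collar is covered, up to the edges, by three rectangles of sides
`2(N + 3)` and `2δ`. The abscissae are at most `N + 3` because the heights are at most `(N + 2)² +
1`. -/
theorem area_collar_le (N : ℕ) {δ : ℝ} (h0 : 0 ≤ δ) (h1 : δ ≤ 1) :
    area (collar N δ) ≤ ENNReal.ofReal (24 * (N + 3) * δ) := by
  rw [area_eq (measurableSet_collar N δ)]
  have key : ∀ s, volume (tr s (collar N δ)) ≤ ENNReal.ofReal (12 * (N + 3) * δ) := by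
    intro s
    have hsub : tr s (collar N δ) ⊆ sides s ∪ ⋃ k ∈ Finset.Icc N (N + 2), {z : ℂ |
        z.re ∈ Icc (-(N + 3) : ℝ) (N + 3) ∧ z.im ∈ Icc (sgn s * k ^ 2 - δ) (sgn s * k ^ 2 + δ)} := by
      rw [tr_collar]
      rintro z ⟨hz, h | h⟩
      · exact Or.inl h
      · right
        simp only [mem_iUnion₂, mem_ofPred_eq, exists_prop] at h ⊢
        obtain ⟨k, hk, h⟩ := h
        refine ⟨k, hk, ?_, ?_⟩
        · have hk' : (k : ℝ) ≤ N + 2 := by exact_mod_cast (Finset.mem_Icc.1 hk).2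
          have hk0 : (0 : ℝ) ≤ k := by positivity
          refine abs_le.1 (abs_re_le hz (by positivity) ?_)
          have := (abs_le.1 h).2
          nlinarith
        · have := abs_le.1 h
          cases s
          · simp only [sgn_false] at *
            constructor <;> linarith
          · simp only [sgn_true] at *
            constructor <;> linarith
    refine (measure_mono hsub).trans ((measure_union_le _ _).trans ?_)
    rw [(volume_sides s).1, zero_add]
    refine (measure_biUnion_finset_le _ _).trans ?_
    simp only [volume_rect]
    have e : ∀ k : ℕ, ENNReal.ofReal ((N + 3 : ℝ) - -(N + 3)) *
        ENNReal.ofReal (sgn s * (k : ℝ) ^ 2 + δ - (sgn s * (k : ℝ) ^ 2 - δ)) =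
        ENNReal.ofReal (4 * (N + 3) * δ) := by
      intro k
      have h2 : (0 : ℝ) ≤ (N + 3 : ℝ) - -(N + 3) := by
        rw [sub_neg_eq_add]; positivity
      rw [← ENNReal.ofReal_mul h2]
      congr 1; ring
    simp only [e]
    rw [Finset.sum_const, Nat.card_Icc, nsmul_eq_mul]
    have e3 : N + 2 + 1 - N = 3 := by omega
    rw [e3, ← ENNReal.ofReal_natCast, ← ENNReal.ofReal_mul (by positivity)]
    refine le_of_eq ?_
    congr 1; push_cast; ring
  refine (add_le_add (key _) (key _)).trans (le_of_eq ?_)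
  have h2 : 0 ≤ 12 * (N + 3) * δ := by positivity
  rw [← ENNReal.ofReal_add h2 h2]
  congr 1; ring

theorem swapMap_mem_collar {N : ℕ} {δ : ℝ} {x : S1} (hx : swapMap x ∈ collar N δ) : x ∈ collar N δ := by
  obtain ⟨s, z, hz, e, h⟩ := hx
  have e' : x = pt (!s) (-z) := by rw [← swapMap_swapMap x, e, swapMap_pt hz]
  refine ⟨!s, -z, neg_mem_poly_not hz, e', ?_⟩
  cases s
  · simpa [sides] using h
  · simpa [sides] using h

/-- A point of the strip close to the line at `(N + 1)²` may be represented in `Q⁻`, at a height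
reflected to be close to `N²` or `(N + 2)²`. This explains the three squares in `collar`. -/
theorem cyl_mem_collar {N : ℕ} {δ : ℝ} {j : ℤ} (hj : j = N ∨ j = N + 1) {z : ℂ} (hz : z ∈ closedStrip 0 j)
    (h : |z.im - (N + 1) ^ 2| ≤ δ) : cyl 0 j z ∈ collar N δ := by
  have hσ : (0 : ℤ) = 0 ∨ (0 : ℤ) = 1 := Or.inl rfl
  have hj0 : 0 ≤ j := by omega
  obtain ⟨i, -, -, hi | hi⟩ := exists_fundamental hσ hj0 hz.1 hz.2
  · rw [cyl_true hσ hj0 hz.1 hz.2 hi]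
    refine ⟨true, _, hi, rfl, Or.inr ⟨N + 1, by simp, ?_⟩⟩
    have e := ht_sub_period (σ := 0) (k := j) z i
    rw [ht_zero, ht_zero] at e
    rw [e]; simpa using h
  · rw [cyl_false hσ hj0 hz.1 hz.2 hi]
    have e : (z - i * period 0 j - offset (j + 0)).im = z.im - (j ^ 2 + (j + 1) ^ 2) := by
      rw [← ht_zero, ht_sub, ht_sub_period, ht_offset_right, ht_zero, level_zero, level_zero]
      push_cast; ring
    rcases hj with rfl | rfl
    · refine ⟨false, _, hi, rfl, Or.inr ⟨N, by simp, ?_⟩⟩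
      rw [e, ← abs_neg, sgn_false]
      convert h using 2
      push_cast; ring
    · refine ⟨false, _, hi, rfl, Or.inr ⟨N + 2, by simp, ?_⟩⟩
      rw [e, ← abs_neg, sgn_false]
      convert h using 2
      push_cast; ring

/-- Traced back from the crossing for at most unit time, the curve changes its height by at most
`|v.im| < 1`. It therefore stays in one of the two cylinders that meet at this level. -/
theorem mem_collar_of_crossing {N : ℕ} {v : ℂ} (hv0 : v.im ≠ 0) (hv : |v.im| < 1) {c : ℝ → S1}
    (hc : IsStraight v univ c) {τ : ℝ} (hτ : τ ∈ Icc (0 : ℝ) 1) {z : ℂ} (e : c τ = pt true z)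
    (hz : z.im = (N + 1) ^ 2) (h0 : -((N : ℝ) + 1) < z.re) (h1 : z.re < N + 1) :
    c 0 ∈ collar N |v.im| := by
  have hσ : (0 : ℤ) = 0 ∨ (0 : ℤ) = 1 := Or.inl rfl
  have hp : poly true ∈ 𝓝 z := poly_mem_nhds_level (k := N + 1) (by omega)
    (by rw [ht_zero, level_zero, hz]; push_cast; rfl) (by push_cast; exact h0) (by push_cast; exact h1)
  rcases hτ.1.eq_or_lt with h2 | h2
  · rw [h2, e]
    refine ⟨true, z, mem_of_mem_nhds hp, rfl, Or.inr ⟨N + 1, by simp, ?_⟩⟩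
    rw [hz]; simp
  -- Before the crossing, a descending curve is in the upper cylinder and an ascending one in the
  -- lower.
  have hstrip : ∃ j : ℤ, (j = N ∨ j = N + 1) ∧
      ∀ t ∈ Ico 0 τ, z + ((t - τ : ℝ) : ℂ) * v ∈ openStrip 0 j := by
    have hN : (0 : ℝ) ≤ N := by positivity
    obtain ⟨v1, v2⟩ := abs_lt.1 hv
    rcases lt_or_gt_of_ne hv0 with h | h
    · refine ⟨N + 1, Or.inr rfl, fun t ht => ?_⟩
      have a1 : 0 < (t - τ) * v.im := mul_pos_of_neg_of_neg (by linarith [ht.2]) h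
      have a2 : (t - τ) * v.im < 1 := by nlinarith [ht.1, ht.2, hτ.2]
      constructor <;> rw [ht_zero, level_zero, Complex.add_im, Complex.im_ofReal_mul, hz] <;> push_cast <;>
        nlinarith
    · refine ⟨N, Or.inl rfl, fun t ht => ?_⟩
      have a1 : (t - τ) * v.im < 0 := mul_neg_of_neg_of_pos (by linarith [ht.2]) h
      have a2 : -1 < (t - τ) * v.im := by nlinarith [ht.1, ht.2, hτ.2]
      constructor <;> rw [ht_zero, level_zero, Complex.add_im, Complex.im_ofReal_mul, hz] <;> push_cast <;>
        nlinarith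
  obtain ⟨j, hj, hstrip⟩ := hstrip
  have hj0 : 0 ≤ j := by omega
  have hs : IsStraight v (Ico 0 τ) (fun t => cyl 0 j (z + ((t - τ : ℝ) : ℂ) * v)) := by
    rw [isStraight_iff]
    intro t ht
    refine straightAt_of_germ (germ_cyl hσ hj0 (hstrip t ht)) (Eventually.of_forall fun t' => ?_)
    congr 1; push_cast; ring
  have hloc : StraightAt v (fun t => pt true (z + ((t - τ : ℝ) : ℂ) * v)) τ :=
    straightAt_of_germ (germ_pt hp) (Eventually.of_forall fun _ => rfl)
  have hev := (isStraight_iff.1 hc τ (mem_univ _)).eventuallyEq hloc (by simpa using e)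
  have hlt : ∀ᶠ t in 𝓝[<] τ, t ∈ Ico 0 τ := by
    filter_upwards [Ioo_mem_nhdsLT h2] with t ht
    exact ⟨ht.1.le, ht.2⟩
  obtain ⟨t₁, h3, h4, h5⟩ := ((hev.filter_mono nhdsWithin_le_nhds).and
    ((((tendsto_line v z τ).eventually hp).filter_mono nhdsWithin_le_nhds).and hlt)).exists
  have h6 := hstrip t₁ h5
  have h7 := cyl_true hσ hj0 h6.1.le h6.2.le (j := 0)
    (by simp only [Int.cast_zero, zero_mul, sub_zero]; exact h4)
  simp only [Int.cast_zero, zero_mul, sub_zero] at h7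
  have h8 := IsStraight.eqOn ordConnected_Ico (hc.mono (subset_univ _)) hs h5 (h3.trans h7.symm)
    (left_mem_Ico.2 h2)
  have h9 := hstrip 0 (left_mem_Ico.2 h2)
  rw [h8]
  refine cyl_mem_collar hj ⟨h9.1.le, h9.2.le⟩ ?_
  rw [Complex.add_im, Complex.im_ofReal_mul, hz, add_sub_cancel_left, abs_mul, zero_sub, abs_neg,
    abs_of_nonneg hτ.1]
  exact mul_le_of_le_one_left (abs_nonneg _) hτ.2

theorem eventually_openCyl {k : ℤ} (hk : 0 ≤ k) {v : ℂ} {c : ℝ → S1} {t : ℝ} (hc : StraightAt v c t)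
    (h : c t ∈ openCyl 0 k) : ∀ᶠ t' in 𝓝 t, c t' ∈ openCyl 0 k := by
  have hσ : (0 : ℤ) = 0 ∨ (0 : ℤ) = 1 := Or.inl rfl
  rw [← image_openStrip hσ hk] at h ⊢
  obtain ⟨z, hz, e⟩ := h
  have h1 : StraightAt v (fun t' => cyl 0 k (z + ((t' - t : ℝ) : ℂ) * v)) t :=
    straightAt_of_germ (germ_cyl hσ hk hz) (Eventually.of_forall fun _ => rfl)
  filter_upwards [hc.eventuallyEq h1 (by simpa using e.symm),
    (tendsto_line v z t).eventually ((isOpen_openStrip 0 k).mem_nhds hz)] with t' h2 h3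
  exact ⟨_, h3, h2.symm⟩

theorem mem_collar_of_exit {N : ℕ} {v : ℂ} (hv : |v.im| < 1) {c : ℝ → S1} (hc : IsStraight v univ c)
    (h0 : c 0 ∈ lowPart N) (h1 : c 1 ∉ lowPart N) : c 0 ∈ collar N |v.im| := by
  have hσ : (0 : ℤ) = 0 ∨ (0 : ℤ) = 1 := Or.inl rfl
  have hst := fun t => isStraight_iff.1 hc t (mem_univ t)
  -- Membership in the low part changes between the times `0` and `1`, so it is not locally
  -- constant.
  have hex : ∃ τ ∈ Icc (0 : ℝ) 1, ¬ ∀ᶠ t' in 𝓝 τ, (c t' ∈ lowPart N) = (c τ ∈ lowPart N) := by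
    by_contra! h
    have := eq_of_locally_eq (g := fun t => c t ∈ lowPart N) ordConnected_Icc h
      (left_mem_Icc.2 zero_le_one) (right_mem_Icc.2 zero_le_one)
    rw [this] at h1
    exact h1 h0
  obtain ⟨τ, hτ, hne⟩ := hex
  have hns := fun t => (hst t).not_mem_singularities
  rcases horizontal_cases hσ (hns τ) with ⟨k, hk, h⟩ | ⟨k, hk, s, z, hz, e, h2, h3, h4⟩
  · refine absurd ?_ hne
    filter_upwards [eventually_openCyl hk (hst τ) h] with t' h'
    rcases openCyl_subset_or hk N with h5 | h5
    · exact propext ⟨fun _ => h5 h, fun _ => h5 h'⟩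
    · exact propext ⟨fun h6 => absurd h6 (disjoint_left.1 h5 h'), fun h6 => absurd h6 (disjoint_left.1 h5 h)⟩
  · rw [Int.cast_zero, add_zero] at h4
    rw [ht_zero, level_zero] at h2
    have hss : sgn s * sgn s = 1 := by cases s <;> simp
    have hp : poly s ∈ 𝓝 z := by
      cases s
      · simp only [sgn_false, neg_mul, one_mul] at h2 h3 h4
        have := poly_mem_nhds_level hk (z := -z) (by rw [ht_zero, level_zero, ← h2]; simp)
          (by simpa using h3) (by simpa using h4)
        have hc : Continuous fun w : ℂ => -w := by fun_prop
        filter_upwards [hc.continuousAt.eventually this] with w hw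
        exact (mem_poly_false).2 hw
      · simp only [sgn_true, one_mul] at h2 h3 h4
        exact poly_mem_nhds_level hk (by rw [ht_zero, level_zero, ← h2]) h3 h4
    have hloc : StraightAt v (fun t => pt s (z + ((t - τ : ℝ) : ℂ) * v)) τ :=
      straightAt_of_germ (germ_pt hp) (Eventually.of_forall fun _ => rfl)
    have hev := (hst τ).eventuallyEq hloc (by simpa using e)
    have hlow : ∀ᶠ t in 𝓝 τ, (c t ∈ lowPart N ↔
        sgn s * (z + ((t - τ : ℝ) : ℂ) * v).im ≤ (N + 1) ^ 2) := by
      filter_upwards [hev, (tendsto_line v z τ).eventually hp] with t a b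
      have := hns t
      rw [a, pt_mem_singularities b] at this
      rw [a, pt_mem_lowPart b]
      exact ⟨fun h => h.resolve_left this, Or.inr⟩
    have hτlow := hlow.self_of_nhds
    simp only [sub_self, Complex.ofReal_zero, zero_mul, add_zero, h2] at hτlow
    have hcont : Continuous fun w : ℂ => sgn s * w.im := by fun_prop
    have htend : Tendsto (fun t : ℝ => sgn s * (z + ((t - τ : ℝ) : ℂ) * v).im) (𝓝 τ) (𝓝 ((k : ℝ) ^ 2)) := by
      rw [← h2]; exact (hcont.tendsto z).comp (tendsto_line v z τ)
    have hk0 : (0 : ℝ) ≤ k := by exact_mod_cast hk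
    -- At any other level membership would be constant near `τ`.
    have hkN : (k : ℝ) = N + 1 := by
      rcases lt_trichotomy (k : ℝ) (N + 1) with h | h | h
      · refine absurd ?_ hne
        have : (k : ℝ) ^ 2 < (N + 1) ^ 2 := by gcongr
        filter_upwards [hlow, htend.eventually (gt_mem_nhds this)] with t a b
        exact propext (by rw [a, hτlow]; exact ⟨fun _ => this.le, fun _ => b.le⟩)
      · exact h
      · refine absurd ?_ hne
        have : ((N : ℝ) + 1) ^ 2 < (k : ℝ) ^ 2 := by gcongr
        filter_upwards [hlow, htend.eventually (lt_mem_nhds this)] with t a b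
        exact propext (by rw [a, hτlow]; exact ⟨fun h => absurd h b.not_ge, fun h => absurd h this.not_ge⟩)
    rw [hkN] at h2 h3 h4 hτlow
    have hv0 : v.im ≠ 0 := by
      intro h
      refine hne ?_
      filter_upwards [hlow] with t a
      refine propext ?_
      rw [a, hτlow, Complex.add_im, Complex.im_ofReal_mul, h, mul_zero, add_zero, h2]
    cases s
    -- A crossing in `Q⁻` becomes one in `Q⁺` after the rotation by `π`, which reverses the
    -- velocity.
    · simp only [sgn_false, neg_mul, one_mul] at h2 h3 h4
      have hc' := affineAut_swap.straight_map (u := v) (u' := -v) (c := 1) (by simp) hc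
      have e1 : {t : ℝ | 1 * t ∈ univ} = univ := by simp
      rw [e1] at hc'
      refine swapMap_mem_collar ?_
      have := mem_collar_of_crossing (N := N) (v := -v) (by simpa using hv0) (by simpa using hv) hc' hτ
        (z := -z) (by
          change swapMap (c (1 * τ)) = _
          rw [one_mul, e, swapMap_pt hz]; rfl) (by simpa using h2) (by simpa using h3) (by simpa using h4)
      simp only [one_mul, Complex.neg_im, abs_neg] at this
      exact this
    · simp only [sgn_true, one_mul] at h2 h3 h4
      exact mem_collar_of_crossing hv0 hv hc hτ e h2 h3 h4

end

section

/-! ### A continued fraction algorithm with even partial quotients -/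

/-- The reals `p` and `q` are linearly independent over the integers. -/
def Incommensurable (p q : ℝ) : Prop := ∀ a b : ℤ, a * p + b * q = 0 → a = 0 ∧ b = 0

theorem Incommensurable.step {p q : ℝ} (h : Incommensurable p q) (n : ℤ) :
    Incommensurable q |p - 2 * n * q| := by
  intro a b hab
  rcases abs_cases (p - 2 * n * q) with ⟨e, -⟩ | ⟨e, -⟩ <;> rw [e] at hab
  · have := h b (a - 2 * n * b) (by push_cast; linarith)
    obtain ⟨h1, h2⟩ := this
    subst h1
    exact ⟨by simpa using h2, rfl⟩
  · have := h (-b) (a + 2 * n * b) (by push_cast; linarith)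
    obtain ⟨h1, h2⟩ := this
    have h3 : b = 0 := by omega
    subst h3
    exact ⟨by simpa using h2, rfl⟩

section

variable {R : ℝ → ℝ → ℕ → Prop}

/-- A state of the algorithm, its parameters being `p`, `d = p - q` and `N`. -/
def State (R : ℝ → ℝ → ℕ → Prop) (p d : ℝ) (N : ℕ) : Prop :=
  R p (p - d) N ∧ 0 < d ∧ d < p ∧ Incommensurable p (p - d)

/-- The quotient `n` makes `|p - 2nq|` less than `q = p - d`. The difference `d` never increases,
and a large quotient `n` is paid for by a small new difference. If `2d < p`, the step is slow: `n =
1` and `d` stays the same. -/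
theorem State.step (hR : ∀ p q N (n : ℕ), R p q N → R q |p - 2 * n * q| (N + n)) {p d : ℝ} {N : ℕ}
    (h : State R p d N) : ∃ (d' : ℝ) (n : ℕ), State R (p - d) d' (N + n) ∧ d' ≤ d ∧ n * d' ≤ d ∧
      (2 * d < p → d' = d ∧ n = 1) := by
  obtain ⟨hr, hd, hdp, hi⟩ := h
  set q := p - d with hq
  have hq0 : 0 < q := by linarith
  -- This makes `2nq` the even multiple of `q` nearest to `p`; incommensurability excludes ties and
  -- a zero remainder.
  obtain ⟨n, hn⟩ : ∃ n : ℕ, n = ⌊(p + q) / (2 * q)⌋₊ := ⟨_, rfl⟩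
  have h2q : 0 < 2 * q := by linarith
  have n1 : (n : ℝ) * (2 * q) ≤ p + q := by
    rw [← le_div_iff₀ h2q, hn]; exact Nat.floor_le (div_nonneg (by linarith) h2q.le)
  have n2 : p + q < (n + 1) * (2 * q) := by
    rw [← div_lt_iff₀ h2q, hn]; exact Nat.lt_floor_add_one _
  have hn1 : 1 ≤ n := by
    rw [hn]
    refine Nat.le_floor ?_
    rw [Nat.cast_one, le_div_iff₀ h2q]; linarith
  have hn1' : (1 : ℝ) ≤ n := by exact_mod_cast hn1
  have hi' := hi.step n
  rw [Int.cast_natCast] at hi'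
  have hne : p + q ≠ n * (2 * q) := by
    intro h
    have := hi 1 (1 - 2 * n) (by push_cast; linarith)
    omega
  have n1' : (n : ℝ) * (2 * q) < p + q := lt_of_le_of_ne n1 hne.symm
  have hpos : 0 < |p - 2 * n * q| := by
    rw [abs_pos]
    intro h
    have := hi' 0 1 (by rw [h]; simp)
    omega
  refine ⟨q - |p - 2 * n * q|, n, ⟨?_, ?_, by linarith, ?_⟩, ?_⟩
  · rw [sub_sub_cancel]; exact hR _ _ _ _ hr
  · rw [sub_pos, abs_lt]; constructor <;> linarith
  · rwa [sub_sub_cancel]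
  · have hd' : d = p - q := by linarith
    rw [hd']
    rcases abs_cases (p - 2 * n * q) with ⟨e, e'⟩ | ⟨e, e'⟩ <;> rw [e]
    · have a1 : q - (p - 2 * n * q) ≤ p - q := by nlinarith
      refine ⟨a1, by nlinarith, fun h => ?_⟩
      nlinarith
    · refine ⟨by nlinarith, by nlinarith, fun h => ?_⟩
      have : (n : ℝ) < 2 := by nlinarith
      have hn2 : n = 1 := by
        have : n < 2 := by exact_mod_cast this
        omega
      refine ⟨?_, hn2⟩
      rw [hn2]; push_cast; ring

/-- A slow step lowers `p` by `d` and raises the cost by `1`, so `(c + N) d + p` is invariant; slow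
steps end when `p ≤ 2d`. -/
theorem State.exists_event (hR : ∀ p q N (n : ℕ), R p q N → R q |p - 2 * n * q| (N + n)) {p d : ℝ} {N : ℕ}
    (h : State R p d N) (c : ℝ) : ∃ p' N', State R p' d N' ∧ p' ≤ 2 * d ∧ p' ≤ p ∧
      (c + (N' : ℕ)) * d + p' = (c + N) * d + p := by
  obtain ⟨K, hK⟩ := exists_nat_ge (p / d)
  rw [div_le_iff₀ h.2.1] at hK
  induction K generalizing p N with
  | zero =>
    have := h.2.1; have := h.2.2.1
    simp at hK; linarith
  | succ K ih =>
    rcases le_or_gt p (2 * d) with hp | hp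
    · exact ⟨p, N, h, hp, le_rfl, rfl⟩
    · obtain ⟨d', n, h1, -, -, h2⟩ := h.step hR
      obtain ⟨rfl, rfl⟩ := h2 hp
      obtain ⟨p', N', h3, h4, h5, h6⟩ := ih h1 (by push_cast at hK; linarith)
      refine ⟨p', N', h3, h4, by linarith [h.2.1], ?_⟩
      rw [h6]; push_cast; ring

theorem State.next_event (hR : ∀ p q N (n : ℕ), R p q N → R q |p - 2 * n * q| (N + n)) {p d : ℝ} {N : ℕ}
    (h : State R p d N) (c : ℝ) : ∃ p' d' N', State R p' d' N' ∧ p' ≤ 2 * d' ∧ p' ≤ p - d ∧ d' ≤ d ∧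
      (c + (N' : ℕ)) * d' + p' ≤ (c + N) * d' + p := by
  obtain ⟨d', n, h1, h2, h3, -⟩ := h.step hR
  obtain ⟨p', N', h4, h5, h6, h7⟩ := h1.exists_event hR c
  refine ⟨p', d', N', h4, h5, h6, h2, ?_⟩
  rw [h7]; push_cast; nlinarith

/-- Two rounds, each a step followed by a run of slow steps, at least halve `d` and increase the
cost by an amount that contributes at most `3d` to the product. The summand `16 d` absorbs this: `(c
+ N) d / 2 + 3d + 8d` is at most three quarters of `(c + N) d + 16 d`. -/
theorem State.exists_contraction (hR : ∀ p q N (n : ℕ), R p q N → R q |p - 2 * n * q| (N + n)) {p d : ℝ}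
    {N : ℕ} (h : State R p d N) (hp : p ≤ 2 * d) {c : ℝ} (hc : 0 ≤ c) : ∃ p' d' N', State R p' d' N' ∧
      p' ≤ 2 * d' ∧ (c + (N' : ℕ)) * d' + 16 * d' ≤ 3 / 4 * ((c + N) * d + 16 * d) := by
  obtain ⟨p₁, d₁, N₁, h1, hp1, hp1', hd1, hx1⟩ := h.next_event hR c
  obtain ⟨p₂, d₂, N₂, h2, hp2, hp2', hd2, hx2⟩ := h1.next_event hR c
  refine ⟨p₂, d₂, N₂, h2, hp2, ?_⟩
  have d0 := h.2.1
  have d10 := h1.2.1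
  have d20 := h2.2.1
  -- Indeed `d₂ ≤ d₁` and `d₂ < p₂ ≤ p₁ - d₁`, so `2 d₂ ≤ p₁ ≤ p - d ≤ d`.
  have hhalf : d₂ ≤ d / 2 := by linarith [h2.2.2.1]
  have hM : (0 : ℝ) ≤ c + N := by positivity
  have h3 : (c + N₁) * d₁ ≤ (c + N) * d₁ + 2 * d := by linarith [h1.2.2.1]
  have h4 : (c + N₁) * d₂ ≤ (c + N) * d₂ + 2 * d := by
    rcases le_total (c + N₁ : ℝ) (c + N) with h5 | h5
    · nlinarith
    · nlinarith
  have h5 : (c + N) * d₂ ≤ (c + N) * (d / 2) := by gcongr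
  have h6 : 0 ≤ (c + N) * d := mul_nonneg hM d0.le
  linarith [h2.2.2.1]

/-- Iterating the contraction makes `(c + N') d'` small, and `p' ≤ 2 d'` at the end of each round.
So the vector shrinks faster than its cost grows. -/
theorem State.exists_small (hR : ∀ p q N (n : ℕ), R p q N → R q |p - 2 * n * q| (N + n)) {p d : ℝ} {N : ℕ}
    (h : State R p d N) {c : ℝ} (hc : 0 ≤ c) {ε : ℝ} (hε : 0 < ε) :
    ∃ p' d' N', State R p' d' N' ∧ (c + (N' : ℕ)) * p' < ε ∧ p' < ε := by
  obtain ⟨p₀, N₀, h₀, hp₀, -, -⟩ := h.exists_event hR c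
  have hiter : ∀ K : ℕ, ∃ p' d' N', State R p' d' N' ∧ p' ≤ 2 * d' ∧
      (c + (N' : ℕ)) * d' + 16 * d' ≤ (3 / 4) ^ K * ((c + N₀) * d + 16 * d) := by
    intro K
    induction K with
    | zero => exact ⟨p₀, d, N₀, h₀, hp₀, by simp⟩
    | succ K ih =>
      obtain ⟨p₁, d₁, N₁, h1, hp1, hx1⟩ := ih
      obtain ⟨p₂, d₂, N₂, h2, hp2, hx2⟩ := h1.exists_contraction hR hp1 hc
      refine ⟨p₂, d₂, N₂, h2, hp2, hx2.trans ?_⟩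
      rw [pow_succ]
      linarith
  have hB : 0 < (c + N₀) * d + 16 * d := by
    have := mul_nonneg (add_nonneg hc N₀.cast_nonneg) h.2.1.le
    linarith [h.2.1]
  obtain ⟨K, hK⟩ := exists_pow_lt_of_lt_one (div_pos (half_pos hε) hB) (show (3 / 4 : ℝ) < 1 by norm_num)
  rw [lt_div_iff₀ hB] at hK
  obtain ⟨p', d', N', h', hp', hx'⟩ := hiter K
  have hM : (0 : ℝ) ≤ c + N' := add_nonneg hc N'.cast_nonneg
  have hd' := h'.2.1
  have h1 : 0 ≤ (c + N') * d' := mul_nonneg hM hd'.le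
  have h2 : (c + N') * p' ≤ (c + N') * (2 * d') := by gcongr
  exact ⟨p', d', N', h', by linarith, by linarith⟩

end

end

section

/-! ### Renormalization and recurrence -/

/-- Some affine automorphism takes the vector `v` to `u`, and its inverse raises the level of a point
by at most `N`. -/
def Reach (u v : ℂ) (N : ℕ) : Prop :=
  ∃ (L : ℂ ≃L[ℝ] ℂ) (φ : S1 ≃ₜ S1), AffineAut L φ ∧ L v = u ∧
    ∀ c x, x ∈ lowPart c → φ.symm x ∈ lowPart (c + N)

theorem Reach.refl (u : ℂ) : Reach u u 0 :=
  ⟨_, _, AffineAut.refl, rfl, fun _ _ hx => hx⟩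

theorem Reach.mono {u v : ℂ} {M N : ℕ} (h : Reach u v M) (hMN : M ≤ N) : Reach u v N := by
  obtain ⟨L, φ, h1, h2, h3⟩ := h
  exact ⟨L, φ, h1, h2, fun c x hx => lowPart_mono (by omega) (h3 c x hx)⟩

theorem Reach.vshear {u v : ℂ} {N : ℕ} (h : Reach u v N) (a : ℤ) :
    Reach u (vshear a v) (N + a.natAbs) := by
  obtain ⟨L, φ, h1, h2, h3⟩ := h
  refine ⟨_, _, (affineAut_slide a).symm.trans h1, ?_, fun c x hx => ?_⟩
  · simp [h2]
  · rw [← add_assoc]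
    exact slideMap_mem_lowPart a (h3 c x hx)

/-- Twists are free of cost, since they preserve the low parts. -/
theorem Reach.hshear {u v : ℂ} {N : ℕ} (h : Reach u v N) (a : ℤ) : Reach u (hshear a v) N := by
  obtain ⟨L, φ, h1, h2, h3⟩ := h
  refine ⟨_, _, (affineAut_twist a).symm.trans h1, ?_, fun c x hx => ?_⟩
  · simp [h2]
  · exact twistMap_mem_lowPart a (h3 c x hx)

theorem exists_abs_add_eq (x y : ℝ) (n : ℕ) :
    ∃ a : ℤ, a.natAbs = n ∧ |x + 2 * a * y| = abs (|x| - 2 * n * |y|) := by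
  rcases abs_cases x with ⟨h1, -⟩ | ⟨h1, -⟩ <;> rcases abs_cases y with ⟨h2, -⟩ | ⟨h2, -⟩ <;> rw [h1, h2]
  · exact ⟨-n, by simp, by congr 1; push_cast; ring⟩
  · exact ⟨n, by simp, by congr 1; push_cast; ring⟩
  · exact ⟨n, by simp, by rw [← abs_neg]; congr 1; push_cast; ring⟩
  · exact ⟨-n, by simp, by rw [← abs_neg]; congr 1; push_cast; ring⟩

/-- A vector whose coordinates have the absolute values `p` and `q`, in some order, can be reached
from `u` at the cost `N`. -/
def ReachAbs (u : ℂ) (p q : ℝ) (N : ℕ) : Prop :=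
  ∃ v, Reach u v N ∧ (|v.re| = p ∧ |v.im| = q ∨ |v.re| = q ∧ |v.im| = p)

theorem ReachAbs.step (u : ℂ) (p q : ℝ) (N n : ℕ) (h : ReachAbs u p q N) :
    ReachAbs u q |p - 2 * n * q| (N + n) := by
  obtain ⟨v, hv, ⟨rfl, rfl⟩ | ⟨rfl, rfl⟩⟩ := h
  · obtain ⟨a, -, ha⟩ := exists_abs_add_eq v.re v.im n
    exact ⟨_, (hv.hshear a).mono (Nat.le_add_right _ _), Or.inr ⟨by simpa using ha, by simp⟩⟩
  · obtain ⟨a, rfl, ha⟩ := exists_abs_add_eq v.im v.re n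
    exact ⟨_, hv.vshear a, Or.inl ⟨by simp, by simpa using ha⟩⟩

/-- A relation `a * u.re + b * u.im = 0` would make `u` parallel to the lattice vector `(b, -a)`. -/
theorem IrrationalDir.incommensurable {u : ℂ} (hu : IrrationalDir u) : Incommensurable |u.re| |u.im| := by
  have key : ∀ a b : ℤ, a * u.re + b * u.im = 0 → a = 0 ∧ b = 0 := by
    intro a b h
    by_contra hab
    have hs : (0 : ℝ) < a ^ 2 + b ^ 2 := by
      rcases eq_or_ne a 0 with rfl | ha
      · have hb : b ≠ 0 := fun hb => hab ⟨rfl, hb⟩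
        positivity
      · positivity
    have hne : u.re ≠ 0 ∨ u.im ≠ 0 := by
      by_contra! h0
      have := hu 1 (mem_lat.2 ⟨⟨0, by simp [h0.1]⟩, 0, by simp [h0.2]⟩)
      norm_num at this
    rcases hne with h0 | h0
    · rcases eq_or_ne b 0 with rfl | hb
      · have ha : (a : ℝ) = 0 := by
          have : (a : ℝ) * u.re = 0 := by simpa using h
          exact (mul_eq_zero.1 this).resolve_right h0
        exact hab ⟨by exact_mod_cast ha, rfl⟩
      · have hb' : (b : ℝ) ≠ 0 := by exact_mod_cast hb
        have := hu (b / u.re) (mem_lat.2 ⟨⟨b, by simp [h0]⟩, -a, by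
          have : u.im = -(a * u.re) / b := by field_simp; linarith
          simp only [Complex.im_ofReal_mul, this]; push_cast; field_simp⟩)
        exact div_ne_zero hb' h0 this
    · rcases eq_or_ne a 0 with rfl | ha
      · have hb : (b : ℝ) = 0 := by
          have : (b : ℝ) * u.im = 0 := by simpa using h
          exact (mul_eq_zero.1 this).resolve_right h0
        exact hab ⟨rfl, by exact_mod_cast hb⟩
      · have ha' : (a : ℝ) ≠ 0 := by exact_mod_cast ha
        have := hu (a / u.im) (mem_lat.2 ⟨⟨-b, by
          have : u.re = -(b * u.im) / a := by field_simp; linarith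
          simp only [Complex.re_ofReal_mul, this]; push_cast; field_simp⟩, a, by simp [h0]⟩)
        exact div_ne_zero ha' h0 this
  intro a b h
  rcases abs_cases u.re with ⟨h1, -⟩ | ⟨h1, -⟩ <;> rcases abs_cases u.im with ⟨h2, -⟩ | ⟨h2, -⟩ <;> rw [h1, h2] at h
  · exact key a b h
  · simpa using key a (-b) (by push_cast; linarith)
  · simpa using key (-a) b (by push_cast; linarith)
  · simpa using key (-a) (-b) (by push_cast; linarith)

theorem Incommensurable.symm {p q : ℝ} (h : Incommensurable p q) : Incommensurable q p :=
  fun a b hab => (h b a (by linarith)).symm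

theorem IrrationalDir.exists_state {u : ℂ} (hu : IrrationalDir u) : ∃ p d, State (ReachAbs u) p d 0 := by
  have hi := hu.incommensurable
  have hre : 0 < |u.re| := abs_pos.2 fun h => by simpa using hi 1 0 (by simp [h])
  have him : 0 < |u.im| := abs_pos.2 fun h => by simpa using hi 0 1 (by simp [h])
  rcases lt_trichotomy |u.re| |u.im| with h | h | h
  · refine ⟨|u.im|, |u.im| - |u.re|, ⟨u, .refl u, Or.inr ⟨?_, rfl⟩⟩, by linarith, by linarith, ?_⟩
    · ring
    · rw [sub_sub_cancel]; exact hi.symm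
  · have := hi 1 (-1) (by push_cast; linarith)
    omega
  · refine ⟨|u.re|, |u.re| - |u.im|, ⟨u, .refl u, Or.inl ⟨rfl, ?_⟩⟩, by linarith, by linarith, ?_⟩
    · ring
    · rw [sub_sub_cancel]; exact hi

theorem IrrationalDir.exists_reach {u : ℂ} (hu : IrrationalDir u) (c : ℕ) {ε : ℝ} (hε : 0 < ε) :
    ∃ v N, Reach u v N ∧ (c + N : ℝ) * |v.im| < ε ∧ |v.im| < ε := by
  obtain ⟨p, d, h⟩ := hu.exists_state
  obtain ⟨p', d', N, ⟨⟨v, hv, hpq⟩, hd0, hdp, -⟩, h1, h2⟩ :=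
    h.exists_small (ReachAbs.step u) (c := c) c.cast_nonneg hε
  have h3 : |v.im| ≤ p' := by rcases hpq with ⟨-, h⟩ | ⟨-, h⟩ <;> linarith
  have h4 : (c + N : ℝ) * |v.im| ≤ (c + N) * p' := by gcongr
  exact ⟨v, N, hv, by linarith, by linarith⟩

/-- The set is the image of `lowPart (c + N)` under an automorphism that takes a nearly horizontal
`v` to `u`. Pulled back, a generic point that leaves it in unit time starts in a collar of small
area. -/
theorem IrrationalDir.exists_small_exit {u : ℂ} (hu : ‖u‖ = 1) (hi : IrrationalDir u) (c : ℕ) {ε : ℝ≥0∞}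
    (hε : ε ≠ 0) : ∃ F, MeasurableSet F ∧ lowPart c ⊆ F ∧ area F ≠ ∞ ∧
      area (F \ flowEquiv hu ⁻¹' F) ≤ ε := by
  obtain ⟨δ, hδ, hδε⟩ : ∃ δ : ℝ, 0 < δ ∧ ENNReal.ofReal δ ≤ ε := by
    rcases eq_or_ne ε ∞ with rfl | h
    · exact ⟨1, one_pos, le_top⟩
    · exact ⟨ε.toReal, ENNReal.toReal_pos hε h, ENNReal.ofReal_toReal_le⟩
  have hu0 : u ≠ 0 := fun h => by simp [h] at hu
  -- The `3` and the `24` are those of `area_collar_le`; the bound `1` is the one on `|v.im|` in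
  -- `mem_collar_of_exit`.
  obtain ⟨v, N, ⟨L, φ, hL, rfl, hN⟩, h1, h2⟩ := hi.exists_reach (c + 3) (lt_min one_pos (show 0 < δ / 24 by positivity))
  have h2' := h2.trans_le (min_le_left _ _)
  have h1' := h1.trans_le (min_le_right _ _)
  refine ⟨φ '' lowPart (c + N), (hL.measurable_image (measurableSet_lowPart _)).1, fun x hx =>
    ⟨φ.symm x, hN c x hx, φ.apply_symm_apply x⟩,
    ne_top_of_le_ne_top (area_lowPart _) (hL.measurable_image (measurableSet_lowPart _)).2, ?_⟩
  have hsub : φ '' lowPart (c + N) \ flowEquiv hu ⁻¹' (φ '' lowPart (c + N)) ⊆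
      φ '' collar (c + N) |v.im| ∪ (generic (L v))ᶜ := by
    rintro _ ⟨⟨y, hy, rfl⟩, hx⟩
    by_cases hg : φ y ∈ generic (L v)
    · refine Or.inl ⟨y, ?_, rfl⟩
      have hs := hL.symm.straight_map (u' := v) (c := 1) (by simp) (isTrajectory_flow hu hg).straight
      simp only [mem_univ, one_mul, ofPred_true] at hs
      have := mem_collar_of_exit (N := c + N) h2' hs
      simp only [flow_zero hu, Homeomorph.symm_apply_apply] at this
      refine this hy fun h => hx ⟨_, h, φ.apply_symm_apply _⟩
    · exact Or.inr hg
  calc area _ ≤ area (φ '' collar (c + N) |v.im| ∪ (generic (L v))ᶜ) := measure_mono hsub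
    _ ≤ area (φ '' collar (c + N) |v.im|) + area (generic (L v))ᶜ := measure_union_le _ _
    _ = area (φ '' collar (c + N) |v.im|) := by rw [area_compl_generic hu0, add_zero]
    _ ≤ area (collar (c + N) |v.im|) := (hL.measurable_image (measurableSet_collar _ _)).2
    _ ≤ ENNReal.ofReal (24 * ((c + N : ℕ) + 3) * |v.im|) := area_collar_le _ (abs_nonneg _) h2'.le
    _ ≤ ENNReal.ofReal δ := ENNReal.ofReal_le_ofReal (by push_cast at h1' ⊢; linarith)
    _ ≤ ε := hδε

/-- Conservativity of the time `1` map already gives returns at arbitrarily large integer times. -/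
theorem IrrationalDir.isRecurrent {u : ℂ} (hu : ‖u‖ = 1) (hi : IrrationalDir u) : IsRecurrent u := by
  have hu0 : u ≠ 0 := fun h => by simp [h] at hu
  have hc : Conservative (flowEquiv hu) area :=
    conservative_of_small_exit _ (measurePreserving_flowEquiv hu) measurableSet_lowPart iUnion_lowPart
      fun c ε hε => hi.exists_small_exit hu c hε
  intro A hA
  have hg : ∀ᵐ x ∂area, x ∈ generic u := area_compl_generic hu0
  filter_upwards [hc.ae_mem_imp_frequently_image_mem hA.nullMeasurableSet, hg] with x hx hxg hxA
  refine ⟨univ, fun t => flow u t x, isTrajectory_flow hu hxg, mem_univ _, flow_zero hu, fun T => ?_⟩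
  obtain ⟨n, hn, hnA⟩ := ((hx hxA).and_eventually (eventually_gt_atTop ⌈T⌉₊)).exists.imp fun n h => h.symm
  rw [flowEquiv_iterate] at hnA
  exact ⟨n, mem_univ _, Nat.lt_of_ceil_lt hn, hnA⟩

theorem irrationalDir_of_slope {u : ℂ} {x : ℝ} (hx : Irrational x) (h : slope u = (x : OnePoint ℝ)) :
    IrrationalDir u := by
  unfold slope frac at h
  split_ifs at h with h0
  · exact absurd h (OnePoint.infty_ne_coe x)
  · have h1 : u.im / u.re = x := OnePoint.coe_injective h
    rw [div_eq_iff h0] at h1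
    intro r hr
    obtain ⟨⟨a, ha⟩, b, hb⟩ := mem_lat.1 hr
    rw [Complex.re_ofReal_mul] at ha
    rw [Complex.im_ofReal_mul, h1] at hb
    by_contra hr0
    refine hx ⟨b / a, ?_⟩
    have ha0 : (a : ℝ) ≠ 0 := ha ▸ mul_ne_zero hr0 h0
    push_cast
    rw [div_eq_iff ha0, ← ha, ← hb]
    ring

end

end ParabolaSurface

end

theorem mainTheorem6 (m : OnePoint ℝ) (u : ℂ) (hu : ‖u‖ = 1)
    (hm : ParabolaSurface.slope u = m) :
    ((ParabolaSurface.IsRationalCongr m 0 1 ∨ ParabolaSurface.IsRationalCongr m 1 1) →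
      ParabolaSurface.IsCompletelyPeriodic u) ∧
    (ParabolaSurface.IsRationalCongr m 1 0 →
      (∃ 𝒞 : Set (Set ParabolaSurface.S1),
        (∀ C ∈ 𝒞, ParabolaSurface.IsInfiniteStrip u C) ∧ ParabolaSurface.IsDecomposition u 𝒞) ∧
      ∀ (J : Set ℝ) (γ : ℝ → ParabolaSurface.S1), ParabolaSurface.IsTrajectory u J γ →
        ¬ (ParabolaSurface.SingularForward J γ ∧ ParabolaSurface.SingularBackward J γ) ∧
        (¬ ParabolaSurface.SingularForward J γ → ParabolaSurface.EscapesForward J γ) ∧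
        (¬ ParabolaSurface.SingularBackward J γ → ParabolaSurface.EscapesBackward J γ)) ∧
    (∀ x : ℝ, Irrational x → m = (x : OnePoint ℝ) →
      ParabolaSurface.IsRecurrent u ∧
      ∀ (J : Set ℝ) (γ : ℝ → ParabolaSurface.S1), ParabolaSurface.IsTrajectory u J γ →
        ¬ ParabolaSurface.IsClosedTrajectory J γ ∧ ¬ ParabolaSurface.IsSaddleConnection J γ) := by
  subst hm
  have hu0 : u ≠ 0 := fun h => by simp [h] at hu
  refine ⟨ParabolaSurface.isCompletelyPeriodic_of_slope hu0, ParabolaSurface.isStripDirection_of_slope hu0,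
    fun x hx hm => ?_⟩
  have hi := ParabolaSurface.irrationalDir_of_slope hx hm
  exact ⟨hi.isRecurrent hu, fun J γ hγ => ⟨hi.not_isClosedTrajectory hγ, hi.not_isSaddleConnection hγ⟩⟩
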